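/- Let $2\le r_1\le r_2$ be integers, $A_i=\{0,\dots,r_i-1\}$, $s=\log r_1/\log r_2$, and let $\mathbb A_i=A_i^{\mathbb N^*}$ carry the distance $d_i(z,z')=r_i^{-|z\wedge z'|}$, where $|z\wedge z'|$ is the length of the longest common prefix of $z$ and $z'$. Endow $\mathbb A_1\times\mathbb A_2$ (the symbolic space over $A_1\times A_2$) with the distance $\max(d_1,d_2)$ and the shift $\sigma$, and write $B_n(z)$ for its closed ball of centre $z$ and radius $r_2^{-n}$. For a finite alphabet $A$, a nonnegative function $\psi$ of the cylinders over $A$, not identically zero, is almost multiplicative if there is $C>0$ with $$C^{-1}\psi([w])\psi([w'])\le\psi([w w'])\le C\,\psi([w])\psi([w'])$$ for all finite words $w,w'$; its pressure is $P(\log\psi)=\lim_{n\to\infty}\frac1n\log\sum_{|w|=n}\psi([w])$. The convention $0^\gamma=0$ is used for all $\gamma\in\mathbb R$. Let $\psi$ be an almost multiplicative function of the cylinders $[w_1]\times[w_2]$ ($|w_1|=|w_2|$) of $\mathbb A_1\times\mathbb A_2$ with $P(\log\psi)=0$, let $\operatorname{supp}(\psi)$ be the set of $z$ such that $\psi([z|n])>0$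 for all $n\ge 0$, where $z|n$ is the prefix of $z$ of length $n$, and let $\mu_\psi$ be the Gibbs measure of $\psi$, that is, the ergodic $\sigma$-invariant Borel probability measure carried by $\operatorname{supp}(\psi)$ for which there is $C>0$ such that $C^{-1}e^{-nP(\log\psi)}\psi([w])\le\mu_\psi([w])\le C e^{-nP(\log\psi)}\psi([w])$ for all $n\ge 0$ and all words $w$ of length $n$ over $A_1\times A_2$. For $q\in\mathbb R$ put $$I_{\psi,q}([w_1])=\sum_{|w_2|=|w_1|}\psi([w_1]\times[w_2])^q,\qquad \beta_\psi(q)=-\frac{P\big(q(1-s)\log I_{\psi,1}+s\log I_{\psi,q}\big)}{\log r_1},$$ the pressure being that of the function $I_{\psi,1}^{q(1-s)}I_{\psi,q}^{s}$ of the cylinders of $\mathbb A_1$. For $\alpha\ge 0$ put $\beta_\psi^*(\alpha)=\inf_{q\in\mathbb R}(\alpha q-\beta_\psi(q))\in\mathbb R\cup\{-\infty\}$ and $$E_{\mu_\psi}(\alpha)=\Big\{z\in\operatorname{supp}(\psi):\ \lim_{n\to\infty}\frac{\log_{r_2}\mu_\psi(B_n(z))}{-n}=\alpha\Big\}.$$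 (i) For every $q\in\mathbb R$ the limit defining $\beta_\psi(q)$ exists in $\mathbb R$, and $\beta_\psi$ is concave, differentiable and non-decreasing on $\mathbb R$. (ii) For every $\alpha\ge 0$, the Hausdorff dimension of $E_{\mu_\psi}(\alpha)$ equals $\beta_\psi^*(\alpha)$ if $\beta_\psi^*(\alpha)>0$, and $E_{\mu_\psi}(\alpha)=\emptyset$ if $\beta_\psi^*(\alpha)<0$. -/

import Mathlib

open Filter Topology MeasureTheory
open scoped ENNReal

namespace SelfAffine

noncomputable section

/-! ### Almost-multiplicative functions of cylinders

A finite word over the alphabet `A` is a list. As soon as `A` has two letters, the word `w` is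
determined by its cylinder `[w]`, so a function of cylinders is a function of words, and
`[w] · [w'] = [w · w']` is the concatenation `w ++ w'`. -/

/-- `ψ` is almost multiplicative: nonnegative, non-zero, and
`C⁻¹ ψ([w]) ψ([w']) ≤ ψ([w]·[w']) ≤ C ψ([w]) ψ([w'])` for some constant `C > 0`. -/
structure AlmostMultiplicative {A : Type*} (ψ : List A → ℝ) : Prop where
  nonneg : ∀ w, 0 ≤ ψ w
  nonzero : ∃ w, ψ w ≠ 0
  bounds : ∃ C : ℝ, 0 < C ∧ ∀ w w' : List A,
    C⁻¹ * (ψ w * ψ w') ≤ ψ (w ++ w') ∧ ψ (w ++ w') ≤ C * (ψ w * ψ w')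

/-- The sequence `(1/n) log ∑_{|w| = n} f([w])`. -/
def pressureSeq {A : Type*} [Fintype A] (f : List A → ℝ) (n : ℕ) : ℝ :=
  (1 / (n : ℝ)) * Real.log (∑ w : Fin n → A, f (List.ofFn w))

/-- The topological pressure `P(log f) = lim (1/n) log ∑_{|w| = n} f([w])`. -/
def pressure {A : Type*} [Fintype A] (f : List A → ℝ) : ℝ :=
  limUnder atTop (pressureSeq f)

/-- Real powers with the convention `0 ^ γ = 0` for all real `γ` (including `γ = 0`). -/
def pow₀ (x γ : ℝ) : ℝ := if x = 0 then 0 else x ^ γ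

/-! ### Symbolic spaces -/

/-- The symbolic space of infinite words over the alphabet `{0, …, r - 1}`. -/
def SymbolicSpace (r : ℕ) : Type := ℕ → Fin r

/-- The ultrametric distance `r ^ (-|z ∧ z'|)`, where `z ∧ z'` is the longest common prefix. -/
instance (r : ℕ) : MetricSpace (SymbolicSpace r) where
  dist z z' := open Classical in
    if z = z' then 0 else ((r : ℝ)⁻¹) ^ (PiNat.firstDiff (E := fun _ => Fin r) z z')
  dist_self z := by simp
  dist_comm z z' := by
    by_cases h : z = z'
    · subst h; rfl
    · simp only [h, Ne.symm h, if_false, PiNat.firstDiff_comm (E := fun _ => Fin r) z z']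
  dist_triangle x y z := by
    have hr : (1 : ℝ) ≤ r := by
      have : 0 < r := (x 0).pos
      exact_mod_cast this
    have h0 : (0 : ℝ) ≤ (r : ℝ)⁻¹ := by positivity
    have h1 : (r : ℝ)⁻¹ ≤ 1 := inv_le_one_of_one_le₀ hr
    by_cases hxz : x = z
    · simp only [hxz, if_true]
      positivity
    by_cases hxy : x = y
    · subst hxy; simp
    by_cases hyz : y = z
    · subst hyz; simp
    simp only [hxz, hxy, hyz, if_false]
    have h := PiNat.min_firstDiff_le (E := fun _ => Fin r) x y z hxz
    rcases min_le_iff.1 h with h | h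
    · exact (pow_le_pow_of_le_one h0 h1 h).trans (le_add_of_nonneg_right (by positivity))
    · exact (pow_le_pow_of_le_one h0 h1 h).trans (le_add_of_nonneg_left (by positivity))
  eq_of_dist_eq_zero {x y} h := by
    by_contra hxy
    have hr : (r : ℝ) ≠ 0 := by
      have : 0 < r := (x 0).pos
      exact_mod_cast this.ne'
    simp only [hxy, if_false] at h
    exact pow_ne_zero _ (inv_ne_zero hr) h

instance (r : ℕ) : MeasurableSpace (SymbolicSpace r) := borel _

instance (r : ℕ) : BorelSpace (SymbolicSpace r) := ⟨rfl⟩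

/-- The self-affine symbolic space `𝔸₁ × 𝔸₂`. As a product of metric spaces it carries the
distance `max (d₁(x, x')) (d₂(y, y'))`. -/
abbrev Carpet (r₁ r₂ : ℕ) : Type := SymbolicSpace r₁ × SymbolicSpace r₂

variable {r₁ r₂ : ℕ}

/-- The shift `σ = (σ₁, σ₂)` on `𝔸₁ × 𝔸₂`. -/
def shift (z : Carpet r₁ r₂) : Carpet r₁ r₂ := (fun n => z.1 (n + 1), fun n => z.2 (n + 1))

/-- The prefix `z|n` of length `n` of `z = (x, y)`, as a word over `A₁ × A₂`. -/
def prefixWord (z : Carpet r₁ r₂) (n : ℕ) : List (Fin r₁ × Fin r₂) :=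
  List.ofFn fun i : Fin n => (z.1 i, z.2 i)

/-- The cylinder `[w]` of `𝔸₁ × 𝔸₂`, for a word `w` over `A₁ × A₂`. -/
def cylinder (w : List (Fin r₁ × Fin r₂)) : Set (Carpet r₁ r₂) :=
  {z | prefixWord z w.length = w}

/-- `supp(ψ) = {z : ψ([z|n]) > 0 for all n ≥ 0}`. -/
def supp (ψ : List (Fin r₁ × Fin r₂) → ℝ) : Set (Carpet r₁ r₂) :=
  {z | ∀ n, 0 < ψ (prefixWord z n)}

/-- `μ` is the Gibbs measure of `ψ`: an ergodic shift-invariant Borel probability measure,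
concentrated on `supp(ψ)`, such that, for a constant `C > 0` and all words `w`,
`C⁻¹ exp(-|w| P(log ψ)) ψ([w]) ≤ μ([w]) ≤ C exp(-|w| P(log ψ)) ψ([w])`. -/
structure IsGibbsMeasure (ψ : List (Fin r₁ × Fin r₂) → ℝ) (μ : Measure (Carpet r₁ r₂)) :
    Prop where
  isProbabilityMeasure : IsProbabilityMeasure μ
  ergodic : Ergodic shift μ
  ae_mem_supp : ∀ᵐ z ∂μ, z ∈ supp ψ
  bounds : ∃ C : ℝ, 0 < C ∧ ∀ w : List (Fin r₁ × Fin r₂),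
    C⁻¹ * (Real.exp (-(w.length : ℝ) * pressure ψ) * ψ w) ≤ μ.real (cylinder w) ∧
    μ.real (cylinder w) ≤ C * (Real.exp (-(w.length : ℝ) * pressure ψ) * ψ w)

/-! ### The function `β_ψ` -/

/-- `I_{ψ,q}([w₁]) = ∑_{|w₂| = |w₁|} ψ([w₁] × [w₂]) ^ q`. -/
def fiberSum (ψ : List (Fin r₁ × Fin r₂) → ℝ) (q : ℝ) (w₁ : List (Fin r₁)) : ℝ :=
  ∑ w₂ : Fin w₁.length → Fin r₂, pow₀ (ψ (List.ofFn fun i => (w₁.get i, w₂ i))) q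

/-- The exponent `s = log r₁ / log r₂`. -/
def sExp (r₁ r₂ : ℕ) : ℝ := Real.log r₁ / Real.log r₂

/-- `I_{ψ,1} ^ (q (1 - s)) · I_{ψ,q} ^ s`, a function of the cylinders of `𝔸₁`. -/
def weight (ψ : List (Fin r₁ × Fin r₂) → ℝ) (q : ℝ) (w₁ : List (Fin r₁)) : ℝ :=
  pow₀ (fiberSum ψ 1 w₁) (q * (1 - sExp r₁ r₂)) * pow₀ (fiberSum ψ q w₁) (sExp r₁ r₂)

/-- `β_ψ(q) = -P(q (1 - s) log I_{ψ,1} + s log I_{ψ,q}) / log r₁`. -/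
def beta (ψ : List (Fin r₁ × Fin r₂) → ℝ) (q : ℝ) : ℝ :=
  -pressure (weight ψ q) / Real.log r₁

/-! ### The spectrum -/

/-- The Legendre transform `f^*(α) = inf_q (α q - f(q))`, with values in `[-∞, ∞]`. -/
def legendre (f : ℝ → ℝ) (α : ℝ) : EReal := ⨅ q : ℝ, ((α * q - f q : ℝ) : EReal)

/-- `E_μ(α)`: the points `z` of `supp(ψ)` such that `log_{r₂} μ(B_n(z)) / (-n) → α`, where
`B_n(z)` is the closed ball of centre `z` and radius `r₂ ^ (-n)`. -/
def levelSet (ψ : List (Fin r₁ × Fin r₂) → ℝ) (μ : Measure (Carpet r₁ r₂)) (α : ℝ) :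
    Set (Carpet r₁ r₂) :=
  {z ∈ supp ψ | Tendsto
    (fun n : ℕ => Real.logb r₂ (μ.real (Metric.closedBall z (((r₂ : ℝ)⁻¹) ^ n))) / (-(n : ℝ)))
    atTop (𝓝 α)}

end

end SelfAffine

/-! Write L(n) for the least integer with r₁^L(n) ≥ r₂^n, so n ≤ s·L(n) ≤ n + 1. The ball of radius
r₂^(-n) about z = (x, y) fixes L(n) letters of x and n letters of y. By almost multiplicativity its
`μ`-mass is, up to a constant, ψ(z|n) · I₁(x|L(n)) / I₁(x|n), where I_q stands for `fiberSum ψ q`.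
All estimates start from this formula (`QuasiMul.abs_log_closedBall_sub_le`).

Regularity of β. The logarithm of the partition function of `weight ψ q` differs from n·P(q) by at
most |q| log C. Jensen's inequality, on the base and in the fibres, gives it a supporting line at
each q, whence convexity of P. For differentiability, `lift ψ q` spreads the weight over the fibres
and, once normalized, is comparable to the cylinder masses p of an invariant law (Banach limits).
Under p the two halves of a word are independent up to a factor, so doubling the length contracts
the normalized variance of log I₁ and log ψ. These logarithms then have means, and exponential
moments at tilt t/2^k are at most 4 for large k. Hence the increments of P at scale 2^(-k) are at
most t·lam + K with K independent of t, which forces a convex function to be differentiable.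
Monotonicity holds because P(log ψ) = 0 keeps ψ and I₁ bounded.

Upper bound and emptiness. For G(n) = log I_q(x|n) - q log I₁(x|n), the ball weight of the
normalized lift at z is, up to constants, r₂^(nβ(q)) · μ(B_n(z))^q · exp(s·G(L(n)) - G(n)). As G
grows at most linearly and L(n) is close to n/s, the last exponent is at least -ηn for infinitely
many n (`frequently_le_of_abs_le`). At points of the level set such balls have weight at least
r₂^(-nd) as soon as d > αq - β(q). The weights of disjoint balls have bounded sum, so the
d-dimensional Hausdorff measure is finite for d ≥ 0; when αq - β(q) < 0, a negative d can be chosen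
and no such point exists.

Lower bound. If D ≤ αq - β(q) for all q, a penalized minimization finds q with β'(q) near α and
qβ'(q) - β(q) ≥ D, even if the infimum is not attained. The lift at q, normalized on words of length
n, is a `BlockLaw` with nearly the right energy and entropy. Independent blocks with slowly growing
lengths and improving laws are concatenated; a law of large numbers puts almost every concatenation
in the level set and bounds the mass of balls about it, and the mass distribution principle
(`le_dimH_of_measure_closedBall_le`) gives dimension at least every positive d < D. -/

namespace SelfAffine

noncomputable section

/-! ### Sums over words of a given length -/

/-- The sum of `f` over the words of length `n`. -/
def wsum {A : Type*} [Fintype A] (n : ℕ) (f : List A → ℝ) : ℝ := ∑ w : Fin n → A, f (List.ofFn w)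

theorem zip_ofFn {A B : Type*} {n : ℕ} (u : Fin n → A) (v : Fin n → B) :
    (List.ofFn u).zip (List.ofFn v) = List.ofFn fun i => (u i, v i) := by
  apply List.ext_get
  · simp
  · intro i h1 h2
    simp

section wsum

variable {A : Type*} [Fintype A] {f g : List A → ℝ} {n : ℕ}

theorem wsum_congr (h : ∀ w : List A, w.length = n → f w = g w) : wsum n f = wsum n g :=
  Finset.sum_congr rfl fun _ _ => h _ (List.length_ofFn)

theorem wsum_mono (h : ∀ w : List A, w.length = n → f w ≤ g w) : wsum n f ≤ wsum n g :=
  Finset.sum_le_sum fun _ _ => h _ (List.length_ofFn)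

theorem wsum_nonneg (h : ∀ w : List A, w.length = n → 0 ≤ f w) : 0 ≤ wsum n f :=
  Finset.sum_nonneg fun _ _ => h _ (List.length_ofFn)

theorem wsum_mul_left (c : ℝ) : wsum n (fun w => c * f w) = c * wsum n f :=
  (Finset.mul_sum _ _ _).symm

theorem wsum_mul_right (c : ℝ) : wsum n (fun w => f w * c) = wsum n f * c :=
  (Finset.sum_mul _ _ _).symm

theorem wsum_div (c : ℝ) : wsum n (fun w => f w / c) = wsum n f / c :=
  (Finset.sum_div _ _ _).symm

theorem wsum_add : wsum n (fun w => f w + g w) = wsum n f + wsum n g :=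
  Finset.sum_add_distrib

theorem wsum_sub : wsum n (fun w => f w - g w) = wsum n f - wsum n g :=
  Finset.sum_sub_distrib _ _

theorem wsum_zero (f : List A → ℝ) : wsum 0 f = f [] := by
  simp [wsum]

theorem wsum_const_zero : wsum n (fun _ : List A => (0 : ℝ)) = 0 := by
  simp [wsum]

theorem le_wsum (h : ∀ w : List A, 0 ≤ f w) (w : List A) : f w ≤ wsum w.length f := by
  have := Finset.single_le_sum (f := fun u : Fin w.length → A => f (List.ofFn u))
    (fun u _ => h _) (Finset.mem_univ w.get)
  simpa [wsum] using this

theorem wsum_append (m n : ℕ) (f : List A → ℝ) :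
    wsum (m + n) f = wsum m fun u => wsum n fun v => f (u ++ v) := by
  unfold wsum
  rw [← (Fin.appendEquiv m n).sum_comp, Fintype.sum_prod_type]
  refine Finset.sum_congr rfl fun u _ => Finset.sum_congr rfl fun v _ => ?_
  simp [Fin.appendEquiv, List.ofFn_fin_append]

theorem wsum_comm {B : Type*} [Fintype B] (m n : ℕ) (f : List A → List B → ℝ) :
    (wsum m fun u => wsum n fun v => f u v) = wsum n fun v => wsum m fun u => f u v :=
  Finset.sum_comm

theorem wsum_zip {B : Type*} [Fintype B] (n : ℕ) (f : List (A × B) → ℝ) :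
    wsum n f = wsum n fun u => wsum n fun v => f (u.zip v) := by
  unfold wsum
  rw [← (Equiv.arrowProdEquivProdArrow (Fin n) (fun _ => A) (fun _ => B)).symm.sum_comp,
    Fintype.sum_prod_type]
  refine Finset.sum_congr rfl fun u _ => Finset.sum_congr rfl fun v _ => ?_
  simp only [zip_ofFn]
  rfl

end wsum

theorem map_fst_zip {A B : Type*} {u : List A} {v : List B} (h : v.length = u.length) :
    (u.zip v).map Prod.fst = u := by
  rw [List.map_fst_zip]; exact h.ge

/-! ### Quasi-multiplicative functions -/

theorem pow₀_zero (γ : ℝ) : pow₀ 0 γ = 0 := if_pos rfl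

theorem pow₀_of_pos {x : ℝ} (hx : 0 < x) (γ : ℝ) : pow₀ x γ = x ^ γ := if_neg hx.ne'

theorem pow₀_nonneg {x : ℝ} (hx : 0 ≤ x) (γ : ℝ) : 0 ≤ pow₀ x γ := by
  unfold pow₀; split_ifs
  · rfl
  · positivity

theorem pow₀_pos {x : ℝ} (hx : 0 < x) (γ : ℝ) : 0 < pow₀ x γ := by
  rw [pow₀_of_pos hx]; positivity

theorem pow₀_one (x : ℝ) : pow₀ x 1 = x := by
  unfold pow₀; split_ifs with h <;> simp [h]

/-- An almost multiplicative function that is positive at the empty word, with explicit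
constant. -/
structure QuasiMul {A : Type*} (C : ℝ) (f : List A → ℝ) : Prop where
  one_le : 1 ≤ C
  nonneg : ∀ w, 0 ≤ f w
  nil_pos : 0 < f []
  lower : ∀ u v, f u * f v ≤ C * f (u ++ v)
  upper : ∀ u v, f (u ++ v) ≤ C * (f u * f v)

namespace QuasiMul

variable {A B : Type*} {C C' : ℝ} {f g : List A → ℝ}

theorem pos (h : QuasiMul C f) : 0 < C := zero_lt_one.trans_le h.one_le

/-- A word with f w > 0 satisfies f w ≤ C · f w · f [], so the empty word cannot have value zero.
Enlarging the constant to at least 1 makes log C a legitimate error bound. -/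
theorem _root_.SelfAffine.AlmostMultiplicative.quasiMul (h : AlmostMultiplicative f) :
    ∃ C, QuasiMul C f := by
  obtain ⟨C, hC, hb⟩ := h.bounds
  obtain ⟨w, hw⟩ := h.nonzero
  have hw' : 0 < f w := (h.nonneg w).lt_of_ne hw.symm
  refine ⟨max C 1, le_max_right _ _, h.nonneg, ?_, fun u v => ?_, fun u v => ?_⟩
  · refine (h.nonneg _).lt_of_ne fun h0 => ?_
    have := (hb w []).2
    rw [← h0] at this
    simp at this
    exact absurd hw' this.not_gt
  · have := (hb u v).1
    rw [inv_mul_le_iff₀ hC] at this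
    exact this.trans (mul_le_mul_of_nonneg_right (le_max_left _ _) (h.nonneg _))
  · exact (hb u v).2.trans (mul_le_mul_of_nonneg_right (le_max_left _ _)
      (mul_nonneg (h.nonneg _) (h.nonneg _)))

/-- Both bounds vanish together with the product, so the support is stable under factors and under
concatenation. Logarithms may therefore be taken on the support without further care. -/
theorem append_pos_iff (h : QuasiMul C f) {u v : List A} :
    0 < f (u ++ v) ↔ 0 < f u ∧ 0 < f v := by
  constructor
  · intro h0
    have h1 := h0.trans_le (h.upper u v)
    have h2 : 0 < f u * f v := (mul_pos_iff_of_pos_left h.pos).1 h1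
    refine ⟨(h.nonneg u).lt_of_ne ?_, (h.nonneg v).lt_of_ne ?_⟩ <;> intro h3 <;>
      simp [← h3] at h2
  · rintro ⟨hu, hv⟩
    have := (mul_pos hu hv).trans_le (h.lower u v)
    exact (mul_pos_iff_of_pos_left h.pos).1 this

theorem abs_log_append_le (h : QuasiMul C f) {u v : List A} (h0 : 0 < f (u ++ v)) :
    |Real.log (f (u ++ v)) - Real.log (f u) - Real.log (f v)| ≤ Real.log C := by
  obtain ⟨hu, hv⟩ := h.append_pos_iff.1 h0
  have h1 := Real.log_le_log (mul_pos hu hv) (h.lower u v)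
  have h2 := Real.log_le_log h0 (h.upper u v)
  rw [Real.log_mul hu.ne' hv.ne', Real.log_mul h.pos.ne' h0.ne'] at h1
  rw [Real.log_mul h.pos.ne' (mul_pos hu hv).ne', Real.log_mul hu.ne' hv.ne'] at h2
  rw [abs_le]; constructor <;> linarith

theorem log_nonneg (h : QuasiMul C f) : 0 ≤ Real.log C := Real.log_nonneg h.one_le

theorem mul (hf : QuasiMul C f) (hg : QuasiMul C' g) :
    QuasiMul (C * C') fun w => f w * g w where
  one_le := one_le_mul_of_one_le_of_one_le hf.one_le hg.one_le
  nonneg w := mul_nonneg (hf.nonneg w) (hg.nonneg w)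
  nil_pos := mul_pos hf.nil_pos hg.nil_pos
  lower u v := by
    have := mul_le_mul (hf.lower u v) (hg.lower u v)
      (mul_nonneg (hg.nonneg _) (hg.nonneg _)) (mul_nonneg hf.pos.le (hf.nonneg _))
    linarith
  upper u v := by
    have := mul_le_mul (hf.upper u v) (hg.upper u v) (hg.nonneg _)
      (mul_nonneg hf.pos.le (mul_nonneg (hf.nonneg _) (hf.nonneg _)))
    linarith

theorem mono (hf : QuasiMul C f) (h : C ≤ C') : QuasiMul C' f where
  one_le := hf.one_le.trans h
  nonneg := hf.nonneg
  nil_pos := hf.nil_pos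
  lower u v := (hf.lower u v).trans (mul_le_mul_of_nonneg_right h (hf.nonneg _))
  upper u v := (hf.upper u v).trans (mul_le_mul_of_nonneg_right h
    (mul_nonneg (hf.nonneg _) (hf.nonneg _)))

theorem congr (hf : QuasiMul C f) (h : ∀ w, f w = g w) : QuasiMul C g := by
  have : f = g := funext h
  rwa [← this]

/-- In logarithms the defect is multiplied by q, hence |q| in the constant whatever the sign. The
convention 0 ^ q = 0 preserves the support, which is what makes negative and zero exponents
harmless. -/
theorem pow (hf : QuasiMul C f) (q : ℝ) : QuasiMul (C ^ |q|) fun w => pow₀ (f w) q where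
  one_le := Real.one_le_rpow hf.one_le (abs_nonneg q)
  nonneg w := pow₀_nonneg (hf.nonneg w) q
  nil_pos := pow₀_pos hf.nil_pos q
  lower u v := by
    by_cases h0 : 0 < f (u ++ v)
    · obtain ⟨hu, hv⟩ := hf.append_pos_iff.1 h0
      have h1 := hf.abs_log_append_le h0
      rw [pow₀_of_pos h0, pow₀_of_pos hu, pow₀_of_pos hv, Real.rpow_def_of_pos h0,
        Real.rpow_def_of_pos hu, Real.rpow_def_of_pos hv, Real.rpow_def_of_pos hf.pos,
        ← Real.exp_add, ← Real.exp_add, Real.exp_le_exp]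
      have h2 : |q * (Real.log (f (u ++ v)) - Real.log (f u) - Real.log (f v))|
          ≤ |q| * Real.log C := by
        rw [abs_mul]; exact mul_le_mul_of_nonneg_left h1 (abs_nonneg q)
      have := neg_le_of_abs_le h2
      linarith
    · have : ¬ (0 < f u ∧ 0 < f v) := fun h => h0 (hf.append_pos_iff.2 h)
      have h3 : pow₀ (f u) q * pow₀ (f v) q = 0 := by
        by_cases hu : 0 < f u
        · have : f v = 0 := le_antisymm (not_lt.1 fun h => this ⟨hu, h⟩) (hf.nonneg v)
          simp [this, pow₀_zero]
        · have : f u = 0 := le_antisymm (not_lt.1 hu) (hf.nonneg u)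
          simp [this, pow₀_zero]
      rw [h3]
      exact mul_nonneg (Real.rpow_nonneg hf.pos.le _) (pow₀_nonneg (hf.nonneg _) q)
  upper u v := by
    by_cases h0 : 0 < f (u ++ v)
    · obtain ⟨hu, hv⟩ := hf.append_pos_iff.1 h0
      have h1 := hf.abs_log_append_le h0
      rw [pow₀_of_pos h0, pow₀_of_pos hu, pow₀_of_pos hv, Real.rpow_def_of_pos h0,
        Real.rpow_def_of_pos hu, Real.rpow_def_of_pos hv, Real.rpow_def_of_pos hf.pos,
        ← Real.exp_add, ← Real.exp_add, Real.exp_le_exp]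
      have h2 : |q * (Real.log (f (u ++ v)) - Real.log (f u) - Real.log (f v))|
          ≤ |q| * Real.log C := by
        rw [abs_mul]; exact mul_le_mul_of_nonneg_left h1 (abs_nonneg q)
      have := le_of_abs_le h2
      linarith
    · have : f (u ++ v) = 0 := le_antisymm (not_lt.1 h0) (hf.nonneg _)
      rw [this, pow₀_zero]
      exact mul_nonneg (Real.rpow_nonneg hf.pos.le _)
        (mul_nonneg (pow₀_nonneg (hf.nonneg _) q) (pow₀_nonneg (hf.nonneg _) q))

theorem comp_map (hf : QuasiMul C f) (φ : B → A) : QuasiMul C fun w => f (w.map φ) where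
  one_le := hf.one_le
  nonneg w := hf.nonneg _
  nil_pos := hf.nil_pos
  lower u v := by simpa using hf.lower (u.map φ) (v.map φ)
  upper u v := by simpa using hf.upper (u.map φ) (v.map φ)

theorem exp_mul (hf : QuasiMul C f) (t : ℝ) :
    QuasiMul C fun w => Real.exp (t * w.length) * f w where
  one_le := hf.one_le
  nonneg w := mul_nonneg (Real.exp_pos _).le (hf.nonneg w)
  nil_pos := mul_pos (Real.exp_pos _) hf.nil_pos
  lower u v := by
    have := mul_le_mul_of_nonneg_left (hf.lower u v)
      (Real.exp_pos (t * (u.length + v.length))).le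
    rw [List.length_append]; push_cast
    rw [mul_add, Real.exp_add] at *
    linarith
  upper u v := by
    have := mul_le_mul_of_nonneg_left (hf.upper u v)
      (Real.exp_pos (t * (u.length + v.length))).le
    rw [List.length_append]; push_cast
    rw [mul_add, Real.exp_add] at *
    linarith

/-- A fibre word over u ++ u' splits uniquely into fibre words over u and u', because the lengths
are prescribed. The double sum factorizes termwise, with the same constant. -/
theorem fiber [Fintype B] {Φ : List (A × B) → ℝ} (h : QuasiMul C Φ) :
    QuasiMul C fun u : List A => wsum u.length fun v : List B => Φ (u.zip v) where
  one_le := h.one_le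
  nonneg w := wsum_nonneg fun _ _ => h.nonneg _
  nil_pos := by
    simp only [List.length_nil, wsum_zero]
    exact h.nil_pos
  lower u u' := by
    rw [List.length_append, wsum_append, ← wsum_mul_right, ← wsum_mul_left]
    refine wsum_mono fun v hv => ?_
    rw [← wsum_mul_left, ← wsum_mul_left]
    refine wsum_mono fun v' hv' => ?_
    rw [List.zip_append hv.symm]
    exact h.lower _ _
  upper u u' := by
    rw [List.length_append, wsum_append, ← wsum_mul_right, ← wsum_mul_left]
    refine wsum_mono fun v hv => ?_
    rw [← wsum_mul_left, ← wsum_mul_left]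
    refine wsum_mono fun v' hv' => ?_
    rw [List.zip_append hv.symm]
    exact h.upper _ _

/-- The logarithm of a quasi-multiplicative function grows at most linearly. -/
theorem exists_abs_log_le [Finite A] (hf : QuasiMul C f) :
    ∃ K, 0 ≤ K ∧ ∀ w, 0 < f w → |Real.log (f w)| ≤ K * (w.length + 1) := by
  have := Fintype.ofFinite A
  set K := Real.log C + |Real.log (f [])| + ∑ a : A, |Real.log (f [a])| with hK
  have hs : 0 ≤ ∑ a : A, |Real.log (f [a])| := Finset.sum_nonneg fun _ _ => abs_nonneg _
  have hl := hf.log_nonneg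
  have hK0 : 0 ≤ K := by positivity
  refine ⟨K, hK0, fun w => ?_⟩
  induction w with
  | nil =>
    intro _
    simp only [List.length_nil, Nat.cast_zero, zero_add, mul_one]
    rw [hK]; linarith
  | cons a w ih =>
    intro h0
    have h1 : 0 < f ([a] ++ w) := h0
    have h2 := hf.abs_log_append_le h1
    have h3 := ih (hf.append_pos_iff.1 h1).2
    have h4 : |Real.log (f [a])| ≤ ∑ a : A, |Real.log (f [a])| :=
      Finset.single_le_sum (f := fun a : A => |Real.log (f [a])|) (fun _ _ => abs_nonneg _)
        (Finset.mem_univ a)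
    have h5 : |Real.log (f ([a] ++ w))| ≤ Real.log C + |Real.log (f [a])| + |Real.log (f w)| := by
      rw [abs_le] at *
      have := neg_abs_le (Real.log (f [a])); have := le_abs_self (Real.log (f [a]))
      have := neg_abs_le (Real.log (f w)); have := le_abs_self (Real.log (f w))
      constructor <;> linarith
    have h6 : 0 ≤ |Real.log (f [])| := abs_nonneg _
    have h7 : |Real.log (f (a :: w))| ≤ Real.log C + |Real.log (f [a])| + |Real.log (f w)| := h5
    push_cast [List.length_cons]
    linarith

theorem exists_pos (hf : QuasiMul C f) {a : A} (ha : 0 < f [a]) (n : ℕ) :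
    ∃ w, w.length = n ∧ 0 < f w := by
  refine ⟨List.replicate n a, by simp, ?_⟩
  induction n with
  | zero => exact hf.nil_pos
  | succ n ih =>
    have : 0 < f ([a] ++ List.replicate n a) := hf.append_pos_iff.2 ⟨ha, ih⟩
    simpa [List.replicate_succ] using this

section partition

variable [Fintype A]

theorem wsum_add_le (hf : QuasiMul C f) (m n : ℕ) :
    wsum (m + n) f ≤ C * (wsum m f * wsum n f) := by
  rw [wsum_append, ← wsum_mul_right, ← wsum_mul_left]
  refine wsum_mono fun u _ => ?_
  rw [← wsum_mul_left, ← wsum_mul_left]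
  exact wsum_mono fun v _ => hf.upper u v

theorem le_wsum_add (hf : QuasiMul C f) (m n : ℕ) :
    wsum m f * wsum n f ≤ C * wsum (m + n) f := by
  rw [wsum_append, ← wsum_mul_right, ← wsum_mul_left]
  refine wsum_mono fun u _ => ?_
  rw [← wsum_mul_left, ← wsum_mul_left]
  exact wsum_mono fun v _ => hf.lower u v

theorem wsum_pos (hf : QuasiMul C f) {a : A} (ha : 0 < f [a]) (n : ℕ) : 0 < wsum n f := by
  obtain ⟨w, rfl, hw⟩ := hf.exists_pos ha n
  exact hw.trans_le (le_wsum hf.nonneg w)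

/-- The pressure of a quasi-multiplicative function exists, and the partition functions are
comparable to `exp (n P)` with the quasi-multiplicativity constant. -/
theorem exists_pressure (hf : QuasiMul C f) {a : A} (ha : 0 < f [a]) :
    ∃ P : ℝ, Tendsto (pressureSeq f) atTop (𝓝 P) ∧
      ∀ n : ℕ, |Real.log (wsum n f) - n * P| ≤ Real.log C := by
  have hpos := fun n => hf.wsum_pos ha n
  set l : ℕ → ℝ := fun n => Real.log (wsum n f) with hl
  have hC := hf.log_nonneg
  have hadd : ∀ m n, |l (m + n) - l m - l n| ≤ Real.log C := by
    intro m n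
    have h1 := Real.log_le_log (hpos _) (hf.wsum_add_le m n)
    have h2 := Real.log_le_log (mul_pos (hpos _) (hpos _)) (hf.le_wsum_add m n)
    rw [Real.log_mul hf.pos.ne' (mul_pos (hpos _) (hpos _)).ne',
      Real.log_mul (hpos _).ne' (hpos _).ne'] at h1
    rw [Real.log_mul hf.pos.ne' (hpos _).ne', Real.log_mul (hpos _).ne' (hpos _).ne'] at h2
    rw [abs_le]; constructor <;> simp only [hl] <;> linarith
  -- Fekete's lemma is applied to both l + log C and -l + log C. Each limit is an infimum, and the
  -- two resulting inequalities give the error bound log C uniformly in n.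
  have hsub : Subadditive fun n => l n + Real.log C := fun m n => by
    have := le_of_abs_le (hadd m n)
    simp only; linarith
  have hsup : Subadditive fun n => -l n + Real.log C := fun m n => by
    have := neg_le_of_abs_le (hadd m n)
    simp only; linarith
  have hlin : ∀ n : ℕ, n ≠ 0 → |l n| ≤ n * (|l 1| + Real.log C) := by
    intro n hn
    obtain ⟨k, rfl⟩ := Nat.exists_eq_succ_of_ne_zero hn
    induction k with
    | zero => simp; exact hC
    | succ k ih =>
      have h1 := hadd (k + 1) 1
      have h2 := ih (by omega)
      have h3 : |l (k + 1 + 1)| ≤ |l (k + 1)| + |l 1| + Real.log C := by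
        rw [abs_le] at *
        have := neg_abs_le (l 1); have := le_abs_self (l 1)
        have := neg_abs_le (l (k + 1)); have := le_abs_self (l (k + 1))
        constructor <;> linarith
      push_cast at *
      linarith
  have hb : ∀ σ : ℝ, |σ| = 1 →
      BddBelow (Set.range fun n : ℕ => (σ * l n + Real.log C) / n) := by
    intro σ hσ
    refine ⟨-(|l 1| + Real.log C), ?_⟩
    rintro _ ⟨n, rfl⟩
    rcases eq_or_ne n 0 with rfl | hn
    · have := abs_nonneg (l 1)
      simp
      linarith
    have hn' : (0 : ℝ) < n := by exact_mod_cast Nat.pos_of_ne_zero hn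
    simp only
    rw [le_div_iff₀ hn']
    have h1 := hlin n hn
    have h2 : |σ * l n| ≤ n * (|l 1| + Real.log C) := by rw [abs_mul, hσ, one_mul]; exact h1
    have := neg_le_of_abs_le h2
    linarith
  have hb1 : BddBelow (Set.range fun n : ℕ => (l n + Real.log C) / n) := by
    simpa using hb 1 (by simp)
  have hb2 : BddBelow (Set.range fun n : ℕ => (-l n + Real.log C) / n) := by
    simpa using hb (-1) (by simp)
  have ht1 := hsub.tendsto_lim hb1
  have ht2 := hsup.tendsto_lim hb2
  have hz : Tendsto (fun n : ℕ => Real.log C / (n : ℝ)) atTop (𝓝 0) :=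
    tendsto_const_div_atTop_nhds_zero_nat _
  have ht : Tendsto (fun n : ℕ => l n / n) atTop (𝓝 hsub.lim) := by
    have := ht1.sub hz
    simpa [add_div] using this
  have ht' : Tendsto (fun n : ℕ => l n / n) atTop (𝓝 (-hsup.lim)) := by
    have := (ht2.sub hz).neg
    simpa [add_div, neg_div] using this
  have heq := tendsto_nhds_unique ht ht'
  refine ⟨hsub.lim, ?_, fun n => ?_⟩
  · refine ht.congr fun n => ?_
    simp only [pressureSeq, hl, wsum]
    ring
  · rcases eq_or_ne n 0 with rfl | hn
    · have h1 := hadd 0 0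
      have : l (0 + 0) - l 0 - l 0 = - l 0 := by simp
      rw [this, abs_neg] at h1
      simpa using h1
    have hn' : (0 : ℝ) < n := by exact_mod_cast Nat.pos_of_ne_zero hn
    have h1 := hsub.lim_le_div hb1 hn
    have h2 := hsup.lim_le_div hb2 hn
    rw [le_div_iff₀ hn'] at h1 h2
    have h3 : hsup.lim = -hsub.lim := by linarith
    rw [h3] at h2
    rw [abs_le]
    constructor <;> simp only [hl] at * <;> linarith

theorem tendsto_pressureSeq (hf : QuasiMul C f) {a : A} (ha : 0 < f [a]) :
    Tendsto (pressureSeq f) atTop (𝓝 (pressure f)) := by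
  obtain ⟨P, hP, -⟩ := hf.exists_pressure ha
  exact tendsto_nhds_limUnder ⟨P, hP⟩

theorem abs_log_wsum_sub_le (hf : QuasiMul C f) {a : A} (ha : 0 < f [a]) (n : ℕ) :
    |Real.log (wsum n f) - n * pressure f| ≤ Real.log C := by
  obtain ⟨P, hP, h⟩ := hf.exists_pressure ha
  rw [tendsto_nhds_unique (hf.tendsto_pressureSeq ha) hP]
  exact h n

end partition

end QuasiMul

end

noncomputable section

/-! ### Banach limits -/

/-- A Banach limit: the limit of the Cesàro averages along a nonprincipal ultrafilter. -/
def blim (a : ℕ → ℝ) : ℝ :=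
  limUnder (hyperfilter ℕ : Filter ℕ) fun N : ℕ => (∑ i ∈ Finset.range N, a i) / N

section blim

variable {a b : ℕ → ℝ} {B B' : ℝ}

theorem tendsto_blim (ha : ∀ i, |a i| ≤ B) :
    Tendsto (fun N : ℕ => (∑ i ∈ Finset.range N, a i) / N) (hyperfilter ℕ : Filter ℕ)
      (𝓝 (blim a)) := by
  have hB : 0 ≤ B := (abs_nonneg _).trans (ha 0)
  set avg : ℕ → ℝ := fun N => (∑ i ∈ Finset.range N, a i) / N
  have hmem : ∀ N, avg N ∈ Set.Icc (-B) B := by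
    intro N
    rw [Set.mem_Icc, ← abs_le]
    rcases eq_or_ne N 0 with rfl | hN
    · simpa [avg] using hB
    have hN' : (0 : ℝ) < N := by exact_mod_cast Nat.pos_of_ne_zero hN
    simp only [avg]
    rw [abs_div, abs_of_pos hN', div_le_iff₀ hN']
    calc |∑ i ∈ Finset.range N, a i| ≤ ∑ i ∈ Finset.range N, |a i| :=
          Finset.abs_sum_le_sum_abs _ _
      _ ≤ ∑ i ∈ Finset.range N, B := Finset.sum_le_sum fun i _ => ha i
      _ = B * N := by simp [mul_comm]
  obtain ⟨x, -, hx⟩ := (isCompact_Icc (a := -B) (b := B)).ultrafilter_le_nhds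
    ((hyperfilter ℕ).map avg) (by
      rw [le_principal_iff]
      exact Filter.Eventually.of_forall (f := (hyperfilter ℕ : Filter ℕ)) hmem)
  exact tendsto_nhds_limUnder ⟨x, hx⟩

theorem blim_mono (ha : ∀ i, |a i| ≤ B) (hb : ∀ i, |b i| ≤ B') (h : ∀ i, a i ≤ b i) :
    blim a ≤ blim b :=
  le_of_tendsto_of_tendsto' (tendsto_blim ha) (tendsto_blim hb) fun N => by
    gcongr with i; exact h i

theorem blim_const (c : ℝ) : blim (fun _ => c) = c := by
  refine tendsto_nhds_unique (tendsto_blim (B := |c|) fun _ => le_rfl) ?_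
  refine Tendsto.mono_left ?_ Nat.hyperfilter_le_atTop
  refine tendsto_const_nhds.congr' ?_
  filter_upwards [eventually_gt_atTop 0] with N hN
  have hN' : (N : ℝ) ≠ 0 := by exact_mod_cast hN.ne'
  simp only [Finset.sum_const, Finset.card_range, nsmul_eq_mul]
  field_simp

/-- Cesàro averaging before the ultralimit is what gives shift invariance: the two sums of N terms
differ by the bounded quantity a N - a 0. -/
theorem blim_succ (ha : ∀ i, |a i| ≤ B) : blim (fun i => a (i + 1)) = blim a := by
  have h1 := tendsto_blim (a := fun i => a (i + 1)) fun i => ha _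
  have h2 := tendsto_blim ha
  have h3 : Tendsto (fun N : ℕ => (a N - a 0) / (N : ℝ)) (hyperfilter ℕ : Filter ℕ) (𝓝 0) := by
    refine Tendsto.mono_left ?_ Nat.hyperfilter_le_atTop
    refine squeeze_zero_norm (a := fun N : ℕ => (B + B) / (N : ℝ)) (fun N => ?_)
      (tendsto_const_div_atTop_nhds_zero_nat _)
    rw [Real.norm_eq_abs, abs_div, Nat.abs_cast]
    gcongr
    exact (abs_sub _ _).trans (add_le_add (ha N) (ha 0))
  refine tendsto_nhds_unique h1 ?_
  have h4 := h2.add h3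
  rw [add_zero] at h4
  refine h4.congr fun N => ?_
  rw [← add_div]
  congr 1
  have := Finset.sum_range_succ a N
  have := Finset.sum_range_succ' a N
  linarith

theorem blim_add_nat (ha : ∀ i, |a i| ≤ B) (m : ℕ) : blim (fun i => a (i + m)) = blim a := by
  induction m with
  | zero => rfl
  | succ m ih =>
    rw [← ih, ← blim_succ (a := fun i => a (i + m)) fun i => ha _]
    congr 1; ext i; congr 1; omega

theorem abs_blim_le (ha : ∀ i, |a i| ≤ B) : |blim a| ≤ B := by
  rw [abs_le]
  constructor
  · rw [← blim_const (-B)]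
    exact blim_mono (B := |B|) (fun _ => by rw [abs_neg]) ha fun i => neg_le_of_abs_le (ha i)
  · rw [← blim_const B]
    exact blim_mono ha (B' := |B|) (fun _ => le_rfl) fun i => le_of_abs_le (ha i)

theorem blim_wsum {A : Type*} [Fintype A] (m : ℕ) {F : ℕ → List A → ℝ} {B : List A → ℝ}
    (hF : ∀ i w, |F i w| ≤ B w) :
    blim (fun i => wsum m (F i)) = wsum m fun w => blim fun i => F i w := by
  have h1 : ∀ i, |wsum m (F i)| ≤ wsum m B := fun i =>
    (Finset.abs_sum_le_sum_abs _ _).trans (Finset.sum_le_sum fun w _ => hF i _)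
  refine tendsto_nhds_unique (tendsto_blim h1) ?_
  have h2 : Tendsto (fun N : ℕ => ∑ w : Fin m → A,
      (∑ i ∈ Finset.range N, F i (List.ofFn w)) / N) (hyperfilter ℕ : Filter ℕ)
      (𝓝 (wsum m fun w => blim fun i => F i w)) :=
    tendsto_finsetSum _ fun w _ => tendsto_blim fun i => hF i _
  refine h2.congr fun N => ?_
  rw [← Finset.sum_div, Finset.sum_comm]
  rfl

end blim

/-! ### Stationary distributions -/

/-- `p` is the family of cylinder masses of a shift-invariant probability measure that is
quasi-Bernoulli from below. -/
structure Stationary {A : Type*} [Fintype A] (C : ℝ) (p : List A → ℝ) : Prop where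
  one_le : 1 ≤ C
  nonneg : ∀ w, 0 ≤ p w
  nil : p [] = 1
  right : ∀ m w, (wsum m fun v => p (w ++ v)) = p w
  left : ∀ m w, (wsum m fun u => p (u ++ w)) = p w
  lower : ∀ u v, p u * p v ≤ C * p (u ++ v)

variable {A : Type*} [Fintype A]

/-- Place w between all words of length i on the left and j on the right, and sum f. Adding a letter
to w on one side only shifts i or j, so a Banach limit in each index yields consistency on the right
and stationarity on the left. Bounded partition functions keep all these sums comparable to f w. -/
theorem QuasiMul.exists_invariant {C Z : ℝ} {f : List A → ℝ} (hf : QuasiMul C f)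
    (hZ : 1 ≤ Z) (hZ1 : ∀ n, wsum n f ≤ Z) (hZ2 : ∀ n, 1 ≤ Z * wsum n f) :
    ∃ (D : ℝ) (p : List A → ℝ), 0 < D ∧ (∀ w, f w ≤ D * p w) ∧ (∀ w, p w ≤ D * f w) ∧
      (∀ m w, (wsum m fun v => p (w ++ v)) = p w) ∧
      (∀ m w, (wsum m fun u => p (u ++ w)) = p w) := by
  have hC := hf.pos
  set g : ℕ → ℕ → List A → ℝ := fun i j w =>
    wsum i fun u => wsum j fun v => f (u ++ w ++ v) with hg
  have hZ0 : ∀ n, 0 ≤ wsum n f := fun n => wsum_nonneg fun w _ => hf.nonneg w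
  have hg0 : ∀ i j w, 0 ≤ g i j w := fun i j w =>
    wsum_nonneg fun _ _ => wsum_nonneg fun _ _ => hf.nonneg _
  set D := C ^ 2 * Z ^ 2 with hD
  have hD1 : 1 ≤ D := one_le_mul_of_one_le_of_one_le (one_le_pow₀ hf.one_le) (one_le_pow₀ hZ)
  have hD0 : 0 < D := zero_lt_one.trans_le hD1
  have hgle : ∀ i j w, g i j w ≤ D * f w := by
    intro i j w
    calc g i j w ≤ wsum i fun u => wsum j fun v => (C ^ 2 * f w) * (f u * f v) := by
          refine wsum_mono fun u _ => wsum_mono fun v _ => ?_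
          have h1 := hf.upper (u ++ w) v
          have h2 := mul_le_mul_of_nonneg_right (hf.upper u w)
            (mul_nonneg hC.le (hf.nonneg v))
          nlinarith
      _ = (C ^ 2 * f w) * (wsum i f * wsum j f) := by
          simp only [wsum_mul_left, wsum_mul_right]
      _ ≤ (C ^ 2 * f w) * (Z * Z) := by
          refine mul_le_mul_of_nonneg_left ?_ (mul_nonneg (by positivity) (hf.nonneg w))
          exact mul_le_mul (hZ1 i) (hZ1 j) (hZ0 j) (by linarith)
      _ = D * f w := by rw [hD]; ring
  have hleg : ∀ i j w, f w ≤ D * g i j w := by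
    intro i j w
    calc f w ≤ f w * ((Z * wsum i f) * (Z * wsum j f)) :=
          le_mul_of_one_le_right (hf.nonneg w)
            (one_le_mul_of_one_le_of_one_le (hZ2 i) (hZ2 j))
      _ = Z ^ 2 * wsum i fun u => wsum j fun v => f w * (f u * f v) := by
          simp only [wsum_mul_left, wsum_mul_right]; ring
      _ ≤ Z ^ 2 * wsum i fun u => wsum j fun v => C ^ 2 * f (u ++ w ++ v) := by
          refine mul_le_mul_of_nonneg_left ?_ (by positivity)
          refine wsum_mono fun u _ => wsum_mono fun v _ => ?_
          have h1 := mul_le_mul_of_nonneg_left (hf.lower (u ++ w) v) hC.le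
          have h2 := mul_le_mul_of_nonneg_right (hf.lower u w) (hf.nonneg v)
          nlinarith
      _ = D * g i j w := by simp only [wsum_mul_left, hg, hD]; ring
  have hgabs : ∀ w i j, |g i j w| ≤ D * f w := fun w i j => by
    rw [abs_of_nonneg (hg0 i j w)]; exact hgle i j w
  have hbabs : ∀ w i, |blim fun j => g i j w| ≤ D * f w := fun w i => abs_blim_le (hgabs w i)
  set p : List A → ℝ := fun w => blim fun i => blim fun j => g i j w with hp
  have hple : ∀ w, p w ≤ D * f w := fun w => le_of_abs_le (abs_blim_le (hbabs w))
  have hlep : ∀ w, f w ≤ D * p w := by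
    intro w
    have : f w / D ≤ p w := by
      rw [← blim_const (f w / D)]
      refine blim_mono (B := |f w / D|) (fun _ => le_rfl) (hbabs w) fun i => ?_
      conv_lhs => rw [← blim_const (f w / D)]
      refine blim_mono (B := |f w / D|) (fun _ => le_rfl) (hgabs w i) fun j => ?_
      rw [div_le_iff₀' hD0]
      exact hleg i j w
    rwa [div_le_iff₀' hD0] at this
  have hright : ∀ m w, (wsum m fun v => p (w ++ v)) = p w := by
    intro m w
    have h1 : ∀ i j, (wsum m fun v => g i j (w ++ v)) = g i (j + m) w := by
      intro i j
      simp only [hg]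
      rw [wsum_comm]
      refine wsum_congr fun u _ => ?_
      rw [add_comm j m, wsum_append]
      simp only [List.append_assoc]
    rw [hp]
    simp only
    rw [← blim_wsum m fun i v => hbabs (w ++ v) i]
    congr 1; ext i
    rw [← blim_wsum m fun j v => hgabs (w ++ v) i j]
    simp only [h1]
    exact blim_add_nat (hgabs w i) m
  have hleft : ∀ m w, (wsum m fun u => p (u ++ w)) = p w := by
    intro m w
    have h1 : ∀ i j, (wsum m fun u => g i j (u ++ w)) = g (i + m) j w := by
      intro i j
      simp only [hg]
      rw [wsum_comm, wsum_append]
      simp only [List.append_assoc]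
    rw [hp]
    simp only
    rw [← blim_wsum m fun i u => hbabs (u ++ w) i,
      ← blim_add_nat (a := fun i => blim fun j => g i j w) (hbabs w) m]
    congr 1; ext i
    rw [← blim_wsum m fun j u => hgabs (u ++ w) i j]
    simp only [h1]
  exact ⟨D, p, hD0, hlep, hple, hright, hleft⟩

theorem QuasiMul.exists_stationary {C Z : ℝ} {f : List A → ℝ} (hf : QuasiMul C f)
    (hZ : 1 ≤ Z) (hZ1 : ∀ n, wsum n f ≤ Z) (hZ2 : ∀ n, 1 ≤ Z * wsum n f) :
    ∃ (K K' : ℝ) (p : List A → ℝ), 0 < K ∧ Stationary K' p ∧ (∀ w, f w ≤ K * p w) ∧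
      ∀ w, p w ≤ K * f w := by
  have hC := hf.pos
  obtain ⟨D, p, hD0, hlep, hple, hright, hleft⟩ := hf.exists_invariant hZ hZ1 hZ2
  have hp0 : ∀ w, 0 ≤ p w := fun w => by
    have := (hf.nonneg w).trans (hlep w)
    exact (mul_nonneg_iff_of_pos_left hD0).1 this
  have hpnil : 0 < p [] := (mul_pos_iff_of_pos_left hD0).1 (hf.nil_pos.trans_le (hlep []))
  have hlow : ∀ u v, p u * p v ≤ (D ^ 3 * C) * p (u ++ v) := by
    intro u v
    calc p u * p v ≤ (D * f u) * (D * f v) :=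
          mul_le_mul (hple u) (hple v) (hp0 v) (mul_nonneg hD0.le (hf.nonneg u))
      _ = D ^ 2 * (f u * f v) := by ring
      _ ≤ D ^ 2 * (C * f (u ++ v)) :=
          mul_le_mul_of_nonneg_left (hf.lower u v) (by positivity)
      _ ≤ D ^ 2 * (C * (D * p (u ++ v))) := by gcongr; exact hlep _
      _ = _ := by ring
  -- The summand D * p [] serves the bound of f by the normalized p, and D / p [] the reverse bound.
  refine ⟨D * p [] + D / p [], max 1 (D ^ 3 * C / p []), fun w => p w / p [],
    by positivity, ⟨le_max_left _ _, fun w => div_nonneg (hp0 w) hpnil.le, div_self hpnil.ne',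
    fun m w => ?_, fun m w => ?_, fun u v => ?_⟩, fun w => ?_, fun w => ?_⟩
  · rw [wsum_div, hright]
  · rw [wsum_div, hleft]
  · refine le_trans ?_ (mul_le_mul_of_nonneg_right (le_max_right 1 _)
      (div_nonneg (hp0 _) hpnil.le))
    rw [div_mul_div_comm, div_mul_div_comm]
    exact div_le_div_of_nonneg_right (hlow u v) (by positivity)
  · refine (hlep w).trans ?_
    have h1 : D * p w = D * p [] * (p w / p []) := by field_simp
    rw [h1]
    exact mul_le_mul_of_nonneg_right (le_add_of_nonneg_right (by positivity))
      (div_nonneg (hp0 w) hpnil.le)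
  · rw [add_mul]
    have h1 : p w / p [] ≤ D / p [] * f w := by
      rw [div_mul_eq_mul_div]
      gcongr
      exact hple w
    exact h1.trans (le_add_of_nonneg_left (mul_nonneg (by positivity) (hf.nonneg w)))

namespace Stationary

variable {C : ℝ} {p : List A → ℝ}

theorem wsum_eq_one (h : Stationary C p) (n : ℕ) : wsum n p = 1 := by
  have := h.right n []
  simpa [h.nil] using this

theorem wsum_fst (h : Stationary C p) (m n : ℕ) (F : List A → ℝ) :
    (wsum m fun u => wsum n fun v => p (u ++ v) * F u) = wsum m fun u => p u * F u := by
  refine wsum_congr fun u _ => ?_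
  rw [wsum_mul_right, h.right]

theorem wsum_snd (h : Stationary C p) (m n : ℕ) (F : List A → ℝ) :
    (wsum m fun u => wsum n fun v => p (u ++ v) * F v) = wsum n fun v => p v * F v := by
  rw [wsum_comm]
  refine wsum_congr fun u _ => ?_
  rw [wsum_mul_right, h.left]

/-- For an additive-up-to-`K` function, doubling the length contracts the normalized variance,
because the two halves of a word are independent up to a multiplicative constant. -/
theorem variance_double_le (h : Stationary C p) {X : List A → ℝ} {K : ℝ}
    (hX : ∀ u v, 0 < p (u ++ v) → |X (u ++ v) - X u - X v| ≤ K) (n : ℕ) {e : ℝ}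
    (he : wsum n (fun w => p w * X w) = e) :
    (wsum (n + n) fun w => p w * (X w - 2 * e) ^ 2) ≤
      (4 - C⁻¹) * (wsum n fun w => p w * (X w - e) ^ 2) + (1 + 4 * C) * K ^ 2 := by
  have hC : 0 < C := zero_lt_one.trans_le h.one_le
  have hCi : C⁻¹ ≤ 1 := inv_le_one_of_one_le₀ h.one_le
  have hCi0 : 0 < C⁻¹ := inv_pos.2 hC
  set V := wsum n fun w => p w * (X w - e) ^ 2 with hV
  have hV0 : 0 ≤ V := wsum_nonneg fun w _ => mul_nonneg (h.nonneg w) (sq_nonneg _)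
  set S := wsum n fun u => wsum n fun v => p (u ++ v) * (X u + X v - 2 * e) ^ 2 with hS
  set T := wsum n fun u => wsum n fun v => p (u ++ v) * (X u - X v) ^ 2 with hT
  have hS0 : 0 ≤ S := wsum_nonneg fun u _ => wsum_nonneg fun v _ =>
    mul_nonneg (h.nonneg _) (sq_nonneg _)
  -- Parallelogram identity: both halves of a word of length n + n have law p by stationarity.
  have hST : S + T = 4 * V := by
    have h1 := h.wsum_fst n n fun u => (X u - e) ^ 2
    have h2 := h.wsum_snd n n fun v => (X v - e) ^ 2
    calc S + T = wsum n fun u => wsum n fun v =>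
          2 * (p (u ++ v) * (X u - e) ^ 2) + 2 * (p (u ++ v) * (X v - e) ^ 2) := by
          rw [hS, hT, ← wsum_add]
          refine wsum_congr fun u _ => ?_
          rw [← wsum_add]
          refine wsum_congr fun v _ => ?_
          ring
      _ = 2 * V + 2 * V := by
          simp only [wsum_add, wsum_mul_left]
          rw [h1, h2]
      _ = 4 * V := by ring
  -- For two independent halves the mean of (X u - X v) ^ 2 would be exactly 2 * V. The bound p u *
  -- p v ≤ C * p (u ++ v) retains a fraction C⁻¹ of it.
  have hTV : 2 * C⁻¹ * V ≤ T := by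
    have h1 : (wsum n fun u => wsum n fun v => p u * p v * (X u - X v) ^ 2) = 2 * V := by
      have hi : ∀ u, (wsum n fun v => p u * p v * (X u - X v) ^ 2) =
          p u * (X u - e) ^ 2 + p u * V := by
        intro u
        have h0 : (wsum n fun v => p v * (X v - e)) = 0 := by
          simp only [mul_sub, wsum_sub, wsum_mul_right]
          rw [he, h.wsum_eq_one]; ring
        calc (wsum n fun v => p u * p v * (X u - X v) ^ 2) = wsum n fun v =>
              ((p u * (X u - e) ^ 2) * p v + p u * (p v * (X v - e) ^ 2)) -
                (2 * p u * (X u - e)) * (p v * (X v - e)) := wsum_congr fun v _ => by ring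
          _ = _ := by
              rw [wsum_sub, wsum_add, wsum_mul_left, wsum_mul_left, wsum_mul_left, h0,
                h.wsum_eq_one]
              ring
      rw [wsum_congr fun u _ => hi u, wsum_add, wsum_mul_right, h.wsum_eq_one]
      ring
    have h2 : (wsum n fun u => wsum n fun v => p u * p v * (X u - X v) ^ 2) ≤ C * T := by
      rw [hT, ← wsum_mul_left]
      refine wsum_mono fun u _ => ?_
      rw [← wsum_mul_left]
      refine wsum_mono fun v _ => ?_
      rw [← mul_assoc]
      exact mul_le_mul_of_nonneg_right (h.lower u v) (sq_nonneg _)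
    rw [h1] at h2
    calc 2 * C⁻¹ * V = C⁻¹ * (2 * V) := by ring
      _ ≤ C⁻¹ * (C * T) := by gcongr
      _ = T := by field_simp
  -- Parameter of Young's inequality (Y + R)² ≤ (1 + η) Y² + (1 + 1/η) R², with 1/η = 4C. It is
  -- small enough for (1 + η)(4 - 2/C) ≤ 4 - 1/C.
  set η := C⁻¹ / 4 with hη
  have hη0 : 0 < η := by positivity
  have key : (wsum (n + n) fun w => p w * (X w - 2 * e) ^ 2) ≤
      (1 + η) * S + (1 + 4 * C) * K ^ 2 := by
    rw [wsum_append]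
    calc _ ≤ wsum n fun u => wsum n fun v => (1 + η) * (p (u ++ v) * (X u + X v - 2 * e) ^ 2) +
          ((1 + 4 * C) * K ^ 2) * p (u ++ v) := by
          refine wsum_mono fun u _ => wsum_mono fun v _ => ?_
          rcases (h.nonneg (u ++ v)).eq_or_lt with h0 | h0
          · simp [← h0]
          have h1 := hX u v h0
          set R := X (u ++ v) - X u - X v with hR
          set Y := X u + X v - 2 * e with hY
          have h2 : X (u ++ v) - 2 * e = Y + R := by rw [hY, hR]; ring
          have h3 : R ^ 2 ≤ K ^ 2 := sq_le_sq' (neg_le_of_abs_le h1) (le_of_abs_le h1)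
          have h5 : 4 * C * η = 1 := by rw [hη]; field_simp
          have h4 : (Y + R) ^ 2 ≤ (1 + η) * Y ^ 2 + (1 + 4 * C) * R ^ 2 := by
            have : (1 + η) * Y ^ 2 + (1 + 4 * C) * R ^ 2 - (Y + R) ^ 2
                = 4 * C * (η * Y - R) ^ 2 := by
              linear_combination (-(2 * R * Y) + η * Y ^ 2) * (-h5)
            have : 0 ≤ 4 * C * (η * Y - R) ^ 2 := by positivity
            linarith
          rw [h2]
          have h6 : (Y + R) ^ 2 ≤ (1 + η) * Y ^ 2 + (1 + 4 * C) * K ^ 2 := by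
            have : (1 + 4 * C) * R ^ 2 ≤ (1 + 4 * C) * K ^ 2 := by gcongr
            linarith
          have := mul_le_mul_of_nonneg_left h6 h0.le
          linarith
      _ = _ := by
          simp only [wsum_add, wsum_mul_left]
          rw [← wsum_append n n p, h.wsum_eq_one, mul_one]
  refine key.trans ?_
  have h6 : S ≤ (4 - 2 * C⁻¹) * V := by linarith
  have h7 : (1 + η) * S ≤ (1 + η) * ((4 - 2 * C⁻¹) * V) := by gcongr
  have h8 : (1 + η) * ((4 - 2 * C⁻¹) * V) = (4 - C⁻¹) * V - (C⁻¹ ^ 2 / 2) * V := by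
    rw [hη]; ring
  have h9 : 0 ≤ (C⁻¹ ^ 2 / 2) * V := by positivity
  linarith

/-- Replacing θ by max θ (1/2) makes the rate positive and slower than the forcing (1/4)^k. The
accumulated forcing then costs only a factor linear in k. -/
theorem tendsto_zero_of_contraction {θ K : ℝ} (hθ : θ < 1) (hK : 0 ≤ K)
    {y : ℕ → ℝ} (hy : ∀ k, 0 ≤ y k) (h : ∀ k, y (k + 1) ≤ θ * y k + K * (1 / 4) ^ k) :
    Tendsto y atTop (𝓝 0) := by
  set r := max θ (1 / 2) with hr
  have hr1 : r < 1 := max_lt hθ (by norm_num)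
  have hr2 : 1 / 2 ≤ r := le_max_right _ _
  have hb : ∀ k, y k ≤ (y 0 + 4 * K * k) * r ^ k := by
    intro k
    induction k with
    | zero => simp
    | succ k ih =>
      have h1 : θ * y k ≤ r * ((y 0 + 4 * K * k) * r ^ k) :=
        mul_le_mul (le_max_left _ _) ih (hy k) (by linarith)
      have h2 : ((1 : ℝ) / 4) ^ k ≤ r ^ k := by
        gcongr; linarith
      have h3 : K * (1 / 4) ^ k ≤ 4 * K * r ^ (k + 1) := by
        have : (1:ℝ) ≤ 4 * r := by linarith
        have h0 : 0 ≤ K * r ^ k := by positivity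
        calc K * (1 / 4) ^ k ≤ K * r ^ k := by gcongr
          _ ≤ (4 * r) * (K * r ^ k) := le_mul_of_one_le_left h0 this
          _ = _ := by ring
      have h4 := h k
      push_cast
      have h5 : (y 0 + 4 * K * (k + 1)) * r ^ (k + 1) =
        r * ((y 0 + 4 * K * k) * r ^ k) + 4 * K * r ^ (k + 1) := by ring
      linarith
  have h1 : Tendsto (fun k : ℕ => y 0 * r ^ k + 4 * K * (k * r ^ k)) atTop
      (𝓝 (y 0 * 0 + 4 * K * 0)) :=
    ((tendsto_pow_atTop_nhds_zero_of_lt_one (by positivity) hr1).const_mul _).add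
      ((tendsto_self_mul_const_pow_of_lt_one (by positivity) hr1).const_mul _)
  simp only [mul_zero, add_zero] at h1
  exact squeeze_zero hy (fun k => (hb k).trans_eq (by ring)) h1

/-- The mean of an additive-up-to-a-constant function exists, and the function divided by the
length converges to it in mean square along powers of two. -/
theorem exists_mean (h : Stationary C p) {X : List A → ℝ} {K : ℝ}
    (hX : ∀ u v, 0 < p (u ++ v) → |X (u ++ v) - X u - X v| ≤ K) :
    ∃ lam : ℝ, Tendsto (fun k : ℕ => wsum (2 ^ k) fun w => p w * (X w / 2 ^ k - lam) ^ 2)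
      atTop (𝓝 0) := by
  have hC : 0 < C := zero_lt_one.trans_le h.one_le
  have hCi : C⁻¹ ≤ 1 := inv_le_one_of_one_le₀ h.one_le
  have hCi0 : 0 < C⁻¹ := inv_pos.2 hC
  set e : ℕ → ℝ := fun k => wsum (2 ^ k) fun w => p w * X w with he
  set V : ℕ → ℝ := fun k => wsum (2 ^ k) fun w => p w * (X w - e k) ^ 2 with hV
  have hV0 : ∀ k, 0 ≤ V k := fun k =>
    wsum_nonneg fun w _ => mul_nonneg (h.nonneg w) (sq_nonneg _)
  have hp2 : ∀ k, (2 : ℕ) ^ (k + 1) = 2 ^ k + 2 ^ k := fun k => by ring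
  -- By stationarity each half contributes the mean e k, so only the additivity defect remains. This
  -- makes e k / 2 ^ k a Cauchy sequence.
  have hdbl : ∀ k, |e (k + 1) - 2 * e k| ≤ |K| := by
    intro k
    have h1 := h.wsum_fst (2 ^ k) (2 ^ k) X
    have h2 := h.wsum_snd (2 ^ k) (2 ^ k) X
    have h3 : e (k + 1) - 2 * e k = wsum (2 ^ k) fun u => wsum (2 ^ k) fun v =>
        p (u ++ v) * (X (u ++ v) - X u - X v) := by
      have : e (k + 1) = wsum (2 ^ k) fun u => wsum (2 ^ k) fun v =>
          p (u ++ v) * X (u ++ v) := by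
        simp only [he]
        rw [hp2, wsum_append]
      have h4 : (2 : ℝ) * e k = e k + e k := by ring
      rw [this, h4]
      nth_rewrite 1 [he]
      simp only
      rw [← h1]
      simp only [he]
      rw [← h2]
      simp only [mul_sub, wsum_sub]
      ring
    rw [h3, abs_le]
    have hsum : (wsum (2 ^ k) fun u => wsum (2 ^ k) fun v => p (u ++ v)) = 1 := by
      rw [← wsum_append, h.wsum_eq_one]
    have hbd : ∀ u v, |p (u ++ v) * (X (u ++ v) - X u - X v)| ≤ |K| * p (u ++ v) := by
      intro u v
      rcases (h.nonneg (u ++ v)).eq_or_lt with h0 | h0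
      · simp [← h0]
      rw [abs_mul, abs_of_pos h0, mul_comm]
      exact mul_le_mul_of_nonneg_right ((hX u v h0).trans (le_abs_self K)) h0.le
    constructor
    · calc -|K| = wsum (2 ^ k) fun u => wsum (2 ^ k) fun v => (-|K|) * p (u ++ v) := by
            simp only [wsum_mul_left]; rw [hsum, mul_one]
        _ ≤ _ := wsum_mono fun u _ => wsum_mono fun v _ => by
            have := neg_le_of_abs_le (hbd u v); linarith
    · calc _ ≤ wsum (2 ^ k) fun u => wsum (2 ^ k) fun v => |K| * p (u ++ v) :=
            wsum_mono fun u _ => wsum_mono fun v _ => le_of_abs_le (hbd u v)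
        _ = |K| := by simp only [wsum_mul_left]; rw [hsum, mul_one]
  have hvar : ∀ k E, (wsum (2 ^ k) fun w => p w * (X w - E) ^ 2) = V k + (e k - E) ^ 2 := by
    intro k E
    calc _ = wsum (2 ^ k) fun w => (p w * (X w - e k) ^ 2 + (e k - E) ^ 2 * p w) +
          (2 * (e k - E)) * (p w * X w - e k * p w) := wsum_congr fun w _ => by ring
      _ = _ := by
          rw [wsum_add, wsum_add, wsum_mul_left, wsum_mul_left, wsum_sub, wsum_mul_left,
            h.wsum_eq_one]
          simp only [he, hV]
          ring
  set y : ℕ → ℝ := fun k => V k / 4 ^ k with hy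
  have hy0 : Tendsto y atTop (𝓝 0) := by
    refine tendsto_zero_of_contraction (θ := (4 - C⁻¹) / 4) (K := (1 + 4 * C) * K ^ 2 / 4)
      (by linarith) (by positivity) (fun k => div_nonneg (hV0 k) (by positivity))
      fun k => ?_
    have h1 := h.variance_double_le hX (2 ^ k) (e := e k) rfl
    rw [← hp2, hvar] at h1
    -- The second moment about 2 * e k exceeds the one about the true mean e (k + 1) by a square,
    -- which is dropped. Dividing by 4 ^ (k + 1) leaves the contraction ratio 1 - 1/(4C).
    have h2 : V (k + 1) ≤ (4 - C⁻¹) * V k + (1 + 4 * C) * K ^ 2 := by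
      have := sq_nonneg (e (k + 1) - 2 * e k)
      simp only [hV] at *
      linarith
    simp only [hy]
    rw [div_le_iff₀ (by positivity)]
    refine h2.trans_eq ?_
    rw [pow_succ, one_div_pow]
    field_simp
    ring
  have hcau : CauchySeq fun k => e k / 2 ^ k := by
    refine cauchySeq_of_le_geometric (1 / 2) (|K|) (by norm_num) fun k => ?_
    rw [Real.dist_eq]
    have : e k / 2 ^ k - e (k + 1) / 2 ^ (k + 1) = -(e (k + 1) - 2 * e k) / 2 ^ (k + 1) := by
      rw [pow_succ]; field_simp; ring
    rw [this, abs_div, abs_neg, abs_of_pos (by positivity : (0 : ℝ) < 2 ^ (k + 1)),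
      div_le_iff₀ (by positivity)]
    refine (hdbl k).trans ?_
    have : (1 / 2 : ℝ) ^ k * 2 ^ k = 1 := by rw [← mul_pow]; norm_num
    have h0 := abs_nonneg K
    rw [pow_succ]
    nlinarith
  obtain ⟨lam, hlam⟩ := cauchySeq_tendsto_of_complete hcau
  refine ⟨lam, ?_⟩
  have h1 : Tendsto (fun k => y k + (e k / 2 ^ k - lam) ^ 2) atTop (𝓝 (0 + (lam - lam) ^ 2)) :=
    hy0.add ((hlam.sub_const lam).pow 2)
  simp only [sub_self, ne_eq, OfNat.ofNat_ne_zero, not_false_eq_true, zero_pow, add_zero] at h1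
  refine h1.congr fun k => ?_
  have h2 := hvar k (2 ^ k * lam)
  have h4 : (4 : ℝ) ^ k = 2 ^ k * 2 ^ k := by rw [← mul_pow]; norm_num
  calc y k + (e k / 2 ^ k - lam) ^ 2 = (V k + (e k - 2 ^ k * lam) ^ 2) / 4 ^ k := by
        simp only [hy]; rw [h4]; field_simp
    _ = _ := by
        rw [← h2, ← wsum_div]
        refine wsum_congr fun w _ => ?_
        rw [h4]; field_simp

/-- Exponential moments along powers of two. -/
theorem eventually_exp_moment_le (h : Stationary C p) {X : List A → ℝ} {M lam : ℝ}
    (hM : ∀ w, 0 < p w → |X w| ≤ M * (w.length + 1))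
    (hlam : Tendsto (fun k : ℕ => wsum (2 ^ k) fun w => p w * (X w / 2 ^ k - lam) ^ 2)
      atTop (𝓝 0)) (t : ℝ) :
    ∀ᶠ k : ℕ in atTop,
      (wsum (2 ^ k) fun w => p w * Real.exp (t * (X w / 2 ^ k - lam))) ≤ 4 := by
  have hM0 : 0 ≤ M := by
    have := hM [] (by rw [h.nil]; norm_num)
    have h0 := abs_nonneg (X [])
    simp at this
    linarith
  set R := |t| * (2 * M + |lam|) with hR
  -- The constant 3 exceeds e and does not depend on t. All dependence on t multiplies x ^ 2, which
  -- mean-square convergence makes negligible, so the final bound 4 holds for every t, only later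
  -- for larger t.
  have hexp : ∀ x : ℝ, |x| ≤ R → Real.exp x ≤ 3 + Real.exp R * x ^ 2 := by
    intro x hx
    by_cases h1 : x ≤ 1
    · have h2 : Real.exp x ≤ Real.exp 1 := Real.exp_le_exp.2 h1
      have h3 := Real.exp_one_lt_d9
      have h4 : 0 ≤ Real.exp R * x ^ 2 := by positivity
      linarith
    · push Not at h1
      have h2 : Real.exp x ≤ Real.exp R := Real.exp_le_exp.2 ((le_abs_self x).trans hx)
      have h3 : Real.exp R ≤ Real.exp R * x ^ 2 :=
        le_mul_of_one_le_right (Real.exp_pos _).le (by nlinarith)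
      linarith
  have h1 : Tendsto (fun k : ℕ => (Real.exp R * t ^ 2) *
      wsum (2 ^ k) fun w => p w * (X w / 2 ^ k - lam) ^ 2) atTop (𝓝 0) := by
    simpa using hlam.const_mul (Real.exp R * t ^ 2)
  filter_upwards [h1.eventually (ge_mem_nhds zero_lt_one)] with k hk
  calc (wsum (2 ^ k) fun w => p w * Real.exp (t * (X w / 2 ^ k - lam)))
      ≤ wsum (2 ^ k) fun w => 3 * p w +
        (Real.exp R * t ^ 2) * (p w * (X w / 2 ^ k - lam) ^ 2) := by
        refine wsum_mono fun w hw => ?_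
        rcases (h.nonneg w).eq_or_lt with h0 | h0
        · simp [← h0]
        have h2 : (0 : ℝ) < 2 ^ k := by positivity
        have h3 : |X w / 2 ^ k| ≤ 2 * M := by
          rw [abs_div, abs_of_pos h2, div_le_iff₀ h2]
          refine (hM w h0).trans ?_
          have h4 : (1 : ℝ) ≤ 2 ^ k := one_le_pow₀ (by norm_num)
          rw [hw]; push_cast
          nlinarith
        have h5 : |t * (X w / 2 ^ k - lam)| ≤ R := by
          rw [abs_mul]
          exact mul_le_mul_of_nonneg_left ((abs_sub _ _).trans (by linarith)) (abs_nonneg t)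
        have := mul_le_mul_of_nonneg_left (hexp _ h5) h0.le
        refine this.trans_eq ?_
        ring
    _ = 3 * 1 + (Real.exp R * t ^ 2) *
        wsum (2 ^ k) fun w => p w * (X w / 2 ^ k - lam) ^ 2 := by
        rw [wsum_add, wsum_mul_left, wsum_mul_left, h.wsum_eq_one]
    _ ≤ 4 := by linarith

end Stationary

end

/-! ### Fibre sums, weights and their exponential tilts -/

noncomputable section

theorem wsum_jensen {A : Type*} [Fintype A] {n : ℕ} {p X : List A → ℝ}
    (hp : ∀ w, 0 ≤ p w) (hpos : 0 < wsum n p) :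
    wsum n p * Real.exp ((wsum n fun w => p w * X w) / wsum n p) ≤
      wsum n fun w => p w * Real.exp (X w) := by
  set m := (wsum n fun w => p w * X w) / wsum n p with hm
  have h1 : (wsum n fun w => p w * X w) = m * wsum n p := by rw [hm]; field_simp
  calc wsum n p * Real.exp m = wsum n fun w =>
        Real.exp m * (p w * X w) + (Real.exp m * (1 - m)) * p w := by
        rw [wsum_add, wsum_mul_left, wsum_mul_left, h1]; ring
    _ ≤ _ := by
        refine wsum_mono fun w _ => ?_
        have h2 : Real.exp m * (X w - m + 1) ≤ Real.exp m * Real.exp (X w - m) :=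
          mul_le_mul_of_nonneg_left (Real.add_one_le_exp _) (Real.exp_pos m).le
        rw [← Real.exp_add, add_sub_cancel] at h2
        have := mul_le_mul_of_nonneg_left h2 (hp w)
        linarith

/-! ### The functions `I_{ψ,q}` and the weights -/

variable {r₁ r₂ : ℕ} {ψ : List (Fin r₁ × Fin r₂) → ℝ} {C : ℝ}

theorem sExp_pos (h₁ : 2 ≤ r₁) (h₂ : r₁ ≤ r₂) : 0 < sExp r₁ r₂ :=
  div_pos (Real.log_pos (by exact_mod_cast (by omega : 1 < r₁)))
    (Real.log_pos (by exact_mod_cast (by omega : 1 < r₂)))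

theorem sExp_le_one (h₁ : 2 ≤ r₁) (h₂ : r₁ ≤ r₂) : sExp r₁ r₂ ≤ 1 := by
  unfold sExp
  rw [div_le_one (Real.log_pos (by exact_mod_cast (by omega : 1 < r₂)))]
  exact Real.log_le_log (by exact_mod_cast (by omega : 0 < r₁)) (by exact_mod_cast h₂)

theorem fiberSum_eq (ψ : List (Fin r₁ × Fin r₂) → ℝ) (q : ℝ) (u : List (Fin r₁)) :
    fiberSum ψ q u = wsum u.length fun v => pow₀ (ψ (u.zip v)) q := by
  unfold fiberSum wsum
  refine Finset.sum_congr rfl fun v _ => ?_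
  rw [← zip_ofFn u.get v, List.ofFn_get]

namespace QuasiMul

theorem quasiMul_fiberSum (hψ : QuasiMul C ψ) (q : ℝ) : QuasiMul (C ^ |q|) (fiberSum ψ q) :=
  (hψ.pow q).fiber.congr fun u => (fiberSum_eq ψ q u).symm

theorem fiberSum_one (hψ : QuasiMul C ψ) : QuasiMul C (fiberSum ψ 1) := by
  simpa using hψ.quasiMul_fiberSum 1

/-- As 0 < s ≤ 1, the two exponents of C are |q| (1 - s) and |q| s, with sum |q|. The explicit
constant matters: it is bounded for q in a bounded set, uniformly in the word length. -/
theorem quasiMul_weight (hψ : QuasiMul C ψ) (h₁ : 2 ≤ r₁) (h₂ : r₁ ≤ r₂) (q : ℝ) :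
    QuasiMul (C ^ |q|) (weight ψ q) := by
  have h := (hψ.fiberSum_one.pow (q * (1 - sExp r₁ r₂))).mul
    ((hψ.quasiMul_fiberSum q).pow (sExp r₁ r₂))
  have hs := sExp_pos h₁ h₂
  have hs1 := sExp_le_one h₁ h₂
  refine h.mono ?_
  rw [← Real.rpow_mul hψ.pos.le, ← Real.rpow_add hψ.pos, abs_mul, abs_of_pos hs,
    abs_of_nonneg (by linarith : 0 ≤ 1 - sExp r₁ r₂)]
  apply le_of_eq
  congr 1
  ring

theorem fiberSum_pos (hψ : QuasiMul C ψ) (q : ℝ) {w : List (Fin r₁ × Fin r₂)} (hw : 0 < ψ w) :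
    0 < fiberSum ψ q (w.map Prod.fst) := by
  rw [fiberSum_eq]
  have h1 : w = (w.map Prod.fst).zip (w.map Prod.snd) := by
    rw [List.zip_map', List.map_id'' (fun _ => rfl)]
  have h2 := le_wsum (f := fun v => pow₀ (ψ ((w.map Prod.fst).zip v)) q)
    (fun v => pow₀_nonneg (hψ.nonneg _) q) (w.map Prod.snd)
  rw [List.length_map, ← h1] at h2
  rw [List.length_map]
  exact (pow₀_pos hw q).trans_le h2

theorem exists_of_fiberSum_pos (hψ : QuasiMul C ψ) {q : ℝ} {u : List (Fin r₁)}
    (hu : 0 < fiberSum ψ q u) : ∃ w, w.map Prod.fst = u ∧ 0 < ψ w := by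
  by_contra! h
  rw [fiberSum_eq] at hu
  have : (wsum u.length fun v => pow₀ (ψ (u.zip v)) q) ≤ wsum u.length fun _ : List (Fin r₂) => 0 := by
    refine wsum_mono fun v hv => ?_
    have h1 := le_antisymm (h (u.zip v) (map_fst_zip hv)) (hψ.nonneg _)
    rw [h1, pow₀_zero]
  rw [wsum_const_zero] at this
  linarith

/-- With 0 ^ q = 0, the support of every I_{ψ,q} is the projection of the support of ψ, so it is the
same for all q. -/
theorem fiberSum_pos_iff (hψ : QuasiMul C ψ) {q q' : ℝ} {u : List (Fin r₁)} :
    0 < fiberSum ψ q u ↔ 0 < fiberSum ψ q' u := by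
  constructor <;> intro h <;> obtain ⟨w, rfl, hw⟩ := hψ.exists_of_fiberSum_pos h <;>
    exact hψ.fiberSum_pos _ hw

theorem weight_eq_exp (hψ : QuasiMul C ψ) (q : ℝ) {u : List (Fin r₁)}
    (hu : 0 < fiberSum ψ 1 u) :
    weight ψ q u = Real.exp (q * (1 - sExp r₁ r₂) * Real.log (fiberSum ψ 1 u)
      + sExp r₁ r₂ * Real.log (fiberSum ψ q u)) := by
  have hq := (hψ.fiberSum_pos_iff (q' := q)).1 hu
  unfold weight
  rw [pow₀_of_pos hu, pow₀_of_pos hq, Real.rpow_def_of_pos hu, Real.rpow_def_of_pos hq,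
    ← Real.exp_add]
  congr 1; ring

theorem weight_eq_zero (hψ : QuasiMul C ψ) (q : ℝ) {u : List (Fin r₁)}
    (hu : ¬ 0 < fiberSum ψ 1 u) : weight ψ q u = 0 := by
  have : fiberSum ψ 1 u = 0 :=
    le_antisymm (not_lt.1 hu) (hψ.fiberSum_one.nonneg u)
  simp [weight, this, pow₀_zero]

theorem weight_letter_pos (hψ : QuasiMul C ψ) {a : Fin r₁ × Fin r₂} (ha : 0 < ψ [a]) (q : ℝ) :
    0 < weight ψ q [a.1] := by
  have h := hψ.fiberSum_pos 1 ha
  rw [List.map_singleton] at h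
  rw [hψ.weight_eq_exp q h]
  exact Real.exp_pos _

end QuasiMul

/-! ### The lift of the weight to `𝔸₁ × 𝔸₂` -/

/-- The function of the cylinders of `𝔸₁ × 𝔸₂` with marginal `weight ψ q` and with conditional
masses on the fibres proportional to `ψ ^ q`. -/
def lift (ψ : List (Fin r₁ × Fin r₂) → ℝ) (q : ℝ) (w : List (Fin r₁ × Fin r₂)) : ℝ :=
  pow₀ (fiberSum ψ 1 (w.map Prod.fst)) (q * (1 - sExp r₁ r₂)) *
    pow₀ (fiberSum ψ q (w.map Prod.fst)) (sExp r₁ r₂ - 1) * pow₀ (ψ w) q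

namespace QuasiMul

theorem quasiMul_lift (hψ : QuasiMul C ψ) (q : ℝ) : ∃ C', QuasiMul C' (lift ψ q) :=
  ⟨_, (((hψ.fiberSum_one.pow _).comp_map Prod.fst).mul
    (((hψ.quasiMul_fiberSum q).pow _).comp_map Prod.fst)).mul (hψ.pow q)⟩

theorem lift_nonneg (hψ : QuasiMul C ψ) (q : ℝ) (w : List (Fin r₁ × Fin r₂)) :
    0 ≤ lift ψ q w := (hψ.quasiMul_lift q).choose_spec.nonneg w

theorem lift_eq_exp (hψ : QuasiMul C ψ) (q : ℝ) {w : List (Fin r₁ × Fin r₂)} (hw : 0 < ψ w) :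
    lift ψ q w = Real.exp (q * (1 - sExp r₁ r₂) *
      Real.log (fiberSum ψ 1 (w.map Prod.fst)) + (sExp r₁ r₂ - 1) *
      Real.log (fiberSum ψ q (w.map Prod.fst)) + q * Real.log (ψ w)) := by
  have h1 := hψ.fiberSum_pos 1 hw
  have hq := hψ.fiberSum_pos q hw
  unfold lift
  rw [pow₀_of_pos h1, pow₀_of_pos hq, pow₀_of_pos hw, Real.rpow_def_of_pos h1,
    Real.rpow_def_of_pos hq, Real.rpow_def_of_pos hw, ← Real.exp_add, ← Real.exp_add]
  congr 1; ring

theorem lift_pos_iff (hψ : QuasiMul C ψ) (q : ℝ) {w : List (Fin r₁ × Fin r₂)} :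
    0 < lift ψ q w ↔ 0 < ψ w := by
  refine ⟨fun h => (hψ.nonneg w).lt_of_ne fun h0 => ?_, fun h => ?_⟩
  · rw [lift, ← h0, pow₀_zero, mul_zero] at h
    exact lt_irrefl _ h
  · rw [hψ.lift_eq_exp q h]; exact Real.exp_pos _

/-- Sums of the lift along a fibre. -/
theorem wsum_lift_zip (hψ : QuasiMul C ψ) (q : ℝ) (u : List (Fin r₁))
    (F : List (Fin r₁ × Fin r₂) → ℝ) :
    (wsum u.length fun v => lift ψ q (u.zip v) * F (u.zip v)) =
      weight ψ q u * ((wsum u.length fun v => pow₀ (ψ (u.zip v)) q * F (u.zip v)) /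
        fiberSum ψ q u) := by
  have h1 : (wsum u.length fun v => lift ψ q (u.zip v) * F (u.zip v)) =
      pow₀ (fiberSum ψ 1 u) (q * (1 - sExp r₁ r₂)) *
      pow₀ (fiberSum ψ q u) (sExp r₁ r₂ - 1) *
      wsum u.length fun v => pow₀ (ψ (u.zip v)) q * F (u.zip v) := by
    rw [← wsum_mul_left]
    refine wsum_congr fun v hv => ?_
    rw [lift, map_fst_zip hv]
    ring
  rw [h1, weight]
  rcases ((hψ.quasiMul_fiberSum q).nonneg u).eq_or_lt with h0 | h0
  · simp [← h0, pow₀_zero]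
  · rw [pow₀_of_pos h0, pow₀_of_pos h0, Real.rpow_sub_one h0.ne']
    ring

theorem wsum_lift_zip_one (hψ : QuasiMul C ψ) (q : ℝ) (u : List (Fin r₁)) :
    (wsum u.length fun v => lift ψ q (u.zip v)) = weight ψ q u := by
  have := hψ.wsum_lift_zip q u fun _ => 1
  simp only [mul_one] at this
  rw [this, ← fiberSum_eq]
  rcases ((hψ.quasiMul_fiberSum q).nonneg u).eq_or_lt with h0 | h0
  · simp [weight, ← h0, pow₀_zero]
  · rw [div_self h0.ne', mul_one]

theorem wsum_lift_fst (hψ : QuasiMul C ψ) (q : ℝ) (n : ℕ) (F : List (Fin r₁) → ℝ) :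
    (wsum n fun w => lift ψ q w * F (w.map Prod.fst)) =
      wsum n fun u => weight ψ q u * F u := by
  rw [wsum_zip]
  refine wsum_congr fun u hu => ?_
  subst hu
  rw [← hψ.wsum_lift_zip_one, ← wsum_mul_right]
  refine wsum_congr fun v hv => ?_
  rw [map_fst_zip hv]

theorem wsum_lift (hψ : QuasiMul C ψ) (q : ℝ) (n : ℕ) :
    wsum n (lift ψ q) = wsum n (weight ψ q) := by
  simpa using hψ.wsum_lift_fst q n fun _ => 1

end QuasiMul

/-- The logarithmic derivative of `q ↦ ∑_{|u| = n} weight ψ q u`. -/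
def energy (ψ : List (Fin r₁ × Fin r₂) → ℝ) (q : ℝ) (n : ℕ) : ℝ :=
  (wsum n fun w => lift ψ q w * ((1 - sExp r₁ r₂) * Real.log (fiberSum ψ 1 (w.map Prod.fst)) +
    sExp r₁ r₂ * Real.log (ψ w))) / wsum n (weight ψ q)

namespace QuasiMul

/-- The energy is a subgradient of the logarithm of the partition function. -/
theorem wsum_weight_ge (hψ : QuasiMul C ψ) (h₁ : 2 ≤ r₁) (h₂ : r₁ ≤ r₂) {q : ℝ} {n : ℕ}
    (hW : 0 < wsum n (weight ψ q)) (q' : ℝ) :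
    wsum n (weight ψ q) * Real.exp ((q' - q) * energy ψ q n) ≤
      wsum n (weight ψ q') := by
  set s := sExp r₁ r₂ with hs
  have hs0 : 0 < s := sExp_pos h₁ h₂
  set E : List (Fin r₁) → ℝ := fun u =>
    (wsum u.length fun v => pow₀ (ψ (u.zip v)) q * Real.log (ψ (u.zip v))) /
      fiberSum ψ q u with hE
  have h1 : (wsum n fun w => lift ψ q w *
      ((1 - s) * Real.log (fiberSum ψ 1 (w.map Prod.fst)) + s * Real.log (ψ w))) =
      wsum n fun u => weight ψ q u *
        ((1 - s) * Real.log (fiberSum ψ 1 u) + s * E u) := by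
    have h2 := hψ.wsum_lift_fst q n fun u => (1 - s) * Real.log (fiberSum ψ 1 u)
    have h3 : (wsum n fun w => lift ψ q w * Real.log (ψ w)) =
        wsum n fun u => weight ψ q u * E u := by
      rw [wsum_zip]
      refine wsum_congr fun u hu => ?_
      subst hu
      exact hψ.wsum_lift_zip q u fun w => Real.log (ψ w)
    calc _ = (wsum n fun w => lift ψ q w *
          ((1 - s) * Real.log (fiberSum ψ 1 (w.map Prod.fst)))) +
          s * wsum n fun w => lift ψ q w * Real.log (ψ w) := by
          rw [← wsum_mul_left, ← wsum_add]
          exact wsum_congr fun w _ => by ring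
      _ = _ := by
          rw [h2, h3, ← wsum_mul_left, ← wsum_add]
          exact wsum_congr fun u _ => by ring
  -- Jensen on the base, with log ψ replaced by its fibre average E u under ψ ^ q / I_{ψ,q}. What
  -- remains is an inequality for each u, obtained from a second use of Jensen in the fibre and from
  -- s > 0.
  have h4 := wsum_jensen (p := weight ψ q) (n := n)
    (X := fun u => (q' - q) * ((1 - s) * Real.log (fiberSum ψ 1 u) + s * E u))
    (hψ.quasiMul_weight h₁ h₂ q).nonneg hW
  have h5 : (wsum n fun u => weight ψ q u *
      ((q' - q) * ((1 - s) * Real.log (fiberSum ψ 1 u) + s * E u))) /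
      wsum n (weight ψ q) = (q' - q) * energy ψ q n := by
    rw [energy, h1, ← mul_div_assoc, ← wsum_mul_left]
    congr 1
    exact wsum_congr fun u _ => by ring
  rw [h5] at h4
  refine h4.trans (wsum_mono fun u _ => ?_)
  by_cases hu : 0 < fiberSum ψ 1 u
  swap
  · rw [hψ.weight_eq_zero q hu, zero_mul]
    exact (hψ.quasiMul_weight h₁ h₂ q').nonneg u
  have hq := (hψ.fiberSum_pos_iff (q' := q)).1 hu
  have hq' := (hψ.fiberSum_pos_iff (q' := q')).1 hu
  rw [hψ.weight_eq_exp q hu, hψ.weight_eq_exp q' hu, ← Real.exp_add, Real.exp_le_exp]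
  have h6 : Real.log (fiberSum ψ q u) + (q' - q) * E u ≤
      Real.log (fiberSum ψ q' u) := by
    have h7 := wsum_jensen (p := fun v => pow₀ (ψ (u.zip v)) q) (n := u.length)
      (X := fun v => (q' - q) * Real.log (ψ (u.zip v)))
      (fun v => pow₀_nonneg (hψ.nonneg _) q) (by rw [← fiberSum_eq]; exact hq)
    rw [← fiberSum_eq] at h7
    have h8 : (wsum u.length fun v => pow₀ (ψ (u.zip v)) q *
        ((q' - q) * Real.log (ψ (u.zip v)))) / fiberSum ψ q u = (q' - q) * E u := by
      simp only [hE]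
      rw [← mul_div_assoc, ← wsum_mul_left]
      congr 1
      exact wsum_congr fun u _ => by ring
    rw [h8] at h7
    have h9 : (wsum u.length fun v => pow₀ (ψ (u.zip v)) q *
        Real.exp ((q' - q) * Real.log (ψ (u.zip v)))) = fiberSum ψ q' u := by
      rw [fiberSum_eq]
      refine wsum_congr fun v _ => ?_
      rcases (hψ.nonneg (u.zip v)).eq_or_lt with h0 | h0
      · simp [← h0, pow₀_zero]
      · rw [pow₀_of_pos h0, pow₀_of_pos h0, Real.rpow_def_of_pos h0, Real.rpow_def_of_pos h0,
          ← Real.exp_add]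
        congr 1; ring
    rw [h9] at h7
    have := Real.log_le_log (by positivity) h7
    rwa [Real.log_mul hq.ne' (Real.exp_pos _).ne', Real.log_exp] at this
  have h7 := mul_le_mul_of_nonneg_left h6 hs0.le
  linarith

/-- An upper bound of the partition function at `q + ε` by exponential moments at `q`. -/
theorem wsum_weight_le (hψ : QuasiMul C ψ) (h₁ : 2 ≤ r₁) (h₂ : r₁ ≤ r₂) (q ε a b : ℝ) (n : ℕ) :
    wsum n (weight ψ (q + ε)) ≤
      Real.exp (ε * ((1 - sExp r₁ r₂) * a + sExp r₁ r₂ * b)) *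
      ((1 - sExp r₁ r₂) * (wsum n fun w => lift ψ q w *
          Real.exp (ε * (Real.log (fiberSum ψ 1 (w.map Prod.fst)) - a))) +
        sExp r₁ r₂ * (wsum n fun w => lift ψ q w *
          Real.exp (ε * (Real.log (ψ w) - b)))) := by
  have hs0 : 0 < sExp r₁ r₂ := sExp_pos h₁ h₂
  have hs1 : sExp r₁ r₂ ≤ 1 := sExp_le_one h₁ h₂
  rw [hψ.wsum_lift_fst q n fun u =>
    Real.exp (ε * (Real.log (fiberSum ψ 1 u) - a)), wsum_zip n fun w =>
    lift ψ q w * Real.exp (ε * (Real.log (ψ w) - b)), ← wsum_mul_left, ← wsum_mul_left,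
    ← wsum_add, ← wsum_mul_left]
  refine wsum_mono fun u hu => ?_
  subst hu
  rw [hψ.wsum_lift_zip q u fun w => Real.exp (ε * (Real.log (ψ w) - b))]
  by_cases hu : 0 < fiberSum ψ 1 u
  swap
  · simp [hψ.weight_eq_zero _ hu]
  have hq := (hψ.fiberSum_pos_iff (q' := q)).1 hu
  have hq' := (hψ.fiberSum_pos_iff (q' := q + ε)).1 hu
  have h1 : (wsum u.length fun v => pow₀ (ψ (u.zip v)) q *
      Real.exp (ε * (Real.log (ψ (u.zip v)) - b))) =
      Real.exp (-(ε * b)) * fiberSum ψ (q + ε) u := by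
    rw [fiberSum_eq, ← wsum_mul_left]
    refine wsum_congr fun v _ => ?_
    rcases (hψ.nonneg (u.zip v)).eq_or_lt with h0 | h0
    · simp [← h0, pow₀_zero]
    · rw [pow₀_of_pos h0, pow₀_of_pos h0, Real.rpow_def_of_pos h0, Real.rpow_def_of_pos h0,
        ← Real.exp_add, ← Real.exp_add]
      congr 1; ring
  rw [h1]
  set R := Real.exp (-(ε * b)) * fiberSum ψ (q + ε) u / fiberSum ψ q u
    with hR
  have hR0 : 0 < R := by positivity
  have hlR : Real.log R = -(ε * b) + Real.log (fiberSum ψ (q + ε) u) -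
      Real.log (fiberSum ψ q u) := by
    rw [hR, Real.log_div (by positivity) hq.ne', Real.log_mul (Real.exp_pos _).ne' hq'.ne',
      Real.log_exp]
  set T := Real.exp (ε * (Real.log (fiberSum ψ 1 u) - a)) with hT
  have hT0 : 0 < T := Real.exp_pos _
  -- The tilt of the weight is the product T ^ (1 - s) * R ^ s. Weighted AM-GM separates the
  -- contributions of I_{ψ,1} and ψ, so no joint moment is needed.
  have h2 := Real.geom_mean_le_arith_mean2_weighted (by linarith : 0 ≤ 1 - sExp r₁ r₂) hs0.le
    hT0.le hR0.le (by ring)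
  have h3 : weight ψ (q + ε) u = Real.exp (ε * ((1 - sExp r₁ r₂) * a + sExp r₁ r₂ * b)) *
      (weight ψ q u * (T ^ (1 - sExp r₁ r₂) * R ^ sExp r₁ r₂)) := by
    rw [hψ.weight_eq_exp _ hu, hψ.weight_eq_exp _ hu, Real.rpow_def_of_pos hT0,
      Real.rpow_def_of_pos hR0, hlR, hT, Real.log_exp, ← Real.exp_add, ← Real.exp_add,
      ← Real.exp_add]
    congr 1; ring
  rw [h3]
  refine mul_le_mul_of_nonneg_left ?_ (Real.exp_pos _).le
  have := mul_le_mul_of_nonneg_left h2 ((hψ.quasiMul_weight h₁ h₂ q).nonneg u)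
  linarith

end QuasiMul

end

/-! ### Convexity, differentiability and monotonicity of the pressure -/

noncomputable section

theorem slope_le_leftDeriv_univ {f : ℝ → ℝ} (hf : ConvexOn ℝ Set.univ f) {x y : ℝ}
    (hxy : y < x) : slope f x y ≤ derivWithin f (Set.Iio x) x := by
  rw [slope_comm]
  exact hf.slope_le_leftDeriv_of_mem_interior (Set.mem_univ y) (by simp) hxy

/-- A convex function is differentiable at `q` as soon as its increments at arbitrarily small
scales `h` are at most `t * lam * h + K * h`, with `K` independent of `t`. -/
theorem hasDerivAt_of_convexOn {f : ℝ → ℝ} (hf : ConvexOn ℝ Set.univ f) {q lam K : ℝ}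
    (hK : 0 ≤ K) (h : ∀ t : ℝ, ∃ δ : ℝ, 0 < δ ∧ (f (q + t * δ) - f q) / δ ≤ t * lam + K) :
    HasDerivAt f lam q := by
  have hq : q ∈ interior (Set.univ : Set ℝ) := by simp
  have hr : derivWithin f (Set.Ioi q) q ≤ lam := by
    refine le_of_forall_pos_le_add fun ε hε => ?_
    -- Convexity bounds the one-sided derivative by the slope over any increment t * δ. Dividing the
    -- hypothesis by this t turns the error K into less than ε, whatever δ is.
    have ht : 0 < (K + 1) / ε := by positivity
    obtain ⟨δ, hδ, h1⟩ := h ((K + 1) / ε)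
    have h2 := hf.rightDeriv_le_slope_of_mem_interior hq
      (Set.mem_univ (q + (K + 1) / ε * δ)) (by simp; positivity)
    refine h2.trans ?_
    rw [slope_def_field, add_sub_cancel_left]
    rw [div_le_iff₀ hδ] at h1
    rw [div_le_iff₀ (by positivity)]
    have h3 : (lam + ε) * ((K + 1) / ε * δ) = ((K + 1) / ε * lam + (K + 1)) * δ := by
      field_simp
    rw [h3]
    nlinarith
  have hl : lam ≤ derivWithin f (Set.Iio q) q := by
    refine le_of_forall_pos_le_add fun ε hε => ?_
    have ht : 0 < (K + 1) / ε := by positivity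
    obtain ⟨δ, hδ, h1⟩ := h (-((K + 1) / ε))
    have hlt : q + -((K + 1) / ε) * δ < q := by
      have : 0 < (K + 1) / ε * δ := by positivity
      linarith
    have h2 := slope_le_leftDeriv_univ hf hlt
    refine le_trans ?_ (add_le_add_left h2 ε)
    rw [slope_def_field, add_sub_cancel_left]
    rw [div_le_iff₀ hδ] at h1
    rw [← sub_le_iff_le_add, le_div_iff_of_neg (by linarith)]
    have h3 : (lam - ε) * (-((K + 1) / ε) * δ) = (-((K + 1) / ε) * lam + (K + 1)) * δ := by
      field_simp; ring
    rw [h3]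
    nlinarith
  -- Convexity orders the one-sided derivatives the other way, so both equal lam.
  have hlr := hf.leftDeriv_le_rightDeriv_of_mem_interior hq
  have h1 := hf.hasDerivWithinAt_rightDeriv_of_mem_interior hq
  have h2 := hf.hasDerivWithinAt_leftDeriv_of_mem_interior hq
  rw [le_antisymm hr (hl.trans hlr)] at h1
  rw [le_antisymm (hlr.trans hr) hl] at h2
  rw [hasDerivAt_iff_tendsto_slope_left_right]
  exact ⟨(hasDerivWithinAt_iff_tendsto_slope' (by simp)).1 h2,
    (hasDerivWithinAt_iff_tendsto_slope' (by simp)).1 h1⟩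

variable {r₁ r₂ : ℕ} {ψ : List (Fin r₁ × Fin r₂) → ℝ} {C : ℝ} {a : Fin r₁ × Fin r₂}

namespace QuasiMul

theorem wsum_weight_pos (hψ : QuasiMul C ψ) (h₁ : 2 ≤ r₁) (h₂ : r₁ ≤ r₂) (ha : 0 < ψ [a])
    (q : ℝ) (n : ℕ) : 0 < wsum n (weight ψ q) :=
  (hψ.quasiMul_weight h₁ h₂ q).wsum_pos (hψ.weight_letter_pos ha q) n

theorem tendsto_pressure_weight (hψ : QuasiMul C ψ) (h₁ : 2 ≤ r₁) (h₂ : r₁ ≤ r₂)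
    (ha : 0 < ψ [a]) (q : ℝ) :
    Tendsto (pressureSeq (weight ψ q)) atTop (𝓝 (pressure (weight ψ q))) :=
  (hψ.quasiMul_weight h₁ h₂ q).tendsto_pressureSeq (hψ.weight_letter_pos ha q)

theorem abs_log_wsum_weight_sub_le (hψ : QuasiMul C ψ) (h₁ : 2 ≤ r₁) (h₂ : r₁ ≤ r₂)
    (ha : 0 < ψ [a]) (q : ℝ) (n : ℕ) :
    |Real.log (wsum n (weight ψ q)) - n * pressure (weight ψ q)| ≤ |q| * Real.log C := by
  have := (hψ.quasiMul_weight h₁ h₂ q).abs_log_wsum_sub_le (hψ.weight_letter_pos ha q) n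
  rwa [Real.log_rpow hψ.pos] at this

theorem log_wsum_weight_ge (hψ : QuasiMul C ψ) (h₁ : 2 ≤ r₁) (h₂ : r₁ ≤ r₂)
    (ha : 0 < ψ [a]) (q q' : ℝ) (n : ℕ) :
    Real.log (wsum n (weight ψ q)) + (q' - q) * energy ψ q n ≤
      Real.log (wsum n (weight ψ q')) := by
  have hW := hψ.wsum_weight_pos h₁ h₂ ha q n
  have := Real.log_le_log (mul_pos hW (Real.exp_pos _)) (hψ.wsum_weight_ge h₁ h₂ hW q')
  rwa [Real.log_mul hW.ne' (Real.exp_pos _).ne', Real.log_exp] at this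

/-- At finite level the energy at c x + d y provides a supporting line; evaluating it at x and y and
averaging gives convexity, which survives the limit. -/
theorem convexOn_pressure (hψ : QuasiMul C ψ) (h₁ : 2 ≤ r₁) (h₂ : r₁ ≤ r₂) (ha : 0 < ψ [a]) :
    ConvexOn ℝ Set.univ fun q => pressure (weight ψ q) := by
  refine ⟨convex_univ, fun x _ y _ c d hc hd hcd => ?_⟩
  simp only [smul_eq_mul]
  refine le_of_tendsto_of_tendsto' (hψ.tendsto_pressure_weight h₁ h₂ ha _)
    (((hψ.tendsto_pressure_weight h₁ h₂ ha x).const_mul c).add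
      ((hψ.tendsto_pressure_weight h₁ h₂ ha y).const_mul d)) fun n => ?_
  have h3 := mul_le_mul_of_nonneg_left (hψ.log_wsum_weight_ge h₁ h₂ ha (c * x + d * y) x n) hc
  have h4 := mul_le_mul_of_nonneg_left (hψ.log_wsum_weight_ge h₁ h₂ ha (c * x + d * y) y n) hd
  have h5 : Real.log (wsum n (weight ψ (c * x + d * y))) ≤
      c * Real.log (wsum n (weight ψ x)) + d * Real.log (wsum n (weight ψ y)) := by
    have hd' : d = 1 - c := by linarith
    subst hd'
    linarith
  have h6 : (0 : ℝ) ≤ 1 / n := by positivity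
  have := mul_le_mul_of_nonneg_left h5 h6
  simp only [pressureSeq, wsum] at *
  linarith

end QuasiMul

/-- The lift of `weight ψ q`, normalized to have pressure zero. -/
def normalizedLift (ψ : List (Fin r₁ × Fin r₂) → ℝ) (q : ℝ) (w : List (Fin r₁ × Fin r₂)) : ℝ :=
  Real.exp (-pressure (weight ψ q) * w.length) * lift ψ q w

namespace QuasiMul

theorem quasiMul_normalizedLift (hψ : QuasiMul C ψ) (q : ℝ) :
    ∃ C', QuasiMul C' (normalizedLift ψ q) :=
  let ⟨C', h⟩ := hψ.quasiMul_lift q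
  ⟨C', h.exp_mul _⟩

theorem wsum_normalizedLift (hψ : QuasiMul C ψ) (q : ℝ) (n : ℕ) :
    wsum n (normalizedLift ψ q) =
      Real.exp (-pressure (weight ψ q) * n) * wsum n (weight ψ q) := by
  rw [← hψ.wsum_lift, ← wsum_mul_left]
  refine wsum_congr fun w hw => ?_
  rw [normalizedLift, hw]

theorem wsum_normalizedLift_pos (hψ : QuasiMul C ψ) (h₁ : 2 ≤ r₁) (h₂ : r₁ ≤ r₂)
    (ha : 0 < ψ [a]) (q : ℝ) (n : ℕ) : 0 < wsum n (normalizedLift ψ q) := by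
  rw [hψ.wsum_normalizedLift]
  exact mul_pos (Real.exp_pos _) (hψ.wsum_weight_pos h₁ h₂ ha q n)

theorem abs_log_wsum_normalizedLift_le (hψ : QuasiMul C ψ) (h₁ : 2 ≤ r₁) (h₂ : r₁ ≤ r₂)
    (ha : 0 < ψ [a]) (q : ℝ) (n : ℕ) :
    |Real.log (wsum n (normalizedLift ψ q))| ≤ |q| * Real.log C := by
  have h1 := hψ.abs_log_wsum_weight_sub_le h₁ h₂ ha q n
  rw [hψ.wsum_normalizedLift, Real.log_mul (Real.exp_pos _).ne'
    (hψ.wsum_weight_pos h₁ h₂ ha q n).ne', Real.log_exp]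
  convert h1 using 2; ring

/-- The derivative is (1 - s) u + s v, where u and v are the mean growth rates of log I_{ψ,1} and
log ψ under the stationary law comparable to the normalized lift. Tilting by t / 2 ^ k on words of
length 2 ^ k changes the partition function by at most exp (t lam) times a constant free of t, and
passing to the pressure costs only the uniform finite-length error. -/
theorem hasDerivAt_pressure (hψ : QuasiMul C ψ) (h₁ : 2 ≤ r₁) (h₂ : r₁ ≤ r₂) (ha : 0 < ψ [a])
    (q : ℝ) : ∃ lam, HasDerivAt (fun q => pressure (weight ψ q)) lam q := by
  set P := pressure (weight ψ q) with hP
  set s := sExp r₁ r₂ with hs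
  have hs0 : 0 < s := sExp_pos h₁ h₂
  have hs1 : s ≤ 1 := sExp_le_one h₁ h₂
  set f := normalizedLift ψ q with hf
  obtain ⟨C', hfq⟩ := hψ.quasiMul_normalizedLift q
  have hlogf := hψ.abs_log_wsum_normalizedLift_le h₁ h₂ ha q
  have hwpos := hψ.wsum_normalizedLift_pos h₁ h₂ ha q
  have hZ0 : 0 ≤ |q| * Real.log C := mul_nonneg (abs_nonneg q) hψ.log_nonneg
  obtain ⟨K, K', p, hK, hst, hfp, hpf⟩ := hfq.exists_stationary
    (Z := Real.exp (|q| * Real.log C)) (Real.one_le_exp hZ0)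
    (fun n => by
      rw [← Real.log_le_iff_le_exp (hwpos n)]; exact le_of_abs_le (hlogf n))
    (fun n => by
      rw [← Real.exp_log (hwpos n), ← Real.exp_add, Real.one_le_exp_iff]
      have := neg_le_of_abs_le (hlogf n)
      linarith)
  have hpψ : ∀ w, 0 < p w → 0 < ψ w := by
    intro w hw
    have h1 : 0 < f w := (mul_pos_iff_of_pos_left hK).1 (hw.trans_le (hpf w))
    exact (hψ.lift_pos_iff q).1 ((mul_pos_iff_of_pos_left (Real.exp_pos _)).1 h1)
  set U : List (Fin r₁ × Fin r₂) → ℝ := fun w => Real.log (fiberSum ψ 1 (w.map Prod.fst)) with hU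
  set V : List (Fin r₁ × Fin r₂) → ℝ := fun w => Real.log (ψ w) with hV
  have hI := hψ.fiberSum_one.comp_map (B := Fin r₁ × Fin r₂) Prod.fst
  obtain ⟨MU, -, hMU⟩ := hI.exists_abs_log_le
  obtain ⟨MV, -, hMV⟩ := hψ.exists_abs_log_le
  obtain ⟨u, hu⟩ := hst.exists_mean (X := U) fun w w' hw =>
    hI.abs_log_append_le (hψ.fiberSum_pos 1 (hpψ _ hw))
  obtain ⟨v, hv⟩ := hst.exists_mean (X := V) fun w w' hw => hψ.abs_log_append_le (hpψ _ hw)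
  refine ⟨(1 - s) * u + s * v, hasDerivAt_of_convexOn (hψ.convexOn_pressure h₁ h₂ ha)
    (K := (|q| + 1) * Real.log C + |Real.log (4 * K)|) (by have := hψ.log_nonneg; positivity)
    fun t => ?_⟩
  -- This keeps |q + t / 2 ^ k| ≤ |q| + 1, so the finite-length error at the tilted parameter is
  -- bounded independently of t.
  have hlarge : ∀ᶠ k : ℕ in atTop, |t| ≤ (2 : ℝ) ^ k :=
    (tendsto_pow_atTop_atTop_of_one_lt (by norm_num : (1 : ℝ) < 2)).eventually_ge_atTop _
  obtain ⟨k, hk1, hk2, hk3⟩ := ((hst.eventually_exp_moment_le (X := U)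
    (fun w hw => hMU w (hψ.fiberSum_pos 1 (hpψ _ hw))) hu t).and
    ((hst.eventually_exp_moment_le (X := V) (fun w hw => hMV w (hpψ _ hw)) hv t).and
      hlarge)).exists
  have hk0 : (0 : ℝ) < 2 ^ k := by positivity
  refine ⟨1 / 2 ^ k, by positivity, ?_⟩
  have hmom : ∀ (X : List (Fin r₁ × Fin r₂) → ℝ) (x : ℝ),
      (wsum (2 ^ k) fun w => p w * Real.exp (t * (X w / 2 ^ k - x))) ≤ 4 →
      (wsum (2 ^ k) fun w => lift ψ q w * Real.exp (t * (1 / 2 ^ k) * (X w - 2 ^ k * x))) ≤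
        Real.exp (P * 2 ^ k) * (4 * K) := by
    intro X x hx
    calc _ ≤ wsum (2 ^ k) fun w => Real.exp (P * 2 ^ k) * K *
          (p w * Real.exp (t * (X w / 2 ^ k - x))) := by
          refine wsum_mono fun w hw => ?_
          have h1 : lift ψ q w = Real.exp (P * 2 ^ k) * f w := by
            simp only [hf, normalizedLift, ← hP]
            rw [hw, ← mul_assoc, ← Real.exp_add]
            push_cast
            rw [show P * 2 ^ k + -P * 2 ^ k = 0 by ring, Real.exp_zero, one_mul]
          have h2 : t * (1 / 2 ^ k) * (X w - 2 ^ k * x) = t * (X w / 2 ^ k - x) := by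
            field_simp
          rw [h1, h2]
          have h3 := mul_le_mul_of_nonneg_left (hfp w) (Real.exp_pos (P * 2 ^ k)).le
          have h4 := mul_le_mul_of_nonneg_right h3 (Real.exp_pos (t * (X w / 2 ^ k - x))).le
          linarith
      _ = Real.exp (P * 2 ^ k) * K * wsum (2 ^ k) fun w =>
          p w * Real.exp (t * (X w / 2 ^ k - x)) := wsum_mul_left _
      _ ≤ Real.exp (P * 2 ^ k) * K * 4 := by gcongr
      _ = _ := by ring
  have hle := hψ.wsum_weight_le h₁ h₂ q (t * (1 / 2 ^ k)) (2 ^ k * u) (2 ^ k * v) (2 ^ k)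
  have h3 := mul_le_mul_of_nonneg_left (hmom U u hk1) (by linarith : 0 ≤ 1 - s)
  have h4 := mul_le_mul_of_nonneg_left (hmom V v hk2) hs0.le
  have h5 : wsum (2 ^ k) (weight ψ (q + t * (1 / 2 ^ k))) ≤
      Real.exp (t * ((1 - s) * u + s * v)) * (Real.exp (P * 2 ^ k) * (4 * K)) := by
    refine hle.trans ?_
    have h6 : t * (1 / 2 ^ k) * ((1 - s) * (2 ^ k * u) + s * (2 ^ k * v)) =
        t * ((1 - s) * u + s * v) := by field_simp
    rw [h6]
    refine mul_le_mul_of_nonneg_left ?_ (Real.exp_pos _).le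
    linarith
  have h6 := Real.log_le_log (hψ.wsum_weight_pos h₁ h₂ ha _ _) h5
  rw [Real.log_mul (Real.exp_pos _).ne' (by positivity),
    Real.log_mul (Real.exp_pos _).ne' (by positivity), Real.log_exp, Real.log_exp] at h6
  have h7 := neg_le_of_abs_le
    (hψ.abs_log_wsum_weight_sub_le h₁ h₂ ha (q + t * (1 / 2 ^ k)) (2 ^ k))
  have h8 : |q + t * (1 / 2 ^ k)| * Real.log C ≤ (|q| + 1) * Real.log C := by
    refine mul_le_mul_of_nonneg_right ((abs_add_le _ _).trans ?_) hψ.log_nonneg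
    gcongr
    rw [abs_mul, abs_of_pos (by positivity : (0 : ℝ) < 1 / 2 ^ k), mul_one_div,
      div_le_one hk0]
    exact hk3
  have h9 := le_abs_self (Real.log (4 * K))
  push_cast at h7
  rw [div_div_eq_mul_div, div_one]
  linarith

/-- The energy per letter converges to the derivative of the pressure. -/
theorem tendsto_energy (hψ : QuasiMul C ψ) (h₁ : 2 ≤ r₁) (h₂ : r₁ ≤ r₂) (ha : 0 < ψ [a])
    {q lam : ℝ} (hd : HasDerivAt (fun q => pressure (weight ψ q)) lam q) :
    Tendsto (fun n : ℕ => energy ψ q n / n) atTop (𝓝 lam) := by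
  set P := fun q => pressure (weight ψ q) with hP
  -- The finite-level supporting line, with logarithms of partition functions replaced by n times
  -- the pressure at bounded cost. After division by n, small x < 0 gives the lower bound and small
  -- x > 0 the upper one.
  have key : ∀ x : ℝ, ∃ K, ∀ n : ℕ, x * (energy ψ q n) ≤ n * (P (q + x) - P q) + K := by
    intro x
    refine ⟨|q + x| * Real.log C + |q| * Real.log C, fun n => ?_⟩
    have h3 := hψ.log_wsum_weight_ge h₁ h₂ ha q (q + x) n
    have h4 := le_of_abs_le (hψ.abs_log_wsum_weight_sub_le h₁ h₂ ha (q + x) n)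
    have h5 := neg_le_of_abs_le (hψ.abs_log_wsum_weight_sub_le h₁ h₂ ha q n)
    simp only [add_sub_cancel_left] at h3
    simp only [hP]
    linarith
  have hslope := (hasDerivAt_iff_tendsto_slope_zero.1 hd)
  simp only [smul_eq_mul] at hslope
  rw [tendsto_order]
  constructor
  · intro b hb
    have h3 : ∀ᶠ x in 𝓝[<] (0 : ℝ), b < x⁻¹ * (P (q + x) - P q) :=
      (hslope.mono_left (nhdsWithin_mono _ fun x hx => (ne_of_lt hx : x ≠ 0))).eventually
        (lt_mem_nhds hb)
    obtain ⟨x, hx, hx0⟩ := (h3.and self_mem_nhdsWithin).exists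
    replace hx0 : x < 0 := hx0
    obtain ⟨K, hK⟩ := key x
    have h4 : Tendsto (fun n : ℕ => x⁻¹ * (P (q + x) - P q) + x⁻¹ * (K / n)) atTop
        (𝓝 (x⁻¹ * (P (q + x) - P q) + x⁻¹ * 0)) :=
      ((tendsto_const_div_atTop_nhds_zero_nat K).const_mul _).const_add _
    rw [mul_zero, add_zero] at h4
    filter_upwards [h4.eventually (lt_mem_nhds hx), eventually_gt_atTop 0] with n hn hn0
    refine hn.trans_le ?_
    have hn1 : (0 : ℝ) < n := by exact_mod_cast hn0
    have h5 := hK n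
    rw [← mul_add, inv_mul_eq_div, div_le_iff_of_neg hx0]
    have h6 : P (q + x) - P q + K / n = (n * (P (q + x) - P q) + K) / n := by field_simp
    rw [h6, div_mul_eq_mul_div]
    exact div_le_div_of_nonneg_right (by linarith) hn1.le
  · intro b hb
    have h3 : ∀ᶠ x in 𝓝[>] (0 : ℝ), x⁻¹ * (P (q + x) - P q) < b :=
      (hslope.mono_left (nhdsWithin_mono _ fun x hx => (ne_of_gt hx : x ≠ 0))).eventually
        (gt_mem_nhds hb)
    obtain ⟨x, hx, hx0⟩ := (h3.and self_mem_nhdsWithin).exists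
    replace hx0 : 0 < x := hx0
    obtain ⟨K, hK⟩ := key x
    have h4 : Tendsto (fun n : ℕ => x⁻¹ * (P (q + x) - P q) + x⁻¹ * (K / n)) atTop
        (𝓝 (x⁻¹ * (P (q + x) - P q) + x⁻¹ * 0)) :=
      ((tendsto_const_div_atTop_nhds_zero_nat K).const_mul _).const_add _
    rw [mul_zero, add_zero] at h4
    filter_upwards [h4.eventually (gt_mem_nhds hx), eventually_gt_atTop 0] with n hn hn0
    refine lt_of_le_of_lt ?_ hn
    have hn1 : (0 : ℝ) < n := by exact_mod_cast hn0
    have h5 := hK n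
    rw [← mul_add, inv_mul_eq_div, le_div_iff₀ hx0]
    have h6 : P (q + x) - P q + K / n = (n * (P (q + x) - P q) + K) / n := by field_simp
    rw [h6, div_mul_eq_mul_div]
    exact div_le_div_of_nonneg_right (by linarith) hn1.le

/-- Both ψ and I_{ψ,1} are at most D, so raising q to q' multiplies each weight by at most D ^ (q' -
q). This factor does not depend on the length and disappears in the pressure. -/
theorem pressure_weight_antitone (hψ : QuasiMul C ψ) (h₁ : 2 ≤ r₁) (h₂ : r₁ ≤ r₂)
    (ha : 0 < ψ [a]) {D : ℝ} (hD : 1 ≤ D) (hψD : ∀ n, wsum n ψ ≤ D) :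
    Antitone fun q => pressure (weight ψ q) := by
  intro q q' hqq
  set s := sExp r₁ r₂ with hs
  have hs0 : 0 < s := sExp_pos h₁ h₂
  have hs1 : s ≤ 1 := sExp_le_one h₁ h₂
  have hlD : 0 ≤ Real.log D := Real.log_nonneg hD
  have hle : ∀ n, wsum n (weight ψ q') ≤ Real.exp ((q' - q) * Real.log D) *
      wsum n (weight ψ q) := by
    intro n
    rw [← wsum_mul_left]
    refine wsum_mono fun u hu => ?_
    by_cases hu0 : 0 < fiberSum ψ 1 u
    swap
    · rw [hψ.weight_eq_zero _ hu0, hψ.weight_eq_zero _ hu0, mul_zero]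
    have hq := (hψ.fiberSum_pos_iff (q' := q)).1 hu0
    have hq' := (hψ.fiberSum_pos_iff (q' := q')).1 hu0
    have hψlog : ∀ w, 0 < ψ w → Real.log (ψ w) ≤ Real.log D := fun w hw =>
      Real.log_le_log hw ((le_wsum hψ.nonneg w).trans (hψD _))
    have h3 : Real.log (fiberSum ψ 1 u) ≤ Real.log D := by
      refine Real.log_le_log hu0 (le_trans ?_ (hψD n))
      rw [wsum_zip, fiberSum_eq, ← hu]
      simp only [pow₀_one]
      exact le_wsum (f := fun u => wsum u.length fun v => ψ (u.zip v))
        (fun u => wsum_nonneg fun v _ => hψ.nonneg _) u |>.trans_eq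
        (wsum_congr fun u' hu' => by rw [hu'])
    have h4 : Real.log (fiberSum ψ q' u) ≤ (q' - q) * Real.log D +
        Real.log (fiberSum ψ q u) := by
      rw [← Real.log_exp ((q' - q) * Real.log D), ← Real.log_mul (Real.exp_pos _).ne' hq.ne']
      refine Real.log_le_log hq' ?_
      rw [fiberSum_eq, fiberSum_eq, ← wsum_mul_left]
      refine wsum_mono fun v _ => ?_
      rcases (hψ.nonneg (u.zip v)).eq_or_lt with h0 | h0
      · simp [← h0, pow₀_zero]
      · rw [pow₀_of_pos h0, pow₀_of_pos h0, Real.rpow_def_of_pos h0, Real.rpow_def_of_pos h0,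
          ← Real.exp_add, Real.exp_le_exp]
        have := mul_le_mul_of_nonneg_left (hψlog _ h0) (by linarith : 0 ≤ q' - q)
        linarith
    rw [hψ.weight_eq_exp _ hu0, hψ.weight_eq_exp _ hu0, ← Real.exp_add, Real.exp_le_exp]
    have h5 := mul_le_mul_of_nonneg_left h3
      (mul_nonneg (by linarith : 0 ≤ q' - q) (by linarith : 0 ≤ 1 - s))
    have h6 := mul_le_mul_of_nonneg_left h4 hs0.le
    linarith
  have h3 : Tendsto (fun n : ℕ => ((q' - q) * Real.log D) / n + pressureSeq (weight ψ q) n)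
      atTop (𝓝 (0 + pressure (weight ψ q))) :=
    (tendsto_const_div_atTop_nhds_zero_nat _).add (hψ.tendsto_pressure_weight h₁ h₂ ha q)
  rw [zero_add] at h3
  refine le_of_tendsto_of_tendsto' (hψ.tendsto_pressure_weight h₁ h₂ ha q') h3 fun n => ?_
  have h4 := Real.log_le_log (hψ.wsum_weight_pos h₁ h₂ ha q' n) (hle n)
  rw [Real.log_mul (Real.exp_pos _).ne' (hψ.wsum_weight_pos h₁ h₂ ha q n).ne', Real.log_exp] at h4
  have h5 : (0 : ℝ) ≤ 1 / n := by positivity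
  have := mul_le_mul_of_nonneg_left h4 h5
  simp only [pressureSeq, wsum] at *
  refine this.trans_eq ?_
  ring

end QuasiMul

end

noncomputable section

/-! ### Prefixes and balls -/

/-- The prefix of length `n` of `x`. -/
def pre {r : ℕ} (x : SymbolicSpace r) (n : ℕ) : List (Fin r) := List.ofFn fun i : Fin n => x i

section pre

variable {r : ℕ} {x y : SymbolicSpace r}

@[simp] theorem length_pre (x : SymbolicSpace r) (n : ℕ) : (pre x n).length = n := by simp [pre]

theorem pre_eq_pre_iff {n : ℕ} : pre x n = pre y n ↔ ∀ i < n, x i = y i := by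
  unfold pre
  rw [List.ofFn_inj, funext_iff]
  exact ⟨fun h i hi => h ⟨i, hi⟩, fun h i => h i i.2⟩

theorem pre_eq_of_le {m n : ℕ} (h : m ≤ n) (hn : pre x n = pre y n) : pre x m = pre y m := by
  rw [pre_eq_pre_iff] at *
  exact fun i hi => hn i (hi.trans_le h)

theorem exists_pre_append (x : SymbolicSpace r) {m n : ℕ} (h : m ≤ n) :
    ∃ t : List (Fin r), pre x n = pre x m ++ t ∧ t.length = n - m := by
  obtain ⟨k, rfl⟩ := Nat.exists_eq_add_of_le h
  refine ⟨List.ofFn fun i : Fin k => x (m + i), ?_, by simp⟩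
  simp only [pre]
  rw [List.ofFn_add]
  rfl

/-- The radius is not assumed to be a power of r⁻¹: on the first coordinate it is a power of r₂⁻¹,
and the threshold L is then a rounded logarithm. -/
theorem dist_le_iff_of_forall {ρ : ℝ} (hρ : 0 ≤ ρ) {L : ℕ}
    (hL : ∀ k : ℕ, ((r : ℝ)⁻¹) ^ k ≤ ρ ↔ L ≤ k) : dist x y ≤ ρ ↔ pre x L = pre y L := by
  by_cases hxy : x = y
  · subst hxy; simpa using hρ
  have h1 : dist x y = ((r : ℝ)⁻¹) ^ PiNat.firstDiff (E := fun _ => Fin r) x y := if_neg hxy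
  rw [h1, hL, pre_eq_pre_iff]
  constructor
  · intro h i hi
    exact PiNat.apply_eq_of_lt_firstDiff (E := fun _ => Fin r) (hi.trans_le h)
  · intro h
    by_contra! hlt
    exact PiNat.apply_firstDiff_ne (E := fun _ => Fin r) hxy (h _ hlt)

theorem dist_le_pow_iff (hr : 2 ≤ r) (L : ℕ) :
    dist x y ≤ ((r : ℝ)⁻¹) ^ L ↔ pre x L = pre y L := by
  refine dist_le_iff_of_forall (by positivity) fun k => ?_
  refine pow_le_pow_iff_right_of_lt_one₀ ?_ ?_
  · have : 0 < r := by omega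
    positivity
  · exact inv_lt_one_of_one_lt₀ (by exact_mod_cast (by omega : 1 < r))

/-- The identity from the space of sequences with the product topology to the symbolic space. -/
def toSymbolic (x : ℕ → Fin r) : SymbolicSpace r := x

/-- Serves to transport compactness from the product topology, hence second countability. The latter
makes the product σ-algebra on the carpet the Borel one. -/
theorem continuous_toSymbolic (hr : 2 ≤ r) : Continuous (toSymbolic (r := r)) := by
  rw [continuous_iff_continuousAt]
  intro x
  refine Metric.tendsto_nhds.2 fun ε hε => ?_
  obtain ⟨n, hn⟩ := exists_pow_lt_of_lt_one hε
    (inv_lt_one_of_one_lt₀ (by exact_mod_cast (by omega : 1 < r) : (1 : ℝ) < r))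
  have hopen : IsOpen {y : ℕ → Fin r | ∀ i < n, y i = x i} := by
    have : {y : ℕ → Fin r | ∀ i < n, y i = x i} =
        ⋂ i ∈ Finset.range n, (fun y : ℕ → Fin r => y i) ⁻¹' {x i} := by
      ext y; simp
    rw [this]
    exact isOpen_biInter_finset fun i _ => (isOpen_discrete _).preimage (continuous_apply i)
  filter_upwards [hopen.mem_nhds (fun i _ => rfl)] with y hy
  exact ((dist_le_pow_iff hr n).2 (pre_eq_pre_iff.2 hy)).trans_lt hn

theorem compactSpace_symbolicSpace (hr : 2 ≤ r) : CompactSpace (SymbolicSpace r) where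
  isCompact_univ := by
    have := isCompact_univ.image (continuous_toSymbolic hr)
    have hsurj : Function.Surjective (toSymbolic (r := r)) := fun x => ⟨x, rfl⟩
    rwa [Set.image_univ, hsurj.range_eq] at this

theorem secondCountable_symbolicSpace (hr : 2 ≤ r) :
    SecondCountableTopology (SymbolicSpace r) := by
  have := compactSpace_symbolicSpace hr
  infer_instance

theorem continuous_coord (hr : 2 ≤ r) (i : ℕ) : Continuous fun x : SymbolicSpace r => x i := by
  rw [continuous_discrete_rng]
  intro a
  rw [Metric.isOpen_iff]
  intro x hx
  refine ⟨((r : ℝ)⁻¹) ^ (i + 1), by have : 0 < r := by omega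
                                    positivity, fun y hy => ?_⟩
  have h := (dist_le_pow_iff hr (i + 1)).1 (Metric.mem_ball.1 hy).le
  have := pre_eq_pre_iff.1 h i (by omega)
  simp only [Set.mem_preimage, Set.mem_singleton_iff] at *
  rw [this, hx]

theorem measurable_coord (hr : 2 ≤ r) (i : ℕ) : Measurable fun x : SymbolicSpace r => x i :=
  measurable_to_countable' fun a =>
    ((isOpen_discrete {a}).preimage (continuous_coord hr i)).measurableSet

theorem measurableSet_pre_eq (hr : 2 ≤ r) (n : ℕ) (u : List (Fin r)) :
    MeasurableSet {x : SymbolicSpace r | pre x n = u} := by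
  by_cases h : ∃ y : SymbolicSpace r, pre y n = u
  · obtain ⟨y, rfl⟩ := h
    have : {x : SymbolicSpace r | pre x n = pre y n} =
        ⋂ i ∈ Finset.range n, (fun x : SymbolicSpace r => x i) ⁻¹' {y i} := by
      ext x; simp [pre_eq_pre_iff]
    rw [this]
    exact Finset.measurableSet_biInter _ fun i _ =>
      measurable_coord hr i (MeasurableSet.singleton _)
  · convert MeasurableSet.empty
    ext x
    simp only [Set.mem_ofPred_eq, Set.mem_empty_iff_false, iff_false]
    exact fun hx => h ⟨x, hx⟩

end pre

variable {r₁ r₂ : ℕ}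

theorem prefixWord_eq_zip (z : Carpet r₁ r₂) (n : ℕ) :
    prefixWord z n = (pre z.1 n).zip (pre z.2 n) := by
  rw [pre, pre, zip_ofFn]; rfl

@[simp] theorem length_prefixWord (z : Carpet r₁ r₂) (n : ℕ) : (prefixWord z n).length = n := by
  simp [prefixWord]

theorem map_fst_prefixWord (z : Carpet r₁ r₂) (n : ℕ) :
    (prefixWord z n).map Prod.fst = pre z.1 n := by
  rw [prefixWord_eq_zip, map_fst_zip (by simp)]

theorem map_snd_prefixWord (z : Carpet r₁ r₂) (n : ℕ) :
    (prefixWord z n).map Prod.snd = pre z.2 n := by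
  rw [prefixWord_eq_zip, List.map_snd_zip]; simp

theorem mem_cylinder_zip_iff {z : Carpet r₁ r₂} {u : List (Fin r₁)} {v : List (Fin r₂)}
    (h : v.length = u.length) :
    z ∈ cylinder (u.zip v) ↔ pre z.1 u.length = u ∧ pre z.2 u.length = v := by
  have hl : (u.zip v).length = u.length := by simp [h]
  simp only [cylinder, Set.mem_ofPred_eq, hl]
  constructor
  · intro he
    constructor
    · rw [← map_fst_prefixWord, he, map_fst_zip h]
    · rw [← map_snd_prefixWord, he, List.map_snd_zip h.le]
  · rintro ⟨h1, h2⟩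
    rw [prefixWord_eq_zip, h1, h2]

theorem exists_eq_zip {A B : Type*} (w : List (A × B)) :
    ∃ (u : List A) (v : List B), u.length = w.length ∧ v.length = w.length ∧ w = u.zip v :=
  ⟨w.map Prod.fst, w.map Prod.snd, by simp, by simp, by
    rw [List.zip_map', List.map_id'' (fun _ => rfl)]⟩

theorem measurableSet_cylinder (hr₁ : 2 ≤ r₁) (hr₂ : 2 ≤ r₂) (w : List (Fin r₁ × Fin r₂)) :
    MeasurableSet (cylinder w) := by
  obtain ⟨u, v, hu, hv, rfl⟩ := exists_eq_zip w
  rw [← hu] at hv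
  have : cylinder (u.zip v) = {x : SymbolicSpace r₁ | pre x u.length = u} ×ˢ
      {y : SymbolicSpace r₂ | pre y u.length = v} := by
    ext z; rw [mem_cylinder_zip_iff hv]; rfl
  rw [this]
  exact (measurableSet_pre_eq hr₁ _ _).prod (measurableSet_pre_eq hr₂ _ _)

/-- The length of the common prefixes on the first coordinate of the points of a ball of radius
`r₂ ^ (-n)`. -/
def baseLen (r₁ r₂ n : ℕ) : ℕ := Nat.clog r₁ (r₂ ^ n)

section baseLen

variable (h₁ : 2 ≤ r₁) (h₂ : r₁ ≤ r₂)
include h₁ h₂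

theorem le_baseLen (n : ℕ) : n ≤ baseLen r₁ r₂ n := by
  have h := Nat.le_pow_clog (b := r₁) (by omega) (r₂ ^ n)
  have h3 : r₁ ^ n ≤ r₁ ^ baseLen r₁ r₂ n := (Nat.pow_le_pow_left h₂ n).trans h
  exact (Nat.pow_le_pow_iff_right (by omega)).1 h3

theorem le_sExp_mul_baseLen (n : ℕ) : (n : ℝ) ≤ sExp r₁ r₂ * baseLen r₁ r₂ n := by
  have h := Nat.le_pow_clog (b := r₁) (by omega) (r₂ ^ n)
  have h3 : ((r₂ : ℝ)) ^ n ≤ (r₁ : ℝ) ^ baseLen r₁ r₂ n := by exact_mod_cast h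
  have hr2 : (0 : ℝ) < r₂ := by exact_mod_cast (by omega : 0 < r₂)
  have h4 := Real.log_le_log (by positivity) h3
  rw [Real.log_pow, Real.log_pow] at h4
  have hl : 0 < Real.log r₂ := Real.log_pos (by exact_mod_cast (by omega : 1 < r₂))
  rw [sExp, div_mul_eq_mul_div, le_div_iff₀ hl]
  linarith

/-- Rounding up adds less than one letter, which contributes at most s ≤ 1. -/
theorem sExp_mul_baseLen_le (n : ℕ) : sExp r₁ r₂ * baseLen r₁ r₂ n ≤ n + 1 := by
  have hl : 0 < Real.log r₂ := Real.log_pos (by exact_mod_cast (by omega : 1 < r₂))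
  have hs := sExp_le_one h₁ h₂
  have hs0 := sExp_pos h₁ h₂
  rcases Nat.eq_zero_or_pos (baseLen r₁ r₂ n) with h0 | h0
  · rw [h0]; simp; positivity
  have h3 : r₁ ^ (baseLen r₁ r₂ n - 1) < r₂ ^ n :=
    Nat.pow_lt_of_lt_clog (Nat.sub_lt h0 one_pos)
  have h4 : (r₁ : ℝ) ^ (baseLen r₁ r₂ n - 1) ≤ (r₂ : ℝ) ^ n := by exact_mod_cast h3.le
  have hr1 : (0 : ℝ) < r₁ := by exact_mod_cast (by omega : 0 < r₁)
  have h5 := Real.log_le_log (by positivity) h4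
  rw [Real.log_pow, Real.log_pow, Nat.cast_sub h0, Nat.cast_one] at h5
  have h6 : sExp r₁ r₂ * ((baseLen r₁ r₂ n : ℝ) - 1) ≤ n := by
    rw [sExp, div_mul_eq_mul_div, div_le_iff₀ hl]
    linarith
  linarith

theorem tendsto_baseLen_div : Tendsto (fun n : ℕ => (baseLen r₁ r₂ n : ℝ) / n) atTop
    (𝓝 (sExp r₁ r₂)⁻¹) := by
  have hs0 := sExp_pos h₁ h₂
  have h1 : Tendsto (fun n : ℕ => (sExp r₁ r₂)⁻¹ + (sExp r₁ r₂)⁻¹ / (n : ℝ)) atTop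
      (𝓝 ((sExp r₁ r₂)⁻¹ + 0)) := (tendsto_const_div_atTop_nhds_zero_nat _).const_add _
  rw [add_zero] at h1
  refine tendsto_of_tendsto_of_tendsto_of_le_of_le' tendsto_const_nhds h1 ?_ ?_
  · filter_upwards [eventually_gt_atTop 0] with n hn
    have hn' : (0 : ℝ) < n := by exact_mod_cast hn
    rw [le_div_iff₀ hn', inv_mul_le_iff₀ hs0]
    exact le_sExp_mul_baseLen h₁ h₂ n
  · filter_upwards [eventually_gt_atTop 0] with n hn
    have hn' : (0 : ℝ) < n := by exact_mod_cast hn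
    rw [div_le_iff₀ hn', add_mul, div_mul_cancel₀ _ hn'.ne', ← mul_add_one,
      le_inv_mul_iff₀ hs0]
    exact sExp_mul_baseLen_le h₁ h₂ n

theorem mem_closedBall_iff {z z' : Carpet r₁ r₂} {n : ℕ} :
    z' ∈ Metric.closedBall z (((r₂ : ℝ)⁻¹) ^ n) ↔
      pre z'.1 (baseLen r₁ r₂ n) = pre z.1 (baseLen r₁ r₂ n) ∧ pre z'.2 n = pre z.2 n := by
  rw [Metric.mem_closedBall, Prod.dist_eq, max_le_iff, dist_le_pow_iff (by omega)]
  refine and_congr_left fun _ => dist_le_iff_of_forall (by positivity) fun k => ?_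
  have hr1 : (0 : ℝ) < r₁ := by exact_mod_cast (by omega : 0 < r₁)
  have hr2 : (0 : ℝ) < r₂ := by exact_mod_cast (by omega : 0 < r₂)
  rw [inv_pow, inv_pow, inv_le_inv₀ (by positivity) (by positivity), baseLen,
    Nat.clog_le_iff_le_pow (by omega)]
  exact_mod_cast Iff.rfl

/-- A ball of radius `r₂ ^ (-n)` is a union of cylinders of length `baseLen r₁ r₂ n`. -/
theorem measureReal_closedBall (m : Measure (Carpet r₁ r₂)) [IsFiniteMeasure m]
    (z : Carpet r₁ r₂) (n : ℕ) :
    m.real (Metric.closedBall z (((r₂ : ℝ)⁻¹) ^ n)) =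
      wsum (baseLen r₁ r₂ n - n) fun v =>
        m.real (cylinder ((pre z.1 (baseLen r₁ r₂ n)).zip (pre z.2 n ++ v))) := by
  set L := baseLen r₁ r₂ n with hL
  have hnL : n ≤ L := le_baseLen h₁ h₂ n
  have hlen : ∀ v : Fin (L - n) → Fin r₂,
      (pre z.2 n ++ List.ofFn v).length = (pre z.1 L).length := by
    intro v; simp; omega
  have hset : Metric.closedBall z (((r₂ : ℝ)⁻¹) ^ n) =
      ⋃ v ∈ (Finset.univ : Finset (Fin (L - n) → Fin r₂)),
        cylinder ((pre z.1 L).zip (pre z.2 n ++ List.ofFn v)) := by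
    ext z'
    rw [mem_closedBall_iff h₁ h₂]
    simp only [Finset.mem_univ, Set.iUnion_true, Set.mem_iUnion]
    constructor
    · rintro ⟨h3, h4⟩
      obtain ⟨t, ht, htl⟩ := exists_pre_append z'.2 hnL
      refine ⟨fun i => t.get (i.cast htl.symm), ?_⟩
      have h5 : List.ofFn (fun i : Fin (L - n) => t.get (i.cast htl.symm)) = t := by
        apply List.ext_get
        · simp [htl]
        · intro i hi1 hi2
          simp
      rw [mem_cylinder_zip_iff (hlen _), length_pre, h5]
      exact ⟨h3, by rw [ht, h4]⟩
    · rintro ⟨v, hv⟩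
      rw [mem_cylinder_zip_iff (hlen _), length_pre] at hv
      refine ⟨hv.1, ?_⟩
      obtain ⟨t, ht, htl⟩ := exists_pre_append z'.2 hnL
      rw [ht] at hv
      exact (List.append_inj hv.2 (by simp)).1
  rw [hset, measureReal_biUnion_finset]
  · rfl
  · intro v _ v' _ hvv
    rw [Function.onFun, Set.disjoint_left]
    intro z' hz hz'
    rw [mem_cylinder_zip_iff (hlen _), length_pre] at hz hz'
    apply hvv
    have := hz.2.symm.trans hz'.2
    rw [List.append_cancel_left_eq, List.ofFn_inj] at this
    exact this
  · exact fun v _ => measurableSet_cylinder h₁ (by omega) _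

theorem measurableSet_closedBall_pow (z : Carpet r₁ r₂) (n : ℕ) :
    MeasurableSet (Metric.closedBall z (((r₂ : ℝ)⁻¹) ^ n)) := by
  have : Metric.closedBall z (((r₂ : ℝ)⁻¹) ^ n) =
      {x : SymbolicSpace r₁ | pre x (baseLen r₁ r₂ n) = pre z.1 (baseLen r₁ r₂ n)} ×ˢ
        {y : SymbolicSpace r₂ | pre y n = pre z.2 n} := by
    ext z'; rw [mem_closedBall_iff h₁ h₂]; rfl
  rw [this]
  exact (measurableSet_pre_eq h₁ _ _).prod (measurableSet_pre_eq (by omega) _ _)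

end baseLen

/-! ### Masses of balls -/

section mass

variable {C K : ℝ} {Φ : List (Fin r₁ × Fin r₂) → ℝ} {m : Measure (Carpet r₁ r₂)}

/-- Let t be the letters of the first coordinate between n and L, and T the fibre sum over t. The
sum over the ball is comparable to Φ (z|n) * T, and the fibre sum at L to the one at n times T;
eliminating T costs C ^ 2. The products avoid dividing by a fibre sum that may vanish. -/
theorem QuasiMul.wsum_cylinder_words (hΦ : QuasiMul C Φ) (z : Carpet r₁ r₂) {n L : ℕ}
    (h : n ≤ L) :
    (wsum (L - n) fun v => Φ ((pre z.1 L).zip (pre z.2 n ++ v))) *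
        (wsum n fun v => Φ ((pre z.1 n).zip v)) ≤
      C ^ 2 * (Φ (prefixWord z n) * wsum L fun v => Φ ((pre z.1 L).zip v)) ∧
    Φ (prefixWord z n) * (wsum L fun v => Φ ((pre z.1 L).zip v)) ≤
      C ^ 2 * ((wsum (L - n) fun v => Φ ((pre z.1 L).zip (pre z.2 n ++ v))) *
        wsum n fun v => Φ ((pre z.1 n).zip v)) := by
  have hC := hΦ.pos
  obtain ⟨t, ht, htl⟩ := exists_pre_append z.1 h
  have hF := hΦ.fiber
  have h1 : ∀ v : List (Fin r₂), (pre z.1 L).zip (pre z.2 n ++ v) = prefixWord z n ++ t.zip v := by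
    intro v
    rw [ht, List.zip_append (by simp), prefixWord_eq_zip]
  set S := wsum (L - n) fun v => Φ ((pre z.1 L).zip (pre z.2 n ++ v)) with hS
  set T := wsum (L - n) fun v => Φ (t.zip v) with hT
  have hS0 : 0 ≤ S := wsum_nonneg fun v _ => hΦ.nonneg _
  have hT0 : 0 ≤ T := wsum_nonneg fun v _ => hΦ.nonneg _
  set Fn := wsum n fun v => Φ ((pre z.1 n).zip v) with hFn
  set FL := wsum L fun v => Φ ((pre z.1 L).zip v) with hFL
  have hFn0 : 0 ≤ Fn := wsum_nonneg fun v _ => hΦ.nonneg _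
  have hFL0 : 0 ≤ FL := wsum_nonneg fun v _ => hΦ.nonneg _
  have hz0 := hΦ.nonneg (prefixWord z n)
  have hST : S ≤ C * (Φ (prefixWord z n) * T) := by
    rw [hS, hT, ← wsum_mul_left, ← wsum_mul_left]
    refine wsum_mono fun v _ => ?_
    rw [h1]; exact hΦ.upper _ _
  have hTS : Φ (prefixWord z n) * T ≤ C * S := by
    rw [hS, hT, ← wsum_mul_left, ← wsum_mul_left]
    refine wsum_mono fun v _ => ?_
    rw [h1]; exact hΦ.lower _ _
  have hF1 : Fn * T ≤ C * FL := by
    have := hF.lower (pre z.1 n) t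
    rw [← ht, length_pre, length_pre, htl] at this
    exact this
  have hF2 : FL ≤ C * (Fn * T) := by
    have := hF.upper (pre z.1 n) t
    rw [← ht, length_pre, length_pre, htl] at this
    exact this
  constructor
  · calc S * Fn ≤ C * (Φ (prefixWord z n) * T) * Fn := by gcongr
      _ = C * Φ (prefixWord z n) * (Fn * T) := by ring
      _ ≤ C * Φ (prefixWord z n) * (C * FL) := by gcongr
      _ = _ := by ring
  · calc Φ (prefixWord z n) * FL ≤ Φ (prefixWord z n) * (C * (Fn * T)) := by gcongr
      _ = C * Fn * (Φ (prefixWord z n) * T) := by ring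
      _ ≤ C * Fn * (C * S) := by gcongr
      _ = _ := by ring

theorem QuasiMul.measureReal_closedBall_le (hΦ : QuasiMul C Φ) (h₁ : 2 ≤ r₁) (h₂ : r₁ ≤ r₂)
    [IsFiniteMeasure m] (n : ℕ)
    (hm : ∀ w, w.length = baseLen r₁ r₂ n → m.real (cylinder w) ≤ K * Φ w) (hK : 0 ≤ K)
    (z : Carpet r₁ r₂) :
    m.real (Metric.closedBall z (((r₂ : ℝ)⁻¹) ^ n)) * (wsum n fun v => Φ ((pre z.1 n).zip v)) ≤
      K * C ^ 2 * (Φ (prefixWord z n) *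
        wsum (baseLen r₁ r₂ n) fun v => Φ ((pre z.1 (baseLen r₁ r₂ n)).zip v)) := by
  have hnL := le_baseLen h₁ h₂ n
  have h3 := (hΦ.wsum_cylinder_words z hnL).1
  rw [measureReal_closedBall h₁ h₂]
  have h4 : (wsum (baseLen r₁ r₂ n - n) fun v =>
      m.real (cylinder ((pre z.1 (baseLen r₁ r₂ n)).zip (pre z.2 n ++ v)))) ≤
      K * wsum (baseLen r₁ r₂ n - n) fun v =>
        Φ ((pre z.1 (baseLen r₁ r₂ n)).zip (pre z.2 n ++ v)) := by
    rw [← wsum_mul_left]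
    refine wsum_mono fun v hv => hm _ ?_
    simp [hv]; omega
  have h5 : 0 ≤ wsum n fun v => Φ ((pre z.1 n).zip v) := wsum_nonneg fun v _ => hΦ.nonneg _
  have h6 := mul_le_mul_of_nonneg_right h4 h5
  have h7 := mul_le_mul_of_nonneg_left h3 hK
  linarith

/-- Only cylinders of the single length `baseLen r₁ r₂ n` are compared, so the bound applies to
measures that resemble Φ up to a finite level. -/
theorem QuasiMul.le_measureReal_closedBall (hΦ : QuasiMul C Φ) (h₁ : 2 ≤ r₁) (h₂ : r₁ ≤ r₂)
    [IsFiniteMeasure m] (n : ℕ)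
    (hm : ∀ w, w.length = baseLen r₁ r₂ n → Φ w ≤ K * m.real (cylinder w))
    (z : Carpet r₁ r₂) :
    Φ (prefixWord z n) *
        (wsum (baseLen r₁ r₂ n) fun v => Φ ((pre z.1 (baseLen r₁ r₂ n)).zip v)) ≤
      K * C ^ 2 * (m.real (Metric.closedBall z (((r₂ : ℝ)⁻¹) ^ n)) *
        wsum n fun v => Φ ((pre z.1 n).zip v)) := by
  have hnL := le_baseLen h₁ h₂ n
  have h3 := (hΦ.wsum_cylinder_words z hnL).2
  rw [measureReal_closedBall h₁ h₂]
  have h4 : (wsum (baseLen r₁ r₂ n - n) fun v =>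
        Φ ((pre z.1 (baseLen r₁ r₂ n)).zip (pre z.2 n ++ v))) ≤
      K * wsum (baseLen r₁ r₂ n - n) fun v =>
      m.real (cylinder ((pre z.1 (baseLen r₁ r₂ n)).zip (pre z.2 n ++ v))) := by
    rw [← wsum_mul_left]
    refine wsum_mono fun v hv => hm _ ?_
    simp [hv]; omega
  have h5 : 0 ≤ wsum n fun v => Φ ((pre z.1 n).zip v) := wsum_nonneg fun v _ => hΦ.nonneg _
  have h6 := mul_le_mul_of_nonneg_left (mul_le_mul_of_nonneg_right h4 h5) (sq_nonneg C)
  linarith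

end mass

end

noncomputable section

variable {r₁ r₂ : ℕ}

/-! ### Discrete approximations -/

/-- The point of the carpet obtained by continuing a word with the letter `a`. -/
def extend (a : Fin r₁ × Fin r₂) (w : List (Fin r₁ × Fin r₂)) : Carpet r₁ r₂ :=
  (fun i => (w.getD i a).1, fun i => (w.getD i a).2)

theorem prefixWord_extend (a : Fin r₁ × Fin r₂) {u v : List (Fin r₁ × Fin r₂)} :
    prefixWord (extend a (u ++ v)) u.length = u := by
  apply List.ext_get
  · simp
  · intro i h1 h2
    simp [prefixWord, extend, List.getElem?_append_left h2, h2]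

/-- Point masses Φ w at one extension of each word of length M. No consistency of Φ is needed, and
finitely many balls see only finitely many levels. -/
theorem exists_discrete_measure (h₁ : 2 ≤ r₁) (h₂ : r₁ ≤ r₂) (a : Fin r₁ × Fin r₂)
    {Φ : List (Fin r₁ × Fin r₂) → ℝ} (hΦ : ∀ w, 0 ≤ Φ w) (M : ℕ) :
    ∃ m : Measure (Carpet r₁ r₂), IsFiniteMeasure m ∧ m.real Set.univ = wsum M Φ ∧
      ∀ w, w.length ≤ M → (wsum (M - w.length) fun v => Φ (w ++ v)) ≤ m.real (cylinder w) := by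
  classical
  set m : Measure (Carpet r₁ r₂) := ∑ w : Fin M → Fin r₁ × Fin r₂,
    ENNReal.ofReal (Φ (List.ofFn w)) • Measure.dirac (extend a (List.ofFn w)) with hm
  have happ : ∀ S, MeasurableSet S → m S = ENNReal.ofReal (wsum M fun w =>
      Φ w * if extend a w ∈ S then 1 else 0) := by
    intro S hS
    rw [hm, Measure.finsetSum_apply, wsum, ENNReal.ofReal_sum_of_nonneg]
    · refine Finset.sum_congr rfl fun w _ => ?_
      rw [Measure.smul_apply, Measure.dirac_apply' _ hS, smul_eq_mul]
      by_cases h : extend a (List.ofFn w) ∈ S <;> simp [h]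
    · intro w _
      have := hΦ (List.ofFn w)
      split_ifs <;> simp [this]
  have hreal : ∀ S, MeasurableSet S → m.real S = wsum M fun w =>
      Φ w * if extend a w ∈ S then 1 else 0 := by
    intro S hS
    rw [Measure.real, happ S hS, ENNReal.toReal_ofReal]
    refine wsum_nonneg fun w _ => ?_
    have := hΦ w
    split_ifs <;> simp [this]
  refine ⟨m, ⟨?_⟩, ?_, fun w hw => ?_⟩
  · rw [happ _ MeasurableSet.univ]; exact ENNReal.ofReal_lt_top
  · rw [hreal _ MeasurableSet.univ]; simp
  · rw [hreal _ (measurableSet_cylinder h₁ (by omega) w)]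
    obtain ⟨k, rfl⟩ := Nat.exists_eq_add_of_le hw
    rw [wsum_append, Nat.add_sub_cancel_left]
    have h3 := le_wsum (f := fun u => wsum k fun v => Φ (u ++ v) *
      if extend a (u ++ v) ∈ cylinder w then 1 else 0) (fun u => wsum_nonneg fun v _ => by
        have := hΦ (u ++ v)
        split_ifs <;> simp [this]) w
    refine le_trans (le_of_eq ?_) h3
    refine wsum_congr fun v _ => ?_
    have : extend a (w ++ v) ∈ cylinder w := prefixWord_extend a
    simp [this]

/-! ### A packing inequality -/

/-- A proxy for the mass of the ball of centre `z` and radius `r₂ ^ (-n)` for a measure whose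
cylinder masses are comparable to `Φ`. -/
def ballWeight (Φ : List (Fin r₁ × Fin r₂) → ℝ) (z : Carpet r₁ r₂) (n : ℕ) : ℝ :=
  Φ (prefixWord z n) *
    (wsum (baseLen r₁ r₂ n) fun v => Φ ((pre z.1 (baseLen r₁ r₂ n)).zip v)) /
    wsum n fun v => Φ ((pre z.1 n).zip v)

theorem ballWeight_congr (h₁ : 2 ≤ r₁) (h₂ : r₁ ≤ r₂) {Φ : List (Fin r₁ × Fin r₂) → ℝ}
    {z z' : Carpet r₁ r₂} {n : ℕ} (h : pre z.1 (baseLen r₁ r₂ n) = pre z'.1 (baseLen r₁ r₂ n))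
    (h' : pre z.2 n = pre z'.2 n) : ballWeight Φ z n = ballWeight Φ z' n := by
  have h3 := pre_eq_of_le (le_baseLen h₁ h₂ n) h
  simp only [ballWeight, prefixWord_eq_zip, h, h', h3]

theorem baseLen_mono {m n : ℕ} (h : m ≤ n) (h₂ : 1 ≤ r₂) : baseLen r₁ r₂ m ≤ baseLen r₁ r₂ n :=
  Nat.clog_mono_right _ (Nat.pow_le_pow_right h₂ h)

/-- Take M beyond every base length that occurs. The discrete measure at level M gives each of these
cylinders mass at least Φ / (Z * C), hence dominates each ball weight up to a constant; disjointness
and total mass at most Z conclude. -/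
theorem QuasiMul.sum_ballWeight_le {C Z : ℝ} {Φ : List (Fin r₁ × Fin r₂) → ℝ}
    (hΦ : QuasiMul C Φ) (h₁ : 2 ≤ r₁) (h₂ : r₁ ≤ r₂) (a : Fin r₁ × Fin r₂) (hZ : 0 ≤ Z)
    (hZ1 : ∀ n, wsum n Φ ≤ Z) (hZ2 : ∀ n, 1 ≤ Z * wsum n Φ)
    {ι : Type*} (F : Finset ι) (z : ι → Carpet r₁ r₂) (n : ι → ℕ)
    (hd : (F : Set ι).PairwiseDisjoint
      fun i => Metric.closedBall (z i) (((r₂ : ℝ)⁻¹) ^ n i)) :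
    ∑ i ∈ F, ballWeight Φ (z i) (n i) ≤ Z * C * C ^ 2 * Z := by
  have hC := hΦ.pos
  set M := F.sup fun i => baseLen r₁ r₂ (n i) with hM
  obtain ⟨m, hm, hmu, hmc⟩ := exists_discrete_measure h₁ h₂ a hΦ.nonneg M
  have hlow : ∀ w, w.length ≤ M → Φ w ≤ Z * C * m.real (cylinder w) := by
    intro w hw
    calc Φ w ≤ Φ w * (Z * wsum (M - w.length) Φ) :=
          le_mul_of_one_le_right (hΦ.nonneg w) (hZ2 _)
      _ = Z * wsum (M - w.length) fun v => Φ w * Φ v := by rw [wsum_mul_left]; ring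
      _ ≤ Z * wsum (M - w.length) fun v => C * Φ (w ++ v) := by
          gcongr
          exact wsum_mono fun v _ => hΦ.lower w v
      _ = Z * C * wsum (M - w.length) fun v => Φ (w ++ v) := by rw [wsum_mul_left]; ring
      _ ≤ Z * C * m.real (cylinder w) := by gcongr; exact hmc w hw
  have hball : ∀ i ∈ F, ballWeight Φ (z i) (n i) ≤
      Z * C * C ^ 2 * m.real (Metric.closedBall (z i) (((r₂ : ℝ)⁻¹) ^ n i)) := by
    intro i hi
    have h3 := hΦ.le_measureReal_closedBall h₁ h₂ (m := m) (K := Z * C) (n i)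
      (fun w hw => hlow w (hw ▸ Finset.le_sup (f := fun i => baseLen r₁ r₂ (n i)) hi)) (z i)
    have h4 : 0 ≤ wsum (n i) fun v => Φ ((pre (z i).1 (n i)).zip v) :=
      wsum_nonneg fun v _ => hΦ.nonneg _
    rw [ballWeight]
    rcases h4.eq_or_lt with h0 | h0
    · rw [← h0, div_zero]
      have : 0 ≤ m.real (Metric.closedBall (z i) (((r₂ : ℝ)⁻¹) ^ n i)) := measureReal_nonneg
      positivity
    · rw [div_le_iff₀ h0]
      linarith
  calc ∑ i ∈ F, ballWeight Φ (z i) (n i)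
      ≤ ∑ i ∈ F, Z * C * C ^ 2 * m.real (Metric.closedBall (z i) (((r₂ : ℝ)⁻¹) ^ n i)) :=
        Finset.sum_le_sum hball
    _ = Z * C * C ^ 2 * m.real (⋃ i ∈ F, Metric.closedBall (z i) (((r₂ : ℝ)⁻¹) ^ n i)) := by
        rw [← Finset.mul_sum, measureReal_biUnion_finset hd
          fun i _ => measurableSet_closedBall_pow h₁ h₂ _ _]
    _ ≤ Z * C * C ^ 2 * m.real Set.univ := by
        exact mul_le_mul_of_nonneg_left (measureReal_mono (Set.subset_univ _)) (by positivity)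
    _ ≤ _ := by rw [hmu]; gcongr; exact hZ1 M

/-! ### Hausdorff measure of sets of points with heavy balls -/

/-- If every point of `E` has balls of arbitrarily small radius `r₂ ^ (-n)` with
`r₂ ^ (-n d) ≤ ballWeight Φ z n`, then the `d`-dimensional Hausdorff measure of `E` is finite. -/
theorem QuasiMul.hausdorffMeasure_lt_top {C Z : ℝ} {Φ : List (Fin r₁ × Fin r₂) → ℝ}
    (hΦ : QuasiMul C Φ) (h₁ : 2 ≤ r₁) (h₂ : r₁ ≤ r₂) (a : Fin r₁ × Fin r₂) (hZ : 0 ≤ Z)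
    (hZ1 : ∀ n, wsum n Φ ≤ Z) (hZ2 : ∀ n, 1 ≤ Z * wsum n Φ) [BorelSpace (Carpet r₁ r₂)]
    {d : ℝ} (hd : 0 ≤ d) {E : Set (Carpet r₁ r₂)}
    (hE : ∀ z ∈ E, ∃ᶠ n in atTop, (((r₂ : ℝ)⁻¹) ^ n) ^ d ≤ ballWeight Φ z n) :
    Measure.hausdorffMeasure d E < ∞ := by
  classical
  have hr2 : (0 : ℝ) < r₂ := by exact_mod_cast (by omega : 0 < r₂)
  have hex : ∀ (N : ℕ) (z : E), ∃ n, N ≤ n ∧ (((r₂ : ℝ)⁻¹) ^ n) ^ d ≤ ballWeight Φ z.1 n :=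
    fun N z => (frequently_atTop.1 (hE z z.2) N)
  set ν : ℕ → E → ℕ := fun N z => Nat.find (hex N z) with hν
  have hν1 : ∀ N z, N ≤ ν N z := fun N z => (Nat.find_spec (hex N z)).1
  have hν2 : ∀ N z, (((r₂ : ℝ)⁻¹) ^ ν N z) ^ d ≤ ballWeight Φ z.1 (ν N z) :=
    fun N z => (Nat.find_spec (hex N z)).2
  -- Heaviness depends only on the ball, not on its centre. So the first heavy index is at most n
  -- throughout a selected ball of index n, and two selected balls that meet must coincide.
  have hν3 : ∀ N (z z' : E) n, ν N z = n → pre z.1.1 (baseLen r₁ r₂ n) =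
      pre z'.1.1 (baseLen r₁ r₂ n) → pre z.1.2 n = pre z'.1.2 n → ν N z' ≤ n := by
    rintro N z z' n rfl h h'
    refine Nat.find_min' _ ⟨hν1 N z, ?_⟩
    rw [← ballWeight_congr h₁ h₂ h h']
    exact hν2 N z
  set code : ℕ → E → List (Fin r₁) × List (Fin r₂) := fun N z =>
    (pre z.1.1 (baseLen r₁ r₂ (ν N z)), pre z.1.2 (ν N z)) with hcode
  set c : ∀ N, Set.range (code N) → E := fun N i => i.2.choose with hc
  have hcc : ∀ N i, code N (c N i) = i.1 := fun N i => i.2.choose_spec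
  set t : ∀ N, Set.range (code N) → Set (Carpet r₁ r₂) := fun N i =>
    Metric.closedBall (c N i).1 (((r₂ : ℝ)⁻¹) ^ ν N (c N i)) with ht
  have hcover : ∀ N, E ⊆ ⋃ i, t N i := by
    intro N z hz
    refine Set.mem_iUnion.2 ⟨⟨code N ⟨z, hz⟩, ⟨z, hz⟩, rfl⟩, ?_⟩
    have h3 := hcc N ⟨code N ⟨z, hz⟩, ⟨z, hz⟩, rfl⟩
    set z' := c N ⟨code N ⟨z, hz⟩, ⟨z, hz⟩, rfl⟩
    simp only [hcode, Prod.mk.injEq] at h3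
    have h4 : ν N z' = ν N ⟨z, hz⟩ := by
      simpa using congrArg List.length h3.2
    simp only [ht]
    rw [mem_closedBall_iff h₁ h₂]
    change pre z.1 (baseLen r₁ r₂ (ν N z')) = pre z'.1.1 _ ∧ pre z.2 (ν N z') = pre z'.1.2 _
    rw [h3.1, h3.2, h4]
    exact ⟨rfl, rfl⟩
  have hdis : ∀ N, Pairwise (Function.onFun Disjoint (t N)) := by
    intro N i j hij
    rw [Function.onFun, Set.disjoint_left]
    intro x hx hx'
    apply hij
    simp only [ht] at hx hx'
    rw [mem_closedBall_iff h₁ h₂] at hx hx'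
    have hle : ∀ z z' : E, ν N z ≤ ν N z' →
        (pre x.1 (baseLen r₁ r₂ (ν N z)) = pre z.1.1 (baseLen r₁ r₂ (ν N z)) ∧
          pre x.2 (ν N z) = pre z.1.2 (ν N z)) →
        (pre x.1 (baseLen r₁ r₂ (ν N z')) = pre z'.1.1 (baseLen r₁ r₂ (ν N z')) ∧
          pre x.2 (ν N z') = pre z'.1.2 (ν N z')) → code N z = code N z' := by
      intro z z' hle hz hz'
      have e1 := pre_eq_of_le (baseLen_mono (r₁ := r₁) hle (by omega : 1 ≤ r₂)) hz'.1
      have e2 := pre_eq_of_le hle hz'.2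
      have e3 := hν3 N z z' _ rfl (hz.1.symm.trans e1) (hz.2.symm.trans e2)
      have e4 : ν N z = ν N z' := le_antisymm hle e3
      simp only [hcode, Prod.mk.injEq]
      rw [← e4] at hz' ⊢
      exact ⟨hz.1.symm.trans hz'.1, hz.2.symm.trans hz'.2⟩
    have key : code N (c N i) = code N (c N j) := by
      rcases le_total (ν N (c N i)) (ν N (c N j)) with hle' | hle'
      · exact hle _ _ hle' hx hx'
      · exact (hle _ _ hle' hx' hx).symm
    rw [hcc, hcc] at key
    exact Subtype.ext key
  -- In an ultrametric the diameter of a ball is at most its radius, without a factor 2.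
  have hdiam : ∀ N i, Metric.ediam (t N i) ≤ ENNReal.ofReal (((r₂ : ℝ)⁻¹) ^ ν N (c N i)) := by
    intro N i
    refine Metric.ediam_le fun x hx y hy => ?_
    rw [edist_dist]
    refine ENNReal.ofReal_le_ofReal ?_
    rw [← Metric.mem_closedBall, mem_closedBall_iff h₁ h₂]
    simp only [ht] at hx hy
    rw [mem_closedBall_iff h₁ h₂] at hx hy
    exact ⟨hx.1.trans hy.1.symm, hx.2.trans hy.2.symm⟩
  have hinv1 : (r₂ : ℝ)⁻¹ < 1 := inv_lt_one_of_one_lt₀ (by exact_mod_cast (by omega : 1 < r₂))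
  have hsum : ∀ N, ∑' i, Metric.ediam (t N i) ^ d ≤ ENNReal.ofReal (Z * C * C ^ 2 * Z) := by
    intro N
    rw [ENNReal.tsum_eq_iSup_sum]
    refine iSup_le fun F => ?_
    have h3 := hΦ.sum_ballWeight_le h₁ h₂ a hZ hZ1 hZ2 F (fun i => (c N i).1)
      (fun i => ν N (c N i)) fun i _ j _ hij => hdis N hij
    calc ∑ i ∈ F, Metric.ediam (t N i) ^ d
        ≤ ∑ i ∈ F, ENNReal.ofReal (ballWeight Φ (c N i).1 (ν N (c N i))) := by
          refine Finset.sum_le_sum fun i _ => ?_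
          refine (ENNReal.rpow_le_rpow (hdiam N i) hd).trans ?_
          rw [ENNReal.ofReal_rpow_of_nonneg (by positivity) hd]
          exact ENNReal.ofReal_le_ofReal (hν2 N _)
      _ = ENNReal.ofReal (∑ i ∈ F, ballWeight Φ (c N i).1 (ν N (c N i))) := by
          rw [ENNReal.ofReal_sum_of_nonneg]
          intro i _
          exact le_trans (by positivity) (hν2 N (c N i))
      _ ≤ _ := ENNReal.ofReal_le_ofReal h3
  have hH := Measure.hausdorffMeasure_le_liminf_tsum d E (l := atTop)
    (fun N : ℕ => ENNReal.ofReal (((r₂ : ℝ)⁻¹) ^ N)) (by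
      rw [← ENNReal.ofReal_zero]
      exact ENNReal.tendsto_ofReal
        (tendsto_pow_atTop_nhds_zero_of_lt_one (by positivity) hinv1)) t
    (Eventually.of_forall fun N i => (hdiam N i).trans (ENNReal.ofReal_le_ofReal
      (pow_le_pow_of_le_one (by positivity) hinv1.le (hν1 N _))))
    (Eventually.of_forall hcover)
  refine (hH.trans ?_).trans_lt (ENNReal.ofReal_lt_top (r := Z * C * C ^ 2 * Z))
  exact (liminf_le_liminf (Eventually.of_forall hsum)).trans_eq (by simp)

/-- Along a sequence growing geometrically, the average of a function of linear growth cannot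
decrease by a definite amount at every step. -/
theorem frequently_le_of_abs_le {G : ℕ → ℝ} {K s : ℝ} (hK : ∀ n : ℕ, |G n| ≤ K * (n + 1))
    {L : ℕ → ℕ} (hL : ∀ n, n ≤ L n) (hL1 : ∀ n : ℕ, (n : ℝ) ≤ s * L n)
    (hL2 : ∀ n : ℕ, s * L n ≤ n + 1) {η : ℝ} (hη : 0 < η) :
    ∃ᶠ n in atTop, -(η * n) ≤ s * G (L n) - G n := by
  have hK0 : 0 ≤ K := by
    have := (abs_nonneg _).trans (hK 0)
    simpa using this
  by_contra hcon
  rw [not_frequently, eventually_atTop] at hcon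
  obtain ⟨N, hN⟩ := hcon
  set H : ℕ → ℝ := fun n => G n / n with hH
  have hHb : ∀ n : ℕ, 1 ≤ n → |H n| ≤ 2 * K := by
    intro n hn
    have hn' : (1 : ℝ) ≤ n := by exact_mod_cast hn
    simp only [hH]
    rw [abs_div, Nat.abs_cast, div_le_iff₀ (by linarith)]
    refine (hK n).trans ?_
    nlinarith
  obtain ⟨N', hN'⟩ := exists_nat_ge (4 * K / η)
  set n₀ := max N (max N' 1) with hn₀
  -- Replacing s * L n by n costs at most |H (L n)| ≤ 2 * K, and n₀ makes this at most half of η *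
  -- n. Iterating L would then push H below its lower bound -2 * K.
  have hstep : ∀ n, n₀ ≤ n → H (L n) ≤ H n - η / 2 := by
    intro n hn
    have hnN : N ≤ n := (le_max_left _ _).trans hn
    have hnN' : N' ≤ n := (le_max_left _ _).trans ((le_max_right _ _).trans hn)
    have hn1 : 1 ≤ n := (le_max_right N' 1).trans ((le_max_right _ _).trans hn)
    have hn' : (0 : ℝ) < n := by exact_mod_cast hn1
    have hLn : (0 : ℝ) < L n := by exact_mod_cast hn1.trans (hL n)
    have h1 := hN n hnN
    push Not at h1
    have h2 := hHb (L n) (hn1.trans (hL n))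
    have h3 : G (L n) = L n * H (L n) := by simp only [hH]; field_simp
    have h4 : G n = n * H n := by simp only [hH]; field_simp
    rw [h3, h4] at h1
    have h5 : n * H (L n) ≤ s * (L n * H (L n)) + 2 * K := by
      have h6 : 0 ≤ s * L n - n := by linarith [hL1 n]
      have h7 : s * L n - n ≤ 1 := by linarith [hL2 n]
      have h8 := neg_le_of_abs_le h2
      nlinarith
    have h6 : 4 * K ≤ η * n := by
      have : (N' : ℝ) ≤ n := by exact_mod_cast hnN'
      have := hN'.trans this
      rw [div_le_iff₀ hη] at this
      linarith
    by_contra! h7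
    have := mul_lt_mul_of_pos_left h7 hn'
    nlinarith
  have hiter : ∀ k : ℕ, n₀ ≤ L^[k] n₀ ∧ H (L^[k] n₀) ≤ H n₀ - k * (η / 2) := by
    intro k
    induction k with
    | zero => simp
    | succ k ih =>
      rw [Function.iterate_succ_apply']
      refine ⟨ih.1.trans (hL _), (hstep _ ih.1).trans ?_⟩
      push_cast
      linarith [ih.2]
  obtain ⟨k, hk⟩ := exists_nat_gt (8 * K / η)
  have h1 := (hiter k).2
  have hn1 : 1 ≤ n₀ := (le_max_right N' 1).trans (le_max_right _ _)
  have h2 := neg_le_of_abs_le (hHb _ (hn1.trans (hiter k).1))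
  have h3 := le_of_abs_le (hHb n₀ hn1)
  rw [div_lt_iff₀ hη] at hk
  linarith

end

/-! ### Upper bound for the level sets -/

noncomputable section

variable {r₁ r₂ : ℕ} {ψ : List (Fin r₁ × Fin r₂) → ℝ} {C K : ℝ} {a : Fin r₁ × Fin r₂}
  {μ : Measure (Carpet r₁ r₂)}

theorem borelSpace_carpet (hr₁ : 2 ≤ r₁) (hr₂ : 2 ≤ r₂) : BorelSpace (Carpet r₁ r₂) := by
  have := secondCountable_symbolicSpace hr₁
  have := secondCountable_symbolicSpace hr₂
  infer_instance

theorem fiberSum_one_pre (z : Carpet r₁ r₂) (n : ℕ) :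
    (wsum n fun v => ψ ((pre z.1 n).zip v)) = fiberSum ψ 1 (pre z.1 n) := by
  rw [fiberSum_eq, length_pre]
  simp only [pow₀_one]

theorem log_eq_sExp_mul (h₁ : 2 ≤ r₁) (h₂ : r₁ ≤ r₂) :
    Real.log r₁ = sExp r₁ r₂ * Real.log r₂ := by
  have hl : 0 < Real.log r₂ := Real.log_pos (by exact_mod_cast (by omega : 1 < r₂))
  rw [sExp, div_mul_cancel₀ _ hl.ne']

namespace QuasiMul

theorem fiberSum_pre_pos (hψ : QuasiMul C ψ) {z : Carpet r₁ r₂} (hz : z ∈ supp ψ) (q : ℝ)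
    (n : ℕ) : 0 < fiberSum ψ q (pre z.1 n) := by
  rw [← map_fst_prefixWord]
  exact hψ.fiberSum_pos q (hz n)

/-- The mass of a ball, up to a constant, for a measure with cylinder masses comparable to `ψ`. -/
theorem abs_log_closedBall_sub_le (hψ : QuasiMul C ψ) (h₁ : 2 ≤ r₁) (h₂ : r₁ ≤ r₂)
    [IsFiniteMeasure μ] (hK : 1 ≤ K) (hμ1 : ∀ w, μ.real (cylinder w) ≤ K * ψ w)
    (hμ2 : ∀ w, ψ w ≤ K * μ.real (cylinder w)) {z : Carpet r₁ r₂} (hz : z ∈ supp ψ) (n : ℕ) :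
    |Real.log (μ.real (Metric.closedBall z (((r₂ : ℝ)⁻¹) ^ n))) -
      (Real.log (ψ (prefixWord z n)) + Real.log (fiberSum ψ 1 (pre z.1 (baseLen r₁ r₂ n))) -
        Real.log (fiberSum ψ 1 (pre z.1 n)))| ≤ Real.log (K * C ^ 2) := by
  have hC := hψ.pos
  have hK0 : 0 < K := by linarith
  have hle := hψ.measureReal_closedBall_le h₁ h₂ n (fun w _ => hμ1 w) hK0.le z
  have hge := hψ.le_measureReal_closedBall h₁ h₂ n (fun w _ => hμ2 w) z
  rw [fiberSum_one_pre, fiberSum_one_pre] at hle hge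
  have hn := hψ.fiberSum_pre_pos hz 1 n
  have hL := hψ.fiberSum_pre_pos hz 1 (baseLen r₁ r₂ n)
  have hz' := hz n
  have hB : 0 < μ.real (Metric.closedBall z (((r₂ : ℝ)⁻¹) ^ n)) := by
    have h3 := (mul_pos hz' hL).trans_le hge
    have h4 : 0 < K * C ^ 2 := by positivity
    exact (mul_pos_iff_of_pos_right hn).1 ((mul_pos_iff_of_pos_left h4).1 h3)
  have hle' := Real.log_le_log (mul_pos hB hn) hle
  have hge' := Real.log_le_log (mul_pos hz' hL) hge
  rw [Real.log_mul hB.ne' hn.ne', Real.log_mul (by positivity) (by positivity),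
    Real.log_mul hz'.ne' hL.ne'] at hle'
  rw [Real.log_mul hz'.ne' hL.ne', Real.log_mul (by positivity) (by positivity),
    Real.log_mul hB.ne' hn.ne'] at hge'
  rw [abs_le]
  constructor <;> linarith

theorem wsum_normalizedLift_pre (hψ : QuasiMul C ψ) (q : ℝ) (z : Carpet r₁ r₂) (n : ℕ) :
    (wsum n fun v => normalizedLift ψ q ((pre z.1 n).zip v)) =
      Real.exp (-pressure (weight ψ q) * n) * weight ψ q (pre z.1 n) := by
  have h := hψ.wsum_lift_zip_one q (pre z.1 n)
  rw [length_pre] at h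
  rw [← h, ← wsum_mul_left]
  refine wsum_congr fun v hv => ?_
  rw [normalizedLift]
  simp [hv]

/-- Dividing the lift at length n by the weight at length n cancels the power of I_{ψ,1} and the
normalization, leaving ψ ^ q / I_{ψ,q}. The weight at the base length is the remaining factor. -/
theorem ballWeight_normalizedLift (hψ : QuasiMul C ψ) (q : ℝ) {z : Carpet r₁ r₂}
    (hz : z ∈ supp ψ) (n : ℕ) :
    ballWeight (normalizedLift ψ q) z n = Real.exp (q * Real.log (ψ (prefixWord z n)) -
      Real.log (fiberSum ψ q (pre z.1 n)) - pressure (weight ψ q) * baseLen r₁ r₂ n +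
      q * (1 - sExp r₁ r₂) * Real.log (fiberSum ψ 1 (pre z.1 (baseLen r₁ r₂ n))) +
      sExp r₁ r₂ * Real.log (fiberSum ψ q (pre z.1 (baseLen r₁ r₂ n)))) := by
  rw [ballWeight, hψ.wsum_normalizedLift_pre, hψ.wsum_normalizedLift_pre, normalizedLift,
    hψ.lift_eq_exp q (hz n), hψ.weight_eq_exp q (hψ.fiberSum_pre_pos hz 1 n),
    hψ.weight_eq_exp q (hψ.fiberSum_pre_pos hz 1 _), map_fst_prefixWord, length_prefixWord]
  simp only [← Real.exp_add, ← Real.exp_sub]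
  congr 1
  ring

/-- The points of the level set have infinitely many heavy balls. -/
theorem frequently_le_ballWeight (hψ : QuasiMul C ψ) (h₁ : 2 ≤ r₁) (h₂ : r₁ ≤ r₂)
    [IsFiniteMeasure μ] (hK : 1 ≤ K) (hμ1 : ∀ w, μ.real (cylinder w) ≤ K * ψ w)
    (hμ2 : ∀ w, ψ w ≤ K * μ.real (cylinder w)) {α q d : ℝ} (hd : α * q - beta ψ q < d)
    {z : Carpet r₁ r₂} (hz : z ∈ levelSet ψ μ α) :
    ∃ᶠ n in atTop, (((r₂ : ℝ)⁻¹) ^ n) ^ d ≤ ballWeight (normalizedLift ψ q) z n := by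
  obtain ⟨hzs, hlim⟩ := hz
  set s := sExp r₁ r₂ with hs
  have hs0 : 0 < s := sExp_pos h₁ h₂
  have hr2 : (0 : ℝ) < r₂ := by exact_mod_cast (by omega : 0 < r₂)
  have hl2 : 0 < Real.log r₂ := Real.log_pos (by exact_mod_cast (by omega : 1 < r₂))
  have hl1 : 0 < Real.log r₁ := Real.log_pos (by exact_mod_cast (by omega : 1 < r₁))
  set U : ℕ → ℝ := fun n => Real.log (fiberSum ψ 1 (pre z.1 n)) with hU
  set κ : ℕ → ℝ := fun n => Real.log (fiberSum ψ q (pre z.1 n)) with hκ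
  obtain ⟨K1, -, hK1⟩ := hψ.fiberSum_one.exists_abs_log_le
  obtain ⟨K2, -, hK2⟩ := (hψ.quasiMul_fiberSum q).exists_abs_log_le
  -- With G = κ - q * U, the logarithm of the ball weight is q log μ(B_n) - P L + s G(L) - G(n) up
  -- to a constant. Linear growth of G is all that is needed to control the last two terms
  -- infinitely often.
  have hG : ∀ n : ℕ, |κ n - q * U n| ≤ (K2 + |q| * K1) * (n + 1) := by
    intro n
    have h3 := hK1 _ (hψ.fiberSum_pre_pos hzs 1 n)
    have h4 := hK2 _ (hψ.fiberSum_pre_pos hzs q n)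
    rw [length_pre] at h3 h4
    refine (abs_sub _ _).trans ?_
    rw [abs_mul]
    have := mul_le_mul_of_nonneg_left h3 (abs_nonneg q)
    linarith
  -- The slack γ is shared in three: the variation of G, the convergence of the local exponent, and
  -- the bounded errors (ball mass constant, and s * L against n in the pressure term).
  set γ := d - (α * q - beta ψ q) with hγ
  have hγ0 : 0 < γ := by linarith
  have hη : 0 < γ * Real.log r₂ / 3 := by positivity
  have hfreq := frequently_le_of_abs_le hG (le_baseLen h₁ h₂)
    (le_sExp_mul_baseLen h₁ h₂) (sExp_mul_baseLen_le h₁ h₂) hη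
  set c := |q| * Real.log (K * C ^ 2) + |beta ψ q| * Real.log r₂ with hc
  obtain ⟨N, hN⟩ := exists_nat_ge (c / (γ * Real.log r₂ / 3))
  have hlim' := (hlim.const_mul q).eventually (gt_mem_nhds (by linarith : q * α < q * α + γ / 3))
  refine (hfreq.and_eventually (hlim'.and
    ((eventually_ge_atTop N).and (eventually_gt_atTop 0)))).mono ?_
  rintro n ⟨hn1, hn2, hn3, hn4⟩
  have hn0 : (0 : ℝ) < n := by exact_mod_cast hn4
  have hball := hψ.abs_log_closedBall_sub_le h₁ h₂ hK hμ1 hμ2 hzs n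
  set lm := Real.log (μ.real (Metric.closedBall z (((r₂ : ℝ)⁻¹) ^ n))) with hlm
  set A := Real.log (ψ (prefixWord z n)) with hA
  set L := baseLen r₁ r₂ n with hL
  rw [hψ.ballWeight_normalizedLift q hzs n, ← Real.rpow_natCast, ← Real.rpow_mul (by positivity),
    Real.rpow_def_of_pos (by positivity), Real.exp_le_exp, Real.log_inv]
  change _ ≤ q * A - κ n - _ * (L : ℝ) + q * (1 - s) * U L + s * κ L
  have hP : pressure (weight ψ q) = -(beta ψ q * (s * Real.log r₂)) := by
    rw [hs, ← log_eq_sExp_mul h₁ h₂, beta]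
    field_simp
  have h3 : |q * (lm - (A + U L - U n))| ≤ |q| * Real.log (K * C ^ 2) := by
    rw [abs_mul]; exact mul_le_mul_of_nonneg_left hball (abs_nonneg q)
  have h4 := le_of_abs_le h3
  have h5 : |beta ψ q * (s * L - n)| ≤ |beta ψ q| := by
    rw [abs_mul]
    refine mul_le_of_le_one_right (abs_nonneg _) ?_
    rw [abs_le]
    constructor <;> linarith [le_sExp_mul_baseLen h₁ h₂ n, sExp_mul_baseLen_le h₁ h₂ n]
  have h6 := mul_le_mul_of_nonneg_right (neg_le_of_abs_le h5) hl2.le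
  have h7 : c ≤ γ * Real.log r₂ / 3 * n := by
    have : (N : ℝ) ≤ n := by exact_mod_cast hn3
    have := hN.trans this
    rw [div_le_iff₀ hη] at this
    linarith
  have h8 : Real.logb r₂ (μ.real (Metric.closedBall z (((r₂ : ℝ)⁻¹) ^ n))) / (-(n : ℝ)) =
      -lm / (Real.log r₂ * n) := by
    rw [Real.logb, ← hlm]; field_simp
  rw [h8] at hn2
  have h9 : q * (-lm / (Real.log r₂ * n)) * (Real.log r₂ * n) = -(q * lm) := by
    field_simp
  have h10 := mul_le_mul_of_nonneg_right hn2.le (by positivity : 0 ≤ Real.log r₂ * n)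
  rw [h9] at h10
  rw [hP]
  have h11 : d = γ + (α * q - beta ψ q) := by rw [hγ]; ring
  rw [h11]
  have h12 : -(q * lm) ≤ (q * α + γ / 3) * (Real.log r₂ * n) := h10
  linarith

theorem exists_wsum_normalizedLift_le (hψ : QuasiMul C ψ) (h₁ : 2 ≤ r₁) (h₂ : r₁ ≤ r₂)
    (ha : 0 < ψ [a]) (q : ℝ) : ∃ Z : ℝ, 0 ≤ Z ∧ (∀ n, wsum n (normalizedLift ψ q) ≤ Z) ∧
      ∀ n, 1 ≤ Z * wsum n (normalizedLift ψ q) := by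
  have hlog := hψ.abs_log_wsum_normalizedLift_le h₁ h₂ ha q
  have hpos := hψ.wsum_normalizedLift_pos h₁ h₂ ha q
  refine ⟨Real.exp (|q| * Real.log C), (Real.exp_pos _).le, fun n => ?_, fun n => ?_⟩
  · rw [← Real.log_le_iff_le_exp (hpos n)]; exact le_of_abs_le (hlog n)
  · rw [← Real.exp_log (hpos n), ← Real.exp_add, Real.one_le_exp_iff]
    have := neg_le_of_abs_le (hlog n)
    linarith

/-- The upper bound for the dimension of the level sets. -/
theorem dimH_levelSet_le (hψ : QuasiMul C ψ) (h₁ : 2 ≤ r₁) (h₂ : r₁ ≤ r₂) (ha : 0 < ψ [a])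
    [IsFiniteMeasure μ] (hK : 1 ≤ K) (hμ1 : ∀ w, μ.real (cylinder w) ≤ K * ψ w)
    (hμ2 : ∀ w, ψ w ≤ K * μ.real (cylinder w)) {α q : ℝ} {d : NNReal}
    (hd : α * q - beta ψ q < d) : dimH (levelSet ψ μ α) ≤ d := by
  have := borelSpace_carpet h₁ (h₁.trans h₂)
  obtain ⟨C', hC'⟩ := hψ.quasiMul_normalizedLift q
  obtain ⟨Z, hZ, hZ1, hZ2⟩ := hψ.exists_wsum_normalizedLift_le h₁ h₂ ha q
  exact dimH_le_of_hausdorffMeasure_ne_top (hC'.hausdorffMeasure_lt_top h₁ h₂ a hZ hZ1 hZ2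
    d.2 fun z hz => hψ.frequently_le_ballWeight h₁ h₂ hK hμ1 hμ2 hd hz).ne

/-- Level sets are empty where the Legendre transform is negative. -/
theorem levelSet_eq_empty (hψ : QuasiMul C ψ) (h₁ : 2 ≤ r₁) (h₂ : r₁ ≤ r₂) (ha : 0 < ψ [a])
    [IsFiniteMeasure μ] (hK : 1 ≤ K) (hμ1 : ∀ w, μ.real (cylinder w) ≤ K * ψ w)
    (hμ2 : ∀ w, ψ w ≤ K * μ.real (cylinder w)) {α q : ℝ}
    (hd : α * q - beta ψ q < 0) : levelSet ψ μ α = ∅ := by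
  by_contra hne
  obtain ⟨z, hz⟩ := Set.nonempty_iff_ne_empty.2 hne
  obtain ⟨C', hC'⟩ := hψ.quasiMul_normalizedLift q
  obtain ⟨Z, hZ, hZ1, hZ2⟩ := hψ.exists_wsum_normalizedLift_le h₁ h₂ ha q
  obtain ⟨d, hd1, hd2⟩ := exists_between hd
  have hfr := hψ.frequently_le_ballWeight h₁ h₂ hK hμ1 hμ2 hd1 hz
  have hr2 : (1 : ℝ) < r₂ := by exact_mod_cast (by omega : 1 < r₂)
  have hgt : Tendsto (fun n : ℕ => (((r₂ : ℝ)⁻¹) ^ d) ^ n) atTop atTop :=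
    tendsto_pow_atTop_atTop_of_one_lt
      (Real.one_lt_rpow_of_pos_of_lt_one_of_neg (by positivity) (inv_lt_one_of_one_lt₀ hr2) hd2)
  obtain ⟨n, hn1, hn2⟩ := (hfr.and_eventually
    (hgt.eventually_gt_atTop (Z * C' * C' ^ 2 * Z))).exists
  -- A family of one ball: its weight is bounded, whereas r₂ ^ (-n d) is unbounded because d < 0.
  have h3 := hC'.sum_ballWeight_le h₁ h₂ a hZ hZ1 hZ2 ({()} : Finset Unit) (fun _ => z)
    (fun _ => n) (by simp)
  rw [Finset.sum_singleton] at h3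
  rw [Real.rpow_pow_comm (by positivity)] at hn2
  linarith

end QuasiMul

end

/-! ### Near-optimal laws on finite blocks -/

noncomputable section

/-- For a differentiable function `f` with `D ≤ α q - f q` for all `q`, there are points where the
derivative is close to `α` and the tangent has intercept at most `-D`. -/
theorem exists_deriv_near {f : ℝ → ℝ} (hf : Differentiable ℝ f) {α D : ℝ}
    (hD : ∀ q, D ≤ α * q - f q) {δ : ℝ} (hδ : 0 < δ) :
    ∃ q, |deriv f q - α| ≤ δ ∧ D ≤ q * deriv f q - f q := by
  set R := α * 0 - f 0 - D with hR
  have hR0 : 0 ≤ R := sub_nonneg.2 (hD 0)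
  -- The penalty ε q² forces a minimum even when the infimum of α q - f q is not attained. At the
  -- minimizer ε q² ≤ R, so |f' - α| = |2 ε q| ≤ δ, and the tangent term gains 2 ε q² ≥ 0 over α q -
  -- f q ≥ D.
  set ε := δ ^ 2 / (4 * (R + 1)) with hε
  have hε0 : 0 < ε := by positivity
  set h : ℝ → ℝ := fun q => α * q - f q + ε * q ^ 2 with hh
  have hcont : Continuous h := by
    have := hf.continuous
    fun_prop
  have hco : Tendsto h (cocompact ℝ) atTop := by
    have h1 : Tendsto (fun q : ℝ => D + ε * ‖q‖ ^ 2) (cocompact ℝ) atTop :=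
      tendsto_atTop_add_const_left _ _ (((tendsto_pow_atTop two_ne_zero).comp
        (tendsto_norm_cocompact_atTop (E := ℝ))).const_mul_atTop hε0)
    refine tendsto_atTop_mono (fun q => ?_) h1
    simp only [hh, Real.norm_eq_abs, sq_abs]
    linarith [hD q]
  obtain ⟨q, hq⟩ := hcont.exists_forall_le hco
  have hder : HasDerivAt h (α * 1 - deriv f q + ε * (2 * q)) q := by
    have h1 := ((hasDerivAt_id q).const_mul α).sub (hf q).hasDerivAt
    have h2 := ((hasDerivAt_pow 2 q).const_mul ε)
    have h3 := h1.add h2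
    exact h3.congr_deriv (by simp)
  have hz : α * 1 - deriv f q + ε * (2 * q) = 0 :=
    IsLocalMin.hasDerivAt_eq_zero (Eventually.of_forall hq) hder
  have h0 : ε * q ^ 2 ≤ R := by
    have h1 := hq 0
    have h2 := hD q
    simp only [hh] at h1
    rw [hR]
    have : ε * (0 : ℝ) ^ 2 = 0 := by ring
    linarith
  refine ⟨q, ?_, ?_⟩
  · have h1 : deriv f q - α = 2 * ε * q := by linarith
    rw [h1]
    refine abs_le_of_sq_le_sq ?_ hδ.le
    have h2 : 4 * (R + 1) * ε = δ ^ 2 := by rw [hε]; field_simp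
    calc (2 * ε * q) ^ 2 = 4 * ε * (ε * q ^ 2) := by ring
      _ ≤ 4 * ε * R := by gcongr
      _ ≤ δ ^ 2 := by rw [← h2]; nlinarith
  · have h1 : deriv f q = α + 2 * ε * q := by linarith
    rw [h1]
    have h2 := hD q
    have h3 : 0 ≤ ε * q ^ 2 := by positivity
    nlinarith

variable {r₁ r₂ : ℕ} {ψ : List (Fin r₁ × Fin r₂) → ℝ} {C : ℝ} {a : Fin r₁ × Fin r₂}

/-- A probability vector on the words of length `n`, carried by the support of `ψ`. -/
structure BlockLaw (ψ : List (Fin r₁ × Fin r₂) → ℝ) (n : ℕ) (p : List (Fin r₁ × Fin r₂) → ℝ) :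
    Prop where
  pos : 0 < n
  nonneg : ∀ w, 0 ≤ p w
  sum : wsum n p = 1
  supp : ∀ w, 0 < p w → 0 < ψ w

/-- The marginal of `p` on the first coordinate. -/
def marginal (p : List (Fin r₁ × Fin r₂) → ℝ) (u : List (Fin r₁)) : ℝ :=
  wsum u.length fun v => p (u.zip v)

/-- The mean of `F` over words of length `n` distributed according to `p`. -/
def mean (n : ℕ) (p F : List (Fin r₁ × Fin r₂) → ℝ) : ℝ := wsum n fun w => p w * F w

/-- The four functions of words whose averages control masses of balls. -/
def observable (ψ p : List (Fin r₁ × Fin r₂) → ℝ) :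
    Fin 4 → List (Fin r₁ × Fin r₂) → ℝ :=
  ![fun w => Real.log (fiberSum ψ 1 (w.map Prod.fst)), fun w => Real.log (ψ w),
    fun w => -Real.log (p w), fun w => -Real.log (marginal p (w.map Prod.fst))]

/-- The law is the lift at a q with β'(q) near α, normalized at length n. Its mean energy per letter
tends to P'(q) = -β'(q) log r₁, and its weighted entropy to P - q P' = (q β' - β) log r₁, which is
at least D log r₁. -/
theorem QuasiMul.exists_blockLaw (hψ : QuasiMul C ψ) (h₁ : 2 ≤ r₁) (h₂ : r₁ ≤ r₂)
    (ha : 0 < ψ [a]) {α D : ℝ} (hD : ∀ q, D ≤ α * q - beta ψ q) {δ : ℝ} (hδ : 0 < δ) (N : ℕ) :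
    ∃ n p, N ≤ n ∧ BlockLaw ψ n p ∧
      |((1 - sExp r₁ r₂) * mean n p (observable ψ p 0) +
        sExp r₁ r₂ * mean n p (observable ψ p 1)) / n + α * Real.log r₁| ≤ δ ∧
      D * Real.log r₁ - δ ≤ (sExp r₁ r₂ * mean n p (observable ψ p 2) +
        (1 - sExp r₁ r₂) * mean n p (observable ψ p 3)) / n := by
  set s := sExp r₁ r₂ with hs
  have hl1 : 0 < Real.log r₁ := Real.log_pos (by exact_mod_cast (by omega : 1 < r₁))
  have hder : ∀ q, ∃ lam, HasDerivAt (fun q => pressure (weight ψ q)) lam q ∧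
      HasDerivAt (beta ψ) (-lam / Real.log r₁) q := fun q => by
    obtain ⟨lam, h⟩ := hψ.hasDerivAt_pressure h₁ h₂ ha q
    exact ⟨lam, h, h.neg.div_const _⟩
  have hdiff : Differentiable ℝ (beta ψ) := fun q =>
    let ⟨_, _, h⟩ := hder q
    h.differentiableAt
  obtain ⟨q, hq1, hq2⟩ := exists_deriv_near hdiff hD (δ := δ / (2 * Real.log r₁)) (by positivity)
  obtain ⟨lam, hlam1, hlam2⟩ := hder q
  rw [hlam2.deriv] at hq1 hq2
  have hE := hψ.tendsto_energy h₁ h₂ ha hlam1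
  have hW := hψ.tendsto_pressure_weight h₁ h₂ ha q
  have hE1 : Tendsto (fun n : ℕ => |energy ψ q n / n - lam|) atTop (𝓝 0) := by
    have := (hE.sub_const lam).abs
    simpa using this
  have hE2 : Tendsto (fun n : ℕ => pressureSeq (weight ψ q) n - q * (energy ψ q n / n)) atTop
      (𝓝 (pressure (weight ψ q) - q * lam)) := hW.sub (hE.const_mul q)
  obtain ⟨n, hn1, hn2, hnN, hn0⟩ := ((hE1.eventually (ge_mem_nhds (by positivity : 0 < δ / 2))).and
    ((hE2.eventually (le_mem_nhds (by linarith : pressure (weight ψ q) - q * lam - δ <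
      pressure (weight ψ q) - q * lam))).and
      ((eventually_ge_atTop N).and (eventually_gt_atTop 0)))).exists
  have hn : (0 : ℝ) < n := by exact_mod_cast hn0
  set W := wsum n (weight ψ q) with hWdef
  have hWpos : 0 < W := hψ.wsum_weight_pos h₁ h₂ ha q n
  set p : List (Fin r₁ × Fin r₂) → ℝ := fun w => lift ψ q w / W with hp
  have hp0 : ∀ w, 0 ≤ p w := fun w => div_nonneg (hψ.lift_nonneg q w) hWpos.le
  have hpψ : ∀ w, 0 < p w → 0 < ψ w := fun w hw =>
    (hψ.lift_pos_iff q).1 ((div_pos_iff_of_pos_right hWpos).1 hw)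
  have hsum : wsum n p = 1 := by
    rw [hp, wsum_div, hψ.wsum_lift, div_self hWpos.ne']
  have hmarg : ∀ u, marginal p u = weight ψ q u / W := fun u => by
    rw [marginal, hp, wsum_div, hψ.wsum_lift_zip_one]
  have hen : (1 - s) * mean n p (observable ψ p 0) + s * mean n p (observable ψ p 1) =
      energy ψ q n := by
    rw [energy, mean, mean, ← wsum_mul_left, ← wsum_mul_left, ← wsum_add, ← wsum_div]
    refine wsum_congr fun w _ => ?_
    simp only [observable, hp, Matrix.cons_val_zero, Matrix.cons_val_one]
    ring
  refine ⟨n, p, hnN, ⟨hn0, hp0, hsum, hpψ⟩, ?_, ?_⟩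
  · rw [hen]
    have h3 : energy ψ q n / n + α * Real.log r₁ =
        (energy ψ q n / n - lam) - (-lam / Real.log r₁ - α) * Real.log r₁ := by
      field_simp; ring
    rw [h3]
    refine (abs_sub _ _).trans ?_
    rw [abs_mul, abs_of_pos hl1]
    have h4 := mul_le_mul_of_nonneg_right hq1 hl1.le
    have h5 : δ / (2 * Real.log r₁) * Real.log r₁ = δ / 2 := by field_simp
    linarith
  -- In s log p + (1 - s) log (marginal), the powers of I_{ψ,q} cancel: s (s - 1) + (1 - s) s = 0.
  -- Only q times the energy and log W remain.
  · have hent : s * mean n p (observable ψ p 2) + (1 - s) * mean n p (observable ψ p 3) =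
        Real.log W - q * energy ψ q n := by
      rw [← hen, mean, mean, mean, mean]
      have h3 : Real.log W = wsum n fun w => Real.log W * p w := by
        rw [wsum_mul_left, hsum, mul_one]
      rw [h3, ← wsum_mul_left, ← wsum_mul_left, ← wsum_mul_left, ← wsum_mul_left, ← wsum_add,
        ← wsum_add, ← wsum_mul_left, ← wsum_sub]
      refine wsum_congr fun w _ => ?_
      rcases (hp0 w).eq_or_lt with h0 | h0
      · simp [← h0]
      have hw := hpψ w h0
      have hl := hψ.lift_eq_exp q hw
      have hwt := hψ.weight_eq_exp q (hψ.fiberSum_pos 1 hw)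
      simp only [observable, Matrix.cons_val_zero, Matrix.cons_val_one, Matrix.cons_val]
      rw [hmarg, hp]
      simp only
      rw [Real.log_div (by rw [hl]; exact (Real.exp_pos _).ne') hWpos.ne',
        Real.log_div (by rw [hwt]; exact (Real.exp_pos _).ne') hWpos.ne', hl, hwt,
        Real.log_exp, Real.log_exp]
      ring
    rw [hent]
    have h3 : (Real.log W - q * energy ψ q n) / n =
        pressureSeq (weight ψ q) n - q * (energy ψ q n / n) := by
      rw [hWdef, wsum, pressureSeq]; ring
    rw [h3]
    refine le_trans ?_ hn2
    have h4 : pressure (weight ψ q) - q * lam =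
        (q * (-lam / Real.log r₁) - beta ψ q) * Real.log r₁ := by
      rw [beta]; field_simp; ring
    rw [h4]
    have := mul_le_mul_of_nonneg_right hq2 hl1.le
    linarith

theorem BlockLaw.le_marginal {n : ℕ} {p : List (Fin r₁ × Fin r₂) → ℝ} (h : BlockLaw ψ n p)
    (w : List (Fin r₁ × Fin r₂)) : p w ≤ marginal p (w.map Prod.fst) := by
  have h1 : w = (w.map Prod.fst).zip (w.map Prod.snd) := by
    rw [List.zip_map', List.map_id'' (fun _ => rfl)]
  have h2 := le_wsum (f := fun v => p ((w.map Prod.fst).zip v)) (fun v => h.nonneg _)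
    (w.map Prod.snd)
  rw [List.length_map, ← h1] at h2
  rwa [marginal, List.length_map]

theorem BlockLaw.wsum_marginal {n : ℕ} {p : List (Fin r₁ × Fin r₂) → ℝ} (h : BlockLaw ψ n p) :
    wsum n (marginal p) = 1 := by
  rw [← h.sum, wsum_zip]
  refine wsum_congr fun u hu => ?_
  rw [marginal, hu]

theorem BlockLaw.marginal_le_one {n : ℕ} {p : List (Fin r₁ × Fin r₂) → ℝ} (h : BlockLaw ψ n p)
    {u : List (Fin r₁)} (hu : u.length = n) : marginal p u ≤ 1 := by
  subst hu
  rw [← h.wsum_marginal]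
  exact le_wsum (fun u => wsum_nonneg fun v _ => h.nonneg _) u

/-- The entropy of a probability vector on words of length `n` is at most `n log |A|`. -/
theorem BlockLaw.entropy_le {n : ℕ} {p : List (Fin r₁ × Fin r₂) → ℝ} (h : BlockLaw ψ n p) :
    mean n p (observable ψ p 2) ≤ n * Real.log (r₁ * r₂) := by
  have hex : ∃ w : List (Fin r₁ × Fin r₂), w.length = n := by
    by_contra! hne
    have h1 : wsum n p ≤ wsum n fun _ : List (Fin r₁ × Fin r₂) => (0 : ℝ) :=
      wsum_mono fun w hw => absurd hw (hne w)
    rw [wsum_const_zero, h.sum] at h1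
    linarith
  obtain ⟨w, hw⟩ := hex
  have hne : 0 < w.length := hw ▸ h.pos
  have hr1 : (0 : ℝ) < r₁ := by exact_mod_cast (w[0].1).pos
  have hr2 : (0 : ℝ) < r₂ := by exact_mod_cast (w[0].2).pos
  set c : ℝ := (r₁ * r₂ : ℝ) ^ n with hc
  have hc0 : 0 < c := by positivity
  have hcard : (wsum n fun _ : List (Fin r₁ × Fin r₂) => c⁻¹) = 1 := by
    simp [wsum, hc]
    field_simp
  have hle : mean n p (observable ψ p 2) ≤
      wsum n fun w => (Real.log c * p w + c⁻¹) - p w := by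
    refine wsum_mono fun w _ => ?_
    simp only [observable, Matrix.cons_val]
    rcases (h.nonneg w).eq_or_lt with h0 | h0
    · simp [← h0, hc0.le]
    -- Gibbs' inequality against the uniform law of mass 1 / c.
    · have h1 := Real.log_le_sub_one_of_pos (by positivity : 0 < 1 / (p w * c))
      rw [Real.log_div one_ne_zero (by positivity), Real.log_one,
        Real.log_mul h0.ne' hc0.ne'] at h1
      have h2 := mul_le_mul_of_nonneg_left h1 h0.le
      have h3 : p w * (1 / (p w * c) - 1) = c⁻¹ - p w := by field_simp
      rw [h3] at h2
      linarith
  refine hle.trans_eq ?_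
  rw [wsum_sub, wsum_add, wsum_mul_left, hcard, h.sum, hc, Real.log_pow]
  ring

end

noncomputable section

/-! ### A strong law of large numbers for slowly growing independent variables -/

section lln

variable {Ω : Type*} {mΩ : MeasurableSpace Ω} {P : Measure Ω} [IsProbabilityMeasure P]

open ProbabilityTheory in
-- Hoeffding and Borel–Cantelli. The growth B j ^ 4 ≤ j + K makes the variance proxy O(J^(3/2)), so
-- the exponent is at least of order J^(1/2) and the tail probabilities are O(J⁻²).
theorem ae_eventually_sum_lt {X : ℕ → Ω → ℝ} (hX : ∀ j, Measurable (X j))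
    (hind : iIndepFun X P) {B : ℕ → ℝ} {K : ℝ} (hB1 : ∀ j, 1 ≤ B j) (hK : 0 ≤ K)
    (hB4 : ∀ j, B j ^ 4 ≤ j + K) (hXB : ∀ j ω, |X j ω| ≤ B j) {δ : ℝ} (hδ : 0 < δ) :
    ∀ᵐ ω ∂P, ∀ᶠ J : ℕ in atTop, ∑ j ∈ Finset.range J, (X j ω - ∫ ω, X j ω ∂P) < δ * J := by
  set c : ℕ → NNReal := fun j => (‖B j - -B j‖₊ / 2) ^ 2 with hc
  have hcB : ∀ j, (c j : ℝ) = B j ^ 2 := by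
    intro j
    have h0 : 0 ≤ B j := by linarith [hB1 j]
    simp only [hc]
    push_cast
    rw [Real.norm_eq_abs, sub_neg_eq_add, abs_of_nonneg (by linarith)]
    ring
  have hsub : ∀ j, HasSubgaussianMGF (fun ω => X j ω - ∫ ω, X j ω ∂P) (c j) P := fun j =>
    hasSubgaussianMGF_of_mem_Icc (hX j).aemeasurable (Eventually.of_forall fun ω => by
      rw [Set.mem_Icc, ← abs_le]; exact hXB j ω)
  have hind' : iIndepFun (fun j ω => X j ω - ∫ ω, X j ω ∂P) P :=
    hind.comp (fun j x => x - ∫ ω, X j ω ∂P) fun j => measurable_id.sub_const _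
  set S : ℕ → Set Ω := fun J =>
    {ω | δ * J ≤ ∑ j ∈ Finset.range J, (X j ω - ∫ ω, X j ω ∂P)} with hS
  have hbound : ∀ J : ℕ, P.real (S J) ≤ (384 * (1 + K) ^ 2 / δ ^ 8 + 1) * (1 / (J : ℝ) ^ 2) ∨
      J = 0 := by
    intro J
    rcases Nat.eq_zero_or_pos J with h0 | h0
    · exact Or.inr h0
    left
    have hJ : (1 : ℝ) ≤ J := by exact_mod_cast h0
    have h1 := HasSubgaussianMGF.measure_sum_ge_le_of_iIndepFun hind' (s := Finset.range J)
      (fun j _ => hsub j) (by positivity : 0 ≤ δ * J)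
    simp only [NNReal.coe_sum, hcB] at h1
    set T := ∑ j ∈ Finset.range J, B j ^ 2 with hT
    have hTJ : (J : ℝ) ≤ T := by
      calc (J : ℝ) = ∑ j ∈ Finset.range J, (1 : ℝ) := by simp
        _ ≤ T := Finset.sum_le_sum fun j _ => one_le_pow₀ (hB1 j)
    have hT0 : 0 < T := by linarith
    have hT2 : T ^ 2 ≤ J ^ 3 * (1 + K) := by
      calc T ^ 2 ≤ (Finset.range J).card * ∑ j ∈ Finset.range J, (B j ^ 2) ^ 2 :=
            sq_sum_le_card_mul_sum_sq
        _ ≤ J * ∑ j ∈ Finset.range J, (J + K) := by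
            rw [Finset.card_range]
            gcongr with j hj
            have h3 := hB4 j
            have h4 : (j : ℝ) ≤ J := by exact_mod_cast (Finset.mem_range.1 hj).le
            calc (B j ^ 2) ^ 2 = B j ^ 4 := by ring
              _ ≤ _ := by linarith
        _ = J ^ 2 * (J + K) := by simp; ring
        _ ≤ J ^ 2 * (J + J * K) := by gcongr; exact le_mul_of_one_le_left hK hJ
        _ = _ := by ring
    set y := (δ * J) ^ 2 / (2 * T) with hy
    have hy0 : 0 < y := by positivity
    -- The fourth power suffices: y ^ 4 is at least of order J ^ 2.
    have h2 := Real.pow_div_factorial_le_exp y hy0.le 4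
    have h3 : Real.exp (-(δ * J) ^ 2 / (2 * T)) ≤ 24 / y ^ 4 := by
      rw [neg_div, ← hy, Real.exp_neg, inv_le_comm₀ (Real.exp_pos _) (by positivity), inv_div]
      refine le_trans (le_of_eq ?_) h2
      norm_num [Nat.factorial]
    refine h1.trans (h3.trans ?_)
    have h4 : 24 / y ^ 4 = 384 * (T ^ 2) ^ 2 / (δ ^ 8 * J ^ 8) := by
      rw [hy]; field_simp; ring
    rw [h4]
    have h5 : (T ^ 2) ^ 2 ≤ (J ^ 3 * (1 + K)) ^ 2 := by gcongr
    calc 384 * (T ^ 2) ^ 2 / (δ ^ 8 * J ^ 8)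
        ≤ 384 * (J ^ 3 * (1 + K)) ^ 2 / (δ ^ 8 * J ^ 8) := by gcongr
      _ = 384 * (1 + K) ^ 2 / δ ^ 8 * (1 / (J : ℝ) ^ 2) := by field_simp
      _ ≤ _ := by gcongr; linarith
  have hsum : ∑' J, P (S J) ≠ ∞ := by
    have hs : Summable fun J : ℕ => P.real (S J) := by
      have h1 : Summable fun J : ℕ => (384 * (1 + K) ^ 2 / δ ^ 8 + 1) * (1 / (J : ℝ) ^ 2) :=
        (Real.summable_one_div_nat_pow.2 (by norm_num)).mul_left _
      refine Summable.of_norm_bounded_eventually_nat h1 ?_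
      filter_upwards [eventually_gt_atTop 0] with J hJ
      rw [Real.norm_of_nonneg measureReal_nonneg]
      exact (hbound J).resolve_right hJ.ne'
    have h2 := hs.tsum_ofReal_ne_top
    simpa [Measure.real] using h2
  filter_upwards [ae_eventually_notMem hsum] with ω hω
  filter_upwards [hω] with J hJ
  simpa [hS] using hJ

open ProbabilityTheory in
-- The one-sided bound is used for X and -X, along the countable family of thresholds 1 / (k + 1).
theorem ae_tendsto_average {X : ℕ → Ω → ℝ} (hX : ∀ j, Measurable (X j))
    (hind : iIndepFun X P) {B : ℕ → ℝ} {K : ℝ} (hB1 : ∀ j, 1 ≤ B j) (hK : 0 ≤ K)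
    (hB4 : ∀ j, B j ^ 4 ≤ j + K) (hXB : ∀ j ω, |X j ω| ≤ B j) :
    ∀ᵐ ω ∂P, Tendsto (fun J : ℕ => (∑ j ∈ Finset.range J, (X j ω - ∫ ω, X j ω ∂P)) / J)
      atTop (𝓝 0) := by
  have h1 : ∀ k : ℕ, ∀ᵐ ω ∂P, ∀ᶠ J : ℕ in atTop,
      ∑ j ∈ Finset.range J, (X j ω - ∫ ω, X j ω ∂P) < 1 / ((k : ℝ) + 1) * J := fun k =>
    ae_eventually_sum_lt hX hind hB1 hK hB4 hXB (by positivity)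
  have h2 : ∀ k : ℕ, ∀ᵐ ω ∂P, ∀ᶠ J : ℕ in atTop,
      ∑ j ∈ Finset.range J, (-X j ω - ∫ ω, -X j ω ∂P) < 1 / ((k : ℝ) + 1) * J := fun k =>
    ae_eventually_sum_lt (fun j => (hX j).neg)
      (hind.comp (fun _ x => -x) fun _ => measurable_neg) hB1 hK hB4
      (fun j ω => by simpa using hXB j ω) (by positivity)
  filter_upwards [ae_all_iff.2 h1, ae_all_iff.2 h2] with ω hω1 hω2
  rw [Metric.tendsto_nhds]
  intro ε hε
  obtain ⟨k, hk⟩ := exists_nat_one_div_lt hε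
  filter_upwards [hω1 k, hω2 k, eventually_gt_atTop 0] with J hJ1 hJ2 hJ0
  have hJ : (0 : ℝ) < J := by exact_mod_cast hJ0
  have h3 : ∑ j ∈ Finset.range J, (-X j ω - ∫ ω, -X j ω ∂P) =
      -∑ j ∈ Finset.range J, (X j ω - ∫ ω, X j ω ∂P) := by
    rw [← Finset.sum_neg_distrib]
    refine Finset.sum_congr rfl fun j _ => ?_
    rw [integral_neg]; ring
  rw [h3] at hJ2
  rw [Real.dist_eq, sub_zero, abs_div, Nat.abs_cast, div_lt_iff₀ hJ]
  have h4 : 1 / ((k : ℝ) + 1) * J < ε * J := by gcongr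
  rw [abs_lt]
  constructor <;> linarith

end lln

/-- Any sequence can be slowed down so as to grow at most linearly. -/
theorem exists_slow (M : ℕ → ℕ) :
    ∃ θ : ℕ → ℕ, Tendsto θ atTop atTop ∧ ∀ j, M (θ j) ≤ j + M 0 := by
  classical
  -- When no index qualifies the value is 0, which accounts for the additive M 0.
  refine ⟨fun j => Nat.findGreatest (fun i => M i ≤ j) j, ?_, fun j => ?_⟩
  · rw [tendsto_atTop]
    intro b
    filter_upwards [eventually_ge_atTop (max b (M b))] with j hj
    exact Nat.le_findGreatest ((le_max_left _ _).trans hj) ((le_max_right _ _).trans hj)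
  · rcases Nat.eq_zero_or_pos (Nat.findGreatest (fun i => M i ≤ j) j) with h0 | h0
    · simp only [h0]; omega
    · exact (Nat.findGreatest_of_ne_zero (P := fun i => M i ≤ j) rfl h0.ne').trans (by omega)

/-! ### Concatenations of random blocks -/

variable {r₁ r₂ : ℕ} {ψ : List (Fin r₁ × Fin r₂) → ℝ} {C : ℝ} {a : Fin r₁ × Fin r₂}

/-- Sequences of blocks of prescribed lengths. -/
abbrev Blocks (r₁ r₂ : ℕ) (n : ℕ → ℕ) : Type := (j : ℕ) → Fin (n j) → Fin r₁ × Fin r₂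

section concat

variable {n : ℕ → ℕ}

/-- The concatenation of the first `J` blocks. -/
def concat (ω : Blocks r₁ r₂ n) : ℕ → List (Fin r₁ × Fin r₂)
  | 0 => []
  | J + 1 => concat ω J ++ List.ofFn (ω J)

/-- The length of the concatenation of the first `J` blocks. -/
def concatLen (n : ℕ → ℕ) (J : ℕ) : ℕ := ∑ j ∈ Finset.range J, n j

@[simp] theorem length_concat (ω : Blocks r₁ r₂ n) (J : ℕ) :
    (concat ω J).length = concatLen n J := by
  induction J with
  | zero => rfl
  | succ J ih => rw [concat, List.length_append, ih, concatLen, concatLen,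
      Finset.sum_range_succ, List.length_ofFn]

theorem concatLen_succ (n : ℕ → ℕ) (J : ℕ) : concatLen n (J + 1) = concatLen n J + n J :=
  Finset.sum_range_succ _ _

theorem le_concatLen (hn : ∀ j, 0 < n j) (J : ℕ) : J ≤ concatLen n J := by
  induction J with
  | zero => exact Nat.zero_le _
  | succ J ih =>
    have := hn J
    rw [concatLen_succ]; omega

theorem concat_prefix (ω : Blocks r₁ r₂ n) {J J' : ℕ} (h : J ≤ J') :
    concat ω J <+: concat ω J' := by
  induction J', h using Nat.le_induction with
  | base => exact List.prefix_rfl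
  | succ J' _ ih => exact ih.trans (List.prefix_append _ _)

/-- The point of the carpet obtained by concatenating all blocks. -/
def concatPoint (a : Fin r₁ × Fin r₂) (ω : Blocks r₁ r₂ n) : Carpet r₁ r₂ :=
  (fun k => ((concat ω (k + 1)).getD k a).1, fun k => ((concat ω (k + 1)).getD k a).2)

theorem prefixWord_concatPoint (hn : ∀ j, 0 < n j) (a : Fin r₁ × Fin r₂) (ω : Blocks r₁ r₂ n)
    (J : ℕ) : prefixWord (concatPoint a ω) (concatLen n J) = concat ω J := by
  apply List.ext_getElem
  · simp
  · intro k h1 h2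
    simp only [prefixWord, concatPoint, List.getElem_ofFn]
    change (concat ω (k + 1)).getD k a = _
    -- Blocks are nonempty, so k + 1 of them contain a letter of index k and the default letter is
    -- never read.
    have h3 : k < (concat ω (k + 1)).length := by
      have := le_concatLen hn (k + 1)
      rw [length_concat]; omega
    rw [List.getD_eq_getElem _ _ h3]
    rcases le_total J (k + 1) with h | h
    · exact ((concat_prefix ω h).getElem h2).symm
    · exact (concat_prefix ω h).getElem h3

/-- Block lengths are deterministic, so a concatenation can be decoded. It is needed for full words
and for their first coordinates only. -/
theorem concat_map_injective {β : Type*} (φ : Fin r₁ × Fin r₂ → β) {ω ω' : Blocks r₁ r₂ n} {J : ℕ}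
    (h : (concat ω J).map φ = (concat ω' J).map φ) {j : ℕ} (hj : j < J) :
    (List.ofFn (ω j)).map φ = (List.ofFn (ω' j)).map φ := by
  induction J with
  | zero => omega
  | succ J ih =>
    rw [concat, concat, List.map_append, List.map_append] at h
    obtain ⟨h1, h2⟩ := List.append_inj h (by simp)
    rcases Nat.lt_succ_iff_lt_or_eq.1 hj with h3 | rfl
    · exact ih h1 h3
    · exact h2

theorem measurableSet_concat_eq (J : ℕ) (l : List (Fin r₁ × Fin r₂)) :
    MeasurableSet {ω : Blocks r₁ r₂ n | concat ω J = l} := by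
  induction J generalizing l with
  | zero => simp only [concat]; exact MeasurableSet.const _
  | succ J ih =>
    have : {ω : Blocks r₁ r₂ n | concat ω (J + 1) = l} =
        {ω | concat ω J = l.take (concatLen n J)} ∩
        (fun ω : Blocks r₁ r₂ n => ω J) ⁻¹' {w | l.take (concatLen n J) ++ List.ofFn w = l} := by
      ext ω
      simp only [concat, Set.mem_ofPred_eq, Set.mem_inter_iff, Set.mem_preimage]
      constructor
      · intro h
        have h1 : concat ω J = l.take (concatLen n J) := by
          rw [← h, ← length_concat ω J, List.take_left]
        exact ⟨h1, by rw [← h1]; exact h⟩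
      · rintro ⟨h1, h2⟩
        rw [h1]; exact h2
    rw [this]
    exact (ih _).inter (measurable_pi_apply J (Set.toFinite _).measurableSet)

theorem measurable_getD_concat (a : Fin r₁ × Fin r₂) (k : ℕ) :
    Measurable fun ω : Blocks r₁ r₂ n => (concat ω (k + 1)).getD k a := by
  refine measurable_to_countable' fun b => ?_
  have : (fun ω : Blocks r₁ r₂ n => (concat ω (k + 1)).getD k a) ⁻¹' {b} =
      ⋃ l ∈ {l : List (Fin r₁ × Fin r₂) | l.getD k a = b}, {ω | concat ω (k + 1) = l} := by
    ext ω; simp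
  rw [this]
  exact MeasurableSet.biUnion (Set.to_countable _) fun l _ => measurableSet_concat_eq _ _

theorem measurable_concatPoint (hr₁ : 2 ≤ r₁) (hr₂ : 2 ≤ r₂) (a : Fin r₁ × Fin r₂) :
    Measurable (concatPoint (n := n) a) := by
  have h1 : Measurable fun ω : Blocks r₁ r₂ n => fun k => ((concat ω (k + 1)).getD k a).1 :=
    measurable_pi_lambda _ fun k => (measurable_getD_concat a k).fst
  have h2 : Measurable fun ω : Blocks r₁ r₂ n => fun k => ((concat ω (k + 1)).getD k a).2 :=
    measurable_pi_lambda _ fun k => (measurable_getD_concat a k).snd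
  exact (((continuous_toSymbolic hr₁).measurable).comp h1).prodMk
    (((continuous_toSymbolic hr₂).measurable).comp h2)

end concat

/-- The measure on blocks of length `n` with the masses given by `p`. -/
def blockMeasure (n : ℕ) (p : List (Fin r₁ × Fin r₂) → ℝ) :
    Measure (Fin n → Fin r₁ × Fin r₂) :=
  ∑ w, ENNReal.ofReal (p (List.ofFn w)) • Measure.dirac w

section blockMeasure

variable {n : ℕ} {p : List (Fin r₁ × Fin r₂) → ℝ}

theorem BlockLaw.blockMeasure_apply (h : BlockLaw ψ n p)
    (S : Set (Fin n → Fin r₁ × Fin r₂)) [DecidablePred (· ∈ S)] :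
    blockMeasure n p S = ENNReal.ofReal (∑ w, if w ∈ S then p (List.ofFn w) else 0) := by
  have hS : MeasurableSet S := (Set.toFinite S).measurableSet
  rw [blockMeasure, Measure.finsetSum_apply, ENNReal.ofReal_sum_of_nonneg]
  · refine Finset.sum_congr rfl fun w _ => ?_
    rw [Measure.smul_apply, Measure.dirac_apply' _ hS, smul_eq_mul]
    by_cases h : w ∈ S <;> simp [h]
  · intro w _
    have := h.nonneg (List.ofFn w)
    split_ifs <;> simp [this]

theorem BlockLaw.isProbabilityMeasure (h : BlockLaw ψ n p) :
    IsProbabilityMeasure (blockMeasure n p) := by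
  classical
  refine ⟨?_⟩
  rw [h.blockMeasure_apply]
  simp only [Set.mem_univ, if_true]
  rw [← ENNReal.ofReal_one, ← h.sum]
  rfl

theorem BlockLaw.blockMeasure_singleton (h : BlockLaw ψ n p) (w : Fin n → Fin r₁ × Fin r₂) :
    blockMeasure n p {w} = ENNReal.ofReal (p (List.ofFn w)) := by
  classical
  rw [h.blockMeasure_apply]
  simp

theorem wsum_ite_eq {A : Type*} [Fintype A] [DecidableEq A] {u : List A} {m : ℕ}
    (hu : u.length = m) (F : List A → ℝ) :
    (wsum m fun u' => if u' = u then F u' else 0) = F u := by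
  subst hu
  rw [wsum, Finset.sum_eq_single u.get]
  · simp
  · intro b _ hb
    rw [if_neg]
    intro he
    apply hb
    rw [← List.ofFn_inj, he, List.ofFn_get]
  · simp

theorem BlockLaw.blockMeasure_fiber (h : BlockLaw ψ n p) (w : Fin n → Fin r₁ × Fin r₂) :
    blockMeasure n p {w' | (List.ofFn w').map Prod.fst = (List.ofFn w).map Prod.fst} =
      ENNReal.ofReal (marginal p ((List.ofFn w).map Prod.fst)) := by
  classical
  rw [h.blockMeasure_apply]
  congr 1
  set u := (List.ofFn w).map Prod.fst with hu
  have hun : u.length = n := by simp [hu]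
  have h1 : (∑ w' : Fin n → Fin r₁ × Fin r₂, if w' ∈ {w' : Fin n → Fin r₁ × Fin r₂ |
      (List.ofFn w').map Prod.fst = u} then p (List.ofFn w') else 0) =
      wsum n fun w' => if w'.map Prod.fst = u then p w' else 0 := rfl
  rw [h1, wsum_zip]
  have h2 : (wsum n fun u' => wsum n fun v => if (u'.zip v).map Prod.fst = u then p (u'.zip v)
      else 0) = wsum n fun u' => if u' = u then marginal p u' else 0 := by
    refine wsum_congr fun u' hu' => ?_
    split_ifs with he
    · rw [marginal, hu']
      refine wsum_congr fun v hv => ?_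
      rw [map_fst_zip (by omega), if_pos he]
    · refine (wsum_congr (g := fun _ => 0) fun v hv => ?_).trans wsum_const_zero
      rw [map_fst_zip (by omega), if_neg he]
  rw [h2]
  exact wsum_ite_eq hun _

theorem BlockLaw.integral_blockMeasure (h : BlockLaw ψ n p)
    (F : List (Fin r₁ × Fin r₂) → ℝ) :
    ∫ w, F (List.ofFn w) ∂(blockMeasure n p) = mean n p F := by
  have := h.isProbabilityMeasure
  rw [integral_fintype (Integrable.of_finite), mean, wsum]
  refine Finset.sum_congr rfl fun w _ => ?_
  rw [Measure.real, h.blockMeasure_singleton, ENNReal.toReal_ofReal (h.nonneg _), smul_eq_mul]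

theorem BlockLaw.ae_pos (h : BlockLaw ψ n p) :
    ∀ᵐ w ∂(blockMeasure n p), 0 < p (List.ofFn w) := by
  classical
  rw [ae_iff, h.blockMeasure_apply, ENNReal.ofReal_eq_zero]
  refine (Finset.sum_nonpos fun w _ => ?_)
  split_ifs with hw
  · exact not_lt.1 hw
  · rfl

end blockMeasure

end

noncomputable section

variable {r₁ r₂ : ℕ} {ψ : List (Fin r₁ × Fin r₂) → ℝ} {C : ℝ} {a : Fin r₁ × Fin r₂}

/-! ### Products of block measures -/

/-- The law of a sequence of independent blocks. -/
def blocksLaw (n : ℕ → ℕ) (p : ℕ → List (Fin r₁ × Fin r₂) → ℝ) : Measure (Blocks r₁ r₂ n) :=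
  Measure.infinitePi fun j => blockMeasure (n j) (p j)

section blocksLaw

variable {n : ℕ → ℕ} {p : ℕ → List (Fin r₁ × Fin r₂) → ℝ}

theorem isProbabilityMeasure_blocksLaw (hp : ∀ j, BlockLaw ψ (n j) (p j)) :
    IsProbabilityMeasure (blocksLaw n p) := by
  have := fun j => (hp j).isProbabilityMeasure
  rw [blocksLaw]
  infer_instance

theorem ae_blocksLaw_pos (hp : ∀ j, BlockLaw ψ (n j) (p j)) :
    ∀ᵐ ω ∂(blocksLaw n p), ∀ j, 0 < p j (List.ofFn (ω j)) := by
  have := fun j => (hp j).isProbabilityMeasure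
  rw [ae_all_iff]
  intro j
  exact (measurePreserving_eval_infinitePi (fun j => blockMeasure (n j) (p j))
    j).quasiMeasurePreserving.ae (hp j).ae_pos

theorem integral_blocksLaw (hp : ∀ j, BlockLaw ψ (n j) (p j)) (j : ℕ)
    (F : List (Fin r₁ × Fin r₂) → ℝ) :
    ∫ ω, F (List.ofFn (ω j)) ∂(blocksLaw n p) = mean (n j) (p j) F := by
  have := fun j => (hp j).isProbabilityMeasure
  have h := measurePreserving_eval_infinitePi (fun j => blockMeasure (n j) (p j)) j
  rw [← (hp j).integral_blockMeasure F, ← h.map_eq, integral_map h.measurable.aemeasurable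
    (measurable_of_finite _).aestronglyMeasurable]
  rfl

theorem ae_tendsto_average_blocks (hp : ∀ j, BlockLaw ψ (n j) (p j))
    (F : ℕ → List (Fin r₁ × Fin r₂) → ℝ) {B : ℕ → ℝ} {K : ℝ} (hB1 : ∀ j, 1 ≤ B j)
    (hK : 0 ≤ K) (hB4 : ∀ j, B j ^ 4 ≤ j + K) (hF : ∀ j w, w.length = n j → |F j w| ≤ B j) :
    ∀ᵐ ω ∂(blocksLaw n p), Tendsto (fun J : ℕ => (∑ j ∈ Finset.range J,
      (F j (List.ofFn (ω j)) - mean (n j) (p j) (F j))) / J) atTop (𝓝 0) := by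
  have := fun j => (hp j).isProbabilityMeasure
  have := isProbabilityMeasure_blocksLaw hp
  have h1 := ae_tendsto_average (P := blocksLaw n p) (X := fun j ω => F j (List.ofFn (ω j)))
    (fun j => (measurable_of_finite fun w => F j (List.ofFn w)).comp (measurable_pi_apply j))
    (ProbabilityTheory.iIndepFun_infinitePi (X := fun j w => F j (List.ofFn w))
      fun j => measurable_of_finite _) hB1 hK hB4 (fun j ω => hF j _ (by simp))
  simpa only [integral_blocksLaw hp] using h1

/-- A ball of index N determines both coordinates up to N but only the first one up to the base
length, so the later blocks are known only through their projections. -/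
theorem agree_of_mem_closedBall (h₁ : 2 ≤ r₁) (h₂ : r₁ ≤ r₂) (hn : ∀ j, 0 < n j)
    (a : Fin r₁ × Fin r₂) {ω ω' : Blocks r₁ r₂ n} {N J J' : ℕ} (hJ : concatLen n J ≤ N)
    (hJ' : concatLen n J' ≤ baseLen r₁ r₂ N)
    (h : concatPoint a ω' ∈ Metric.closedBall (concatPoint a ω) (((r₂ : ℝ)⁻¹) ^ N)) :
    (∀ j < J, ω' j = ω j) ∧
      ∀ j < J', (List.ofFn (ω' j)).map Prod.fst = (List.ofFn (ω j)).map Prod.fst := by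
  rw [mem_closedBall_iff h₁ h₂] at h
  constructor
  · intro j hj
    have h1 := pre_eq_of_le (hJ.trans (le_baseLen h₁ h₂ N)) h.1
    have h2 := pre_eq_of_le hJ h.2
    have h3 : concat ω' J = concat ω J := by
      rw [← prefixWord_concatPoint hn a, ← prefixWord_concatPoint hn a, prefixWord_eq_zip,
        prefixWord_eq_zip, h1, h2]
    have h4 := concat_map_injective id (congrArg (List.map id) h3) hj
    simpa [List.ofFn_inj] using h4
  · intro j hj
    refine concat_map_injective Prod.fst ?_ hj
    rw [← prefixWord_concatPoint hn a, ← prefixWord_concatPoint hn a, map_fst_prefixWord,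
      map_fst_prefixWord, pre_eq_of_le hJ' h.1]

/-- By independence the ball lies in an event of product form: each of the first J blocks
contributes its mass under p, each of the blocks from J to J' its marginal mass. Letters of
incomplete blocks are ignored, which can only enlarge the event. -/
theorem blocksLaw_preimage_closedBall_le (h₁ : 2 ≤ r₁) (h₂ : r₁ ≤ r₂)
    (hp : ∀ j, BlockLaw ψ (n j) (p j)) (a : Fin r₁ × Fin r₂) {ω : Blocks r₁ r₂ n}
    (hω : ∀ j, 0 < p j (List.ofFn (ω j))) {N J J' : ℕ} (hJJ : J ≤ J')
    (hJ : concatLen n J ≤ N) (hJ' : concatLen n J' ≤ baseLen r₁ r₂ N) :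
    blocksLaw n p (concatPoint a ⁻¹'
      Metric.closedBall (concatPoint a ω) (((r₂ : ℝ)⁻¹) ^ N)) ≤ ENNReal.ofReal (Real.exp
        (-(∑ j ∈ Finset.range J, observable ψ (p j) 2 (List.ofFn (ω j)) +
          (∑ j ∈ Finset.range J', observable ψ (p j) 3 (List.ofFn (ω j)) -
            ∑ j ∈ Finset.range J, observable ψ (p j) 3 (List.ofFn (ω j)))))) := by
  classical
  have := fun j => (hp j).isProbabilityMeasure
  set t : (j : ℕ) → Set (Fin (n j) → Fin r₁ × Fin r₂) := fun j => if j < J then {ω j} else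
    {w' | (List.ofFn w').map Prod.fst = (List.ofFn (ω j)).map Prod.fst} with ht
  have hsub : concatPoint a ⁻¹' Metric.closedBall (concatPoint a ω) (((r₂ : ℝ)⁻¹) ^ N) ⊆
      Set.pi (Finset.range J') t := by
    intro ω' hω'
    obtain ⟨h3, h4⟩ := agree_of_mem_closedBall h₁ h₂ (fun j => (hp j).pos) a hJ hJ' hω'
    intro j hj
    simp only [ht]
    split_ifs with hjJ
    · exact h3 j hjJ
    · exact h4 j (by simpa using hj)
  refine (measure_mono hsub).trans ?_
  rw [blocksLaw, Measure.infinitePi_pi _ fun j _ => (Set.toFinite _).measurableSet]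
  have hfac : ∀ j, blockMeasure (n j) (p j) (t j) = ENNReal.ofReal (Real.exp
      (-(if j < J then observable ψ (p j) 2 (List.ofFn (ω j)) else
        observable ψ (p j) 3 (List.ofFn (ω j))))) := by
    intro j
    simp only [ht]
    split_ifs with hjJ
    · rw [(hp j).blockMeasure_singleton]
      simp [observable, Real.exp_log (hω j)]
    · rw [(hp j).blockMeasure_fiber]
      have h5 : 0 < marginal (p j) ((List.ofFn (ω j)).map Prod.fst) :=
        (hω j).trans_le ((hp j).le_marginal _)
      simp only [observable, Matrix.cons_val, neg_neg]
      rw [Real.exp_log h5]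
  rw [Finset.prod_congr rfl fun j _ => hfac j,
    ← ENNReal.ofReal_prod_of_nonneg fun j _ => (Real.exp_pos _).le, ← Real.exp_sum,
    Finset.sum_neg_distrib, ← Finset.sum_range_add_sum_Ico _ hJJ,
    ← Finset.sum_range_add_sum_Ico (fun j => observable ψ (p j) 3 (List.ofFn (ω j))) hJJ,
    add_sub_cancel_left]
  refine le_of_eq ?_
  congr 4
  · exact Finset.sum_congr rfl fun j hj => if_pos (Finset.mem_range.1 hj)
  · exact Finset.sum_congr rfl fun j hj => if_neg (not_lt.2 (Finset.mem_Ico.1 hj).1)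

end blocksLaw

end

noncomputable section

variable {r₁ r₂ : ℕ} {ψ : List (Fin r₁ × Fin r₂) → ℝ} {C : ℝ} {a : Fin r₁ × Fin r₂}

/-! ### Asymptotics along concatenations -/

section asymptotics

variable {n : ℕ → ℕ}

/-- The number of complete blocks among the first `N` letters. -/
def blockCount (n : ℕ → ℕ) (N : ℕ) : ℕ := Nat.findGreatest (fun J => concatLen n J ≤ N) N

theorem concatLen_blockCount_le (n : ℕ → ℕ) (N : ℕ) : concatLen n (blockCount n N) ≤ N :=
  Nat.findGreatest_spec (P := fun J => concatLen n J ≤ N) (Nat.zero_le N) (by simp [concatLen])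

theorem le_blockCount (hn : ∀ j, 0 < n j) {J N : ℕ} (h : concatLen n J ≤ N) :
    J ≤ blockCount n N :=
  Nat.le_findGreatest ((le_concatLen hn J).trans h) h

theorem lt_concatLen_blockCount_succ (hn : ∀ j, 0 < n j) (N : ℕ) :
    N < concatLen n (blockCount n N + 1) := by
  by_contra! h
  have := le_blockCount hn h
  omega

theorem tendsto_blockCount (hn : ∀ j, 0 < n j) : Tendsto (blockCount n) atTop atTop := by
  rw [tendsto_atTop]
  intro b
  filter_upwards [eventually_ge_atTop (concatLen n b)] with N hN
  exact le_blockCount hn hN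

theorem blockCount_mono (hn : ∀ j, 0 < n j) {M N : ℕ} (h : M ≤ N) :
    blockCount n M ≤ blockCount n N :=
  le_blockCount hn ((concatLen_blockCount_le n M).trans h)

theorem tendsto_concatLen (hn : ∀ j, 0 < n j) :
    Tendsto (fun J => (concatLen n J : ℝ)) atTop atTop :=
  tendsto_atTop_mono (fun J => by exact_mod_cast le_concatLen hn J) tendsto_natCast_atTop_atTop

/-- Weighted Cesàro averages. -/
theorem tendsto_sum_div_concatLen (hn : ∀ j, 0 < n j) {f : ℕ → ℝ} {c : ℝ}
    (hf : Tendsto (fun j => f j / n j) atTop (𝓝 c)) :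
    Tendsto (fun J => (∑ j ∈ Finset.range J, f j) / concatLen n J) atTop (𝓝 c) := by
  have hn' : ∀ j, (n j : ℝ) ≠ 0 := fun j => by exact_mod_cast (hn j).ne'
  have h1 : (fun j => f j - c * n j) =o[atTop] fun j => (n j : ℝ) := by
    rw [Asymptotics.isLittleO_iff_tendsto fun j h => absurd h (hn' j)]
    have := hf.sub_const c
    rw [sub_self] at this
    refine this.congr fun j => ?_
    rw [sub_div, mul_div_cancel_right₀ _ (hn' j)]
  have hcast : (fun J => ∑ j ∈ Finset.range J, (n j : ℝ)) = fun J => (concatLen n J : ℝ) := by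
    funext J; simp [concatLen]
  have h2 := h1.sum_range (fun j => Nat.cast_nonneg _) (by rw [hcast]; exact tendsto_concatLen hn)
  rw [hcast] at h2
  have h3 := h2.tendsto_div_nhds_zero.add_const c
  rw [zero_add] at h3
  refine h3.congr' ?_
  filter_upwards [(tendsto_concatLen hn).eventually_gt_atTop 0] with J hJ
  rw [Finset.sum_sub_distrib, ← Finset.mul_sum, congrFun hcast J]
  field_simp
  ring

theorem tendsto_div_concatLen (hn : ∀ j, 0 < n j) (hlim : Tendsto n atTop atTop) :
    Tendsto (fun J : ℕ => (J : ℝ) / concatLen n J) atTop (𝓝 0) := by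
  have h := tendsto_sum_div_concatLen hn (f := fun _ => 1) (c := 0)
    (((tendsto_natCast_atTop_atTop (R := ℝ)).comp hlim).inv_tendsto_atTop.congr fun j => by simp)
  simpa using h

/-- The concatenation of J blocks has length at least J, while n J ^ 2 ≤ J + K; the quotient is thus
at most (1 + K) / n J. An unfinished block is therefore negligible. -/
theorem tendsto_len_div_concatLen (hn : ∀ j, 0 < n j) (hlim : Tendsto n atTop atTop) {K : ℝ}
    (hK : 0 ≤ K) (hslow : ∀ j, (n j : ℝ) ^ 2 ≤ j + K) :
    Tendsto (fun J : ℕ => (n J : ℝ) / concatLen n J) atTop (𝓝 0) := by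
  have h1 : Tendsto (fun J : ℕ => (1 + K) / (n J : ℝ)) atTop (𝓝 0) :=
    (tendsto_natCast_atTop_atTop.comp hlim).const_div_atTop _
  refine squeeze_zero' (Eventually.of_forall fun J => by positivity) ?_ h1
  filter_upwards [eventually_gt_atTop 0] with J hJ
  have h2 : (J : ℝ) ≤ concatLen n J := by exact_mod_cast le_concatLen hn J
  have h3 : (1 : ℝ) ≤ J := by exact_mod_cast hJ
  have h4 : (0 : ℝ) < n J := by exact_mod_cast hn J
  rw [div_le_div_iff₀ (by linarith) h4]
  have h5 : K * 1 ≤ K * (concatLen n J : ℝ) := by gcongr; linarith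
  nlinarith [hslow J]

/-- Limits along complete blocks are limits along all lengths. -/
theorem tendsto_div_of_blocks (hn : ∀ j, 0 < n j) (hlim : Tendsto n atTop atTop) {K : ℝ}
    (hK : 0 ≤ K) (hslow : ∀ j, (n j : ℝ) ^ 2 ≤ j + K) {S g : ℕ → ℝ} {c K' : ℝ}
    (hS : Tendsto (fun J => S J / concatLen n J) atTop (𝓝 c))
    (hg : ∀ N, |g N - S (blockCount n N)| ≤ K' * (blockCount n N + 1 + n (blockCount n N))) :
    Tendsto (fun N : ℕ => g N / N) atTop (𝓝 c) := by
  have hJ := tendsto_blockCount hn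
  have hT0 : ∀ᶠ N in atTop, (0 : ℝ) < concatLen n (blockCount n N) :=
    hJ.eventually ((tendsto_concatLen hn).eventually_gt_atTop 0)
  have hTN : ∀ N, (concatLen n (blockCount n N) : ℝ) ≤ N := fun N => by
    exact_mod_cast concatLen_blockCount_le n N
  have hNT : ∀ N : ℕ, (N : ℝ) ≤ concatLen n (blockCount n N) + n (blockCount n N) := fun N => by
    have := (lt_concatLen_blockCount_succ hn N).le
    rw [concatLen_succ] at this
    exact_mod_cast this
  have hlen := (tendsto_len_div_concatLen hn hlim hK hslow).comp hJ
  have hcount := (tendsto_div_concatLen hn hlim).comp hJ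
  have hone : Tendsto (fun J => 1 / (concatLen n J : ℝ)) atTop (𝓝 0) :=
    (tendsto_concatLen hn).const_div_atTop 1
  have hratio : Tendsto (fun N : ℕ => (concatLen n (blockCount n N) : ℝ) / N) atTop (𝓝 1) := by
    have h1 := hlen.const_sub 1
    rw [sub_zero] at h1
    refine tendsto_of_tendsto_of_tendsto_of_le_of_le' h1 tendsto_const_nhds ?_ ?_
    · filter_upwards [hT0] with N hN
      have hN0 : (0 : ℝ) < N := hN.trans_le (hTN N)
      have h2 : (n (blockCount n N) : ℝ) / N ≤
          (n (blockCount n N) : ℝ) / concatLen n (blockCount n N) := by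
        gcongr; exact concatLen_blockCount_le n N
      have h3 : 1 ≤ (concatLen n (blockCount n N) : ℝ) / N + (n (blockCount n N) : ℝ) / N := by
        rw [← add_div, le_div_iff₀ hN0, one_mul]; exact hNT N
      simp only [Function.comp]
      linarith
    · exact Eventually.of_forall fun N => div_le_one_of_le₀ (hTN N) (Nat.cast_nonneg _)
  have herr : Tendsto (fun N : ℕ => (g N - S (blockCount n N)) / N) atTop (𝓝 0) := by
    have h1 := (((hcount.add (hone.comp hJ)).add hlen).const_mul |K'|)
    rw [add_zero, add_zero, mul_zero] at h1
    refine squeeze_zero_norm' ?_ h1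
    filter_upwards [hT0] with N hN
    have hN0 : (0 : ℝ) < N := hN.trans_le (hTN N)
    rw [Real.norm_eq_abs, abs_div, Nat.abs_cast]
    simp only [Function.comp]
    rw [← add_div, ← add_div, ← mul_div_assoc]
    have h2 : |g N - S (blockCount n N)| ≤
        |K'| * (blockCount n N + 1 + n (blockCount n N)) :=
      (hg N).trans (by gcongr; exact le_abs_self _)
    calc _ ≤ |K'| * (blockCount n N + 1 + n (blockCount n N)) / N := by gcongr
      _ ≤ _ := by gcongr; exact concatLen_blockCount_le n N
  have h := herr.add ((hS.comp hJ).mul hratio)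
  rw [zero_add, mul_one] at h
  refine h.congr' ?_
  filter_upwards [hT0] with N hN
  simp only [Function.comp]
  rw [div_mul_div_cancel₀ hN.ne', ← add_div, sub_add_cancel]

theorem exists_prefixWord_append (z : Carpet r₁ r₂) {m k : ℕ} (h : m ≤ k) :
    ∃ t, prefixWord z k = prefixWord z m ++ t ∧ t.length = k - m := by
  obtain ⟨j, rfl⟩ := Nat.exists_eq_add_of_le h
  refine ⟨List.ofFn fun i : Fin j => (z.1 (m + i), z.2 (m + i)), ?_, by simp⟩
  simp only [prefixWord]
  rw [List.ofFn_add]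
  rfl

theorem QuasiMul.concat_pos {F : List (Fin r₁ × Fin r₂) → ℝ} (hF : QuasiMul C F)
    {ω : Blocks r₁ r₂ n} (hω : ∀ j, 0 < F (List.ofFn (ω j))) (J : ℕ) : 0 < F (concat ω J) := by
  induction J with
  | zero => exact hF.nil_pos
  | succ J ih => exact hF.append_pos_iff.2 ⟨ih, hω J⟩

theorem QuasiMul.abs_log_concat_sub_le {F : List (Fin r₁ × Fin r₂) → ℝ} (hF : QuasiMul C F)
    {ω : Blocks r₁ r₂ n} (hω : ∀ j, 0 < F (List.ofFn (ω j))) (J : ℕ) :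
    |Real.log (F (concat ω J)) - ∑ j ∈ Finset.range J, Real.log (F (List.ofFn (ω j)))| ≤
      |Real.log (F [])| + J * Real.log C := by
  induction J with
  | zero => simp [concat]
  | succ J ih =>
    have h1 := hF.abs_log_append_le (hF.concat_pos hω (J + 1))
    rw [Finset.sum_range_succ, concat]
    push_cast
    rw [abs_le] at *
    constructor <;> linarith [h1.1, h1.2, ih.1, ih.2]

theorem QuasiMul.prefixWord_pos {F : List (Fin r₁ × Fin r₂) → ℝ} (hF : QuasiMul C F)
    (hn : ∀ j, 0 < n j) (a : Fin r₁ × Fin r₂) {ω : Blocks r₁ r₂ n}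
    (hω : ∀ j, 0 < F (List.ofFn (ω j))) (N : ℕ) : 0 < F (prefixWord (concatPoint a ω) N) := by
  obtain ⟨t, ht, -⟩ := exists_prefixWord_append (concatPoint a ω) (le_concatLen hn N)
  have h := hF.concat_pos hω N
  rw [← prefixWord_concatPoint hn a, ht] at h
  exact (hF.append_pos_iff.1 h).1

/-- Two errors must vanish per letter: log C for each junction, because block lengths tend to
infinity, and the contribution of the unfinished block, because lengths grow slowly. -/
theorem QuasiMul.tendsto_log_prefixWord {F : List (Fin r₁ × Fin r₂) → ℝ} (hF : QuasiMul C F)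
    (hn : ∀ j, 0 < n j) (hlim : Tendsto n atTop atTop) {K : ℝ}
    (hK : 0 ≤ K) (hslow : ∀ j, (n j : ℝ) ^ 2 ≤ j + K) (a : Fin r₁ × Fin r₂)
    {ω : Blocks r₁ r₂ n} (hω : ∀ j, 0 < F (List.ofFn (ω j))) {c : ℝ}
    (hc : Tendsto (fun J => (∑ j ∈ Finset.range J, Real.log (F (List.ofFn (ω j)))) /
      concatLen n J) atTop (𝓝 c)) :
    Tendsto (fun N : ℕ => Real.log (F (prefixWord (concatPoint a ω) N)) / N) atTop (𝓝 c) := by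
  obtain ⟨K0, hK0, hlog⟩ := hF.exists_abs_log_le
  refine tendsto_div_of_blocks (K' := Real.log C + 2 * K0) hn hlim hK hslow hc fun N => ?_
  have hle := concatLen_blockCount_le n N
  have hlt := lt_concatLen_blockCount_succ hn N
  obtain ⟨J, hJ⟩ : ∃ J, blockCount n N = J := ⟨_, rfl⟩
  rw [hJ] at hle hlt ⊢
  rw [concatLen_succ] at hlt
  obtain ⟨t, ht, htl⟩ := exists_prefixWord_append (concatPoint a ω) hle
  have hpos := hF.prefixWord_pos hn a hω N
  rw [ht] at hpos ⊢
  have h1 := hF.abs_log_append_le hpos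
  have h2 := hlog t (hF.append_pos_iff.1 hpos).2
  rw [prefixWord_concatPoint hn] at h1 ⊢
  have h3 := hF.abs_log_concat_sub_le hω J
  have h4 := hlog [] hF.nil_pos
  simp only [List.length_nil, Nat.cast_zero, zero_add, mul_one] at h4
  replace h3 := h3.trans (add_le_add_left h4 _)
  have h5 : (t.length : ℝ) ≤ n J := by exact_mod_cast (by omega : t.length ≤ n J)
  have h6 : K0 * ((t.length : ℝ) + 1) ≤ K0 * (n J + 1) := by gcongr
  have hC0 := hF.log_nonneg
  have h7 : 0 ≤ Real.log C * n J := by positivity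
  have h8 : 0 ≤ K0 * J := by positivity
  have h9 : 0 ≤ K0 * n J := by positivity
  rw [abs_le] at *
  constructor <;> linarith [h1.1, h1.2, h2.1, h2.2, h3.1, h3.2]

end asymptotics

/-! ### Choice of the blocks -/

/-- Independent blocks of slowly growing lengths along which the means of the observables
converge. -/
structure BlockScheme (ψ : List (Fin r₁ × Fin r₂) → ℝ) (n : ℕ → ℕ)
    (p : ℕ → List (Fin r₁ × Fin r₂) → ℝ) (c : Fin 4 → ℝ) : Prop where
  law : ∀ j, BlockLaw ψ (n j) (p j)
  tendsto_len : Tendsto n atTop atTop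
  tendsto_mean : ∀ i, Tendsto (fun j => mean (n j) (p j) (observable ψ (p j) i) / n j) atTop
    (𝓝 (c i))
  slow : ∃ (B : ℕ → ℝ) (K : ℝ), 0 ≤ K ∧ ∀ j, 1 ≤ B j ∧ n j ≤ B j ∧ B j ^ 4 ≤ j + K ∧
    ∀ i w, w.length = n j → |observable ψ (p j) i w| ≤ B j

theorem BlockLaw.abs_mean_le {n : ℕ} {p F : List (Fin r₁ × Fin r₂) → ℝ} (h : BlockLaw ψ n p)
    {R : ℝ} (hF : ∀ w, w.length = n → 0 < p w → |F w| ≤ R) : |mean n p F| ≤ R := by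
  have h1 : |mean n p F| ≤ wsum n fun w => |p w * F w| := Finset.abs_sum_le_sum_abs _ _
  refine h1.trans ?_
  calc (wsum n fun w => |p w * F w|) ≤ wsum n fun w => R * p w := by
        refine wsum_mono fun w hw => ?_
        rw [abs_mul, abs_of_nonneg (h.nonneg w)]
        rcases (h.nonneg w).eq_or_lt with h0 | h0
        · simp [← h0]
        · rw [mul_comm]; gcongr; exact hF w hw h0
    _ = R := by rw [wsum_mul_left, h.sum, mul_one]

/-- Provides compactness for extracting limits of the means. The entropy is at most n log (r₁ r₂),
and p ≤ marginal ≤ 1 places the marginal entropy term between 0 and the entropy. -/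
theorem QuasiMul.exists_abs_mean_le (hψ : QuasiMul C ψ) :
    ∃ R, 0 ≤ R ∧ ∀ n p, BlockLaw ψ n p → ∀ i, |mean n p (observable ψ p i) / n| ≤ R := by
  obtain ⟨K0, hK0, h0⟩ := hψ.fiberSum_one.exists_abs_log_le
  obtain ⟨K1, hK1, h1⟩ := hψ.exists_abs_log_le
  set E := Real.log (r₁ * r₂ : ℝ) with hE
  refine ⟨2 * K0 + 2 * K1 + |E|, by positivity, fun n p h i => ?_⟩
  have hn : (1 : ℝ) ≤ n := by exact_mod_cast h.pos
  rw [abs_div, Nat.abs_cast, div_le_iff₀ (by linarith)]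
  have hK0n : K0 * 1 ≤ K0 * (n : ℝ) := by gcongr
  have hK1n : K1 * 1 ≤ K1 * (n : ℝ) := by gcongr
  have hEn : 0 ≤ |E| * n := by positivity
  have hent := h.entropy_le
  have hE' : n * E ≤ |E| * n := by rw [mul_comm]; gcongr; exact le_abs_self E
  have hm3 : 0 ≤ mean n p (observable ψ p 3) := wsum_nonneg fun w hw => by
    refine mul_nonneg (h.nonneg w) ?_
    simp only [observable, Matrix.cons_val]
    have hl : (w.map Prod.fst).length = n := by simpa using hw
    rw [neg_nonneg]
    refine Real.log_nonpos (wsum_nonneg fun _ _ => h.nonneg _) (h.marginal_le_one hl)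
  have hm32 : mean n p (observable ψ p 3) ≤ mean n p (observable ψ p 2) :=
    wsum_mono fun w hw => by
      rcases (h.nonneg w).eq_or_lt with h2 | h2
      · simp [← h2]
      · refine mul_le_mul_of_nonneg_left ?_ h2.le
        simp only [observable, Matrix.cons_val]
        exact neg_le_neg (Real.log_le_log h2 (h.le_marginal w))
  fin_cases i
  · refine (h.abs_mean_le (R := K0 * (n + 1)) fun w hw hpw => ?_).trans (by linarith)
    have := h0 (w.map Prod.fst) (hψ.fiberSum_pos 1 (h.supp w hpw))
    simpa [observable, hw] using this
  · refine (h.abs_mean_le (R := K1 * (n + 1)) fun w hw hpw => ?_).trans (by linarith)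
    have := h1 w (h.supp w hpw)
    simpa [observable, hw] using this
  · change |mean n p (observable ψ p 2)| ≤ _
    rw [abs_of_nonneg (hm3.trans hm32)]
    linarith
  · change |mean n p (observable ψ p 3)| ≤ _
    rw [abs_of_nonneg hm3]
    linarith

/-- Block laws with precision 1 / (i + 1) control only two combinations of the four means; a
subsequence makes each mean converge. Each law is then repeated long enough for the sizes to satisfy
the growth condition of the law of large numbers. -/
theorem QuasiMul.exists_blockScheme (hψ : QuasiMul C ψ) (h₁ : 2 ≤ r₁) (h₂ : r₁ ≤ r₂)
    (ha : 0 < ψ [a]) {α D : ℝ} (hD : ∀ q, D ≤ α * q - beta ψ q) :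
    ∃ n p c, BlockScheme ψ n p c ∧
      (1 - sExp r₁ r₂) * c 0 + sExp r₁ r₂ * c 1 = -(α * Real.log r₁) ∧
      D * Real.log r₁ ≤ sExp r₁ r₂ * c 2 + (1 - sExp r₁ r₂) * c 3 := by
  have hδ : ∀ i : ℕ, (0 : ℝ) < 1 / ((i : ℝ) + 1) := fun i => by positivity
  choose n p hnN hlaw hen hent using fun i : ℕ => hψ.exists_blockLaw h₁ h₂ ha hD (hδ i) i
  obtain ⟨R, hR, hmean⟩ := hψ.exists_abs_mean_le
  set x : ℕ → Fin 4 → ℝ := fun j i => mean (n j) (p j) (observable ψ (p j) i) / n j with hx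
  obtain ⟨c, -, φ, hφ, hc⟩ := tendsto_subseq_of_bounded
    (Metric.isBounded_closedBall (x := (0 : Fin 4 → ℝ)) (r := R)) (x := x) fun j => by
      rw [mem_closedBall_zero_iff, pi_norm_le_iff_of_nonneg hR]
      exact fun i => hmean _ _ (hlaw j) i
  have hci : ∀ i, Tendsto (fun j => x (φ j) i) atTop (𝓝 (c i)) := fun i =>
    (tendsto_pi_nhds.1 hc) i
  have hδφ : Tendsto (fun j => 1 / (((φ j : ℕ) : ℝ) + 1)) atTop (𝓝 0) :=
    tendsto_one_div_add_atTop_nhds_zero_nat.comp hφ.tendsto_atTop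
  -- One integer dominating the block length, 1, and all four observables on all words of that
  -- length, where the crude sum of absolute values suffices.
  set b : ℕ → ℕ := fun j => n (φ j) + 1 +
    ⌈∑ i, wsum (n (φ j)) fun w => |observable ψ (p (φ j)) i w|⌉₊ with hb
  obtain ⟨θ, hθ, hslow⟩ := exists_slow fun j => b j ^ 4
  refine ⟨fun j => n (φ (θ j)), fun j => p (φ (θ j)), c, ⟨fun j => hlaw _, ?_, fun i =>
    (hci i).comp hθ, fun j => b (θ j), (b 0 ^ 4 : ℕ), Nat.cast_nonneg _, fun j => ⟨?_, ?_, ?_, ?_⟩⟩,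
    ?_, ?_⟩
  · exact tendsto_atTop_mono (fun j => (hφ.le_apply).trans (hnN (φ (θ j)))) hθ
  · change (1 : ℝ) ≤ (b (θ j) : ℝ)
    exact_mod_cast (by simp only [hb]; omega : 1 ≤ b (θ j))
  · change (n (φ (θ j)) : ℝ) ≤ (b (θ j) : ℝ)
    exact_mod_cast (by simp only [hb]; omega : n (φ (θ j)) ≤ b (θ j))
  · change (b (θ j) : ℝ) ^ 4 ≤ j + ((b 0 ^ 4 : ℕ) : ℝ)
    exact_mod_cast hslow j
  · intro i w hw
    have h1 : |observable ψ (p (φ (θ j))) i w| ≤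
        wsum (n (φ (θ j))) fun w => |observable ψ (p (φ (θ j))) i w| := by
      rw [← hw]
      exact le_wsum (f := fun w => |observable ψ (p (φ (θ j))) i w|) (fun _ => abs_nonneg _) w
    have h2 := Finset.single_le_sum (f := fun i => wsum (n (φ (θ j))) fun w =>
      |observable ψ (p (φ (θ j))) i w|) (fun i _ => wsum_nonneg fun _ _ => abs_nonneg _)
      (Finset.mem_univ i)
    refine (h1.trans h2).trans ((Nat.le_ceil _).trans ?_)
    simp only [hb]
    push_cast
    linarith [(Nat.cast_nonneg (n (φ (θ j))) : (0 : ℝ) ≤ _)]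
  · have h1 : Tendsto (fun j => (1 - sExp r₁ r₂) * x (φ j) 0 + sExp r₁ r₂ * x (φ j) 1 +
        α * Real.log r₁) atTop (𝓝 0) := by
      refine squeeze_zero_norm (fun j => ?_) hδφ
      have := hen (φ j)
      rw [add_div, mul_div_assoc, mul_div_assoc] at this
      exact this
    have h2 := (((hci 0).const_mul (1 - sExp r₁ r₂)).add
      ((hci 1).const_mul (sExp r₁ r₂))).add_const (α * Real.log r₁)
    have := tendsto_nhds_unique h2 h1
    linarith
  · have h1 := hδφ.const_sub (D * Real.log r₁)
    rw [sub_zero] at h1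
    refine le_of_tendsto_of_tendsto' h1 (((hci 2).const_mul (sExp r₁ r₂)).add
      ((hci 3).const_mul (1 - sExp r₁ r₂))) fun j => ?_
    have := hent (φ j)
    rw [add_div, mul_div_assoc, mul_div_assoc] at this
    exact this

end

/-! ### The mass distribution principle -/

noncomputable section

variable {r₁ r₂ : ℕ}

/-- The mass distribution principle on the carpet. -/
theorem le_dimH_of_measure_closedBall_le (h₁ : 2 ≤ r₁) (h₂ : r₁ ≤ r₂)
    (m : Measure (Carpet r₁ r₂)) {E : Set (Carpet r₁ r₂)} (hE : m E ≠ 0) {d : NNReal}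
    (hd0 : 0 < d)
    (hd : ∀ z ∈ E, ∀ᶠ N : ℕ in atTop, m (Metric.closedBall z (((r₂ : ℝ)⁻¹) ^ N)) ≤
      ENNReal.ofReal ((((r₂ : ℝ)⁻¹) ^ N) ^ (d : ℝ))) : (d : ℝ≥0∞) ≤ dimH E := by
  have := borelSpace_carpet h₁ (h₁.trans h₂)
  have hr2 : (1 : ℝ) < r₂ := by exact_mod_cast (by omega : 1 < r₂)
  have hr0 : (0 : ℝ) < r₂ := by linarith
  -- Points where the ball estimate holds from index k on. These sets exhaust E, so one of them is
  -- not null; none needs to be measurable.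
  set F : ℕ → Set (Carpet r₁ r₂) := fun k => {z ∈ E | ∀ N, k ≤ N →
    m (Metric.closedBall z (((r₂ : ℝ)⁻¹) ^ N)) ≤
      ENNReal.ofReal ((((r₂ : ℝ)⁻¹) ^ N) ^ (d : ℝ))} with hF
  have hEF : E = ⋃ k, F k := by
    ext z
    simp only [hF, Set.mem_iUnion, Set.mem_ofPred_eq]
    constructor
    · intro hz
      obtain ⟨k, hk⟩ := eventually_atTop.1 (hd z hz)
      exact ⟨k, hz, hk⟩
    · rintro ⟨k, hz, -⟩
      exact hz
  obtain ⟨k, hk⟩ : ∃ k, m (F k) ≠ 0 := by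
    by_contra! h
    apply hE
    rw [hEF]
    exact measure_iUnion_null h
  refine (le_dimH_of_hausdorffMeasure_ne_zero ?_).trans (dimH_mono (s := F k) fun z hz => hz.1)
  set c : ℝ≥0∞ := ENNReal.ofReal ((r₂ : ℝ) ^ (d : ℝ)) with hc
  have hc0 : c ≠ 0 := by
    rw [hc, Ne, ENNReal.ofReal_eq_zero, not_le]; positivity
  have hct : c ≠ ∞ := ENNReal.ofReal_ne_top
  -- The restriction of m to F k, divided by r₂ ^ d. This factor pays for enclosing a set in a ball
  -- whose radius is a power of r₂⁻¹, at most r₂ times its diameter.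
  set o : OuterMeasure (Carpet r₁ r₂) :=
    c⁻¹ • OuterMeasure.restrict (F k) m.toOuterMeasure with ho
  have hle : o ≤ OuterMeasure.mkMetric fun r => r ^ (d : ℝ) := by
    refine OuterMeasure.le_mkMetric _ o (ENNReal.ofReal ((r₂ : ℝ)⁻¹ ^ k)) (by
      rw [ENNReal.ofReal_pos]; positivity) fun S hS => ?_
    have hoS : o S = c⁻¹ * m (S ∩ F k) := by
      rw [ho, smul_apply, OuterMeasure.restrict_apply, smul_eq_mul,
        Measure.coe_toOuterMeasure]
    rw [hoS]
    rcases (S ∩ F k).eq_empty_or_nonempty with h0 | ⟨z, hzS, hz⟩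
    · simp [h0]
    have hball : ∀ N : ℕ, k ≤ N → Metric.ediam S ≤ ENNReal.ofReal ((r₂ : ℝ)⁻¹ ^ N) →
        m (S ∩ F k) ≤ ENNReal.ofReal ((((r₂ : ℝ)⁻¹) ^ N) ^ (d : ℝ)) := by
      intro N hN hSN
      refine (measure_mono fun x hx => ?_).trans (hz.2 N hN)
      have h1 := (Metric.edist_le_ediam_of_mem hx.1 hzS).trans hSN
      rwa [edist_dist, ENNReal.ofReal_le_ofReal_iff (by positivity)] at h1
    have hSt : Metric.ediam S ≠ ∞ := ne_top_of_le_ne_top ENNReal.ofReal_ne_top hS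
    set D := (Metric.ediam S).toReal with hD
    have hDS : Metric.ediam S = ENNReal.ofReal D := (ENNReal.ofReal_toReal hSt).symm
    -- A set of zero diameter lies in arbitrarily small balls, whose masses tend to 0 because d > 0.
    rcases (ENNReal.toReal_nonneg : 0 ≤ D).eq_or_lt with h0 | h0
    · have h1 : m (S ∩ F k) ≤ 0 := by
        have hlim : Tendsto (fun N : ℕ => ENNReal.ofReal ((((r₂ : ℝ)⁻¹) ^ N) ^ (d : ℝ))) atTop
            (𝓝 0) := by
          rw [← ENNReal.ofReal_zero]
          refine (ENNReal.continuous_ofReal.tendsto 0).comp ?_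
          have h2 := (tendsto_pow_atTop_nhds_zero_of_lt_one (by positivity : 0 ≤ (r₂ : ℝ)⁻¹)
            (inv_lt_one_of_one_lt₀ hr2)).rpow_const (p := (d : ℝ)) (Or.inr d.2)
          rwa [Real.zero_rpow (by exact_mod_cast hd0.ne')] at h2
        refine ge_of_tendsto hlim ?_
        filter_upwards [eventually_ge_atTop k] with N hN
        refine hball N hN ?_
        rw [hDS, hD, ← h0]; simp
      rw [nonpos_iff_eq_zero.1 h1]; simp
    · have hDk : D ≤ (r₂ : ℝ)⁻¹ ^ k := by
        rwa [hDS, ENNReal.ofReal_le_ofReal_iff (by positivity)] at hS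
      obtain ⟨N, hN1, hN2⟩ := exists_nat_pow_near_of_lt_one h0
        (hDk.trans (pow_le_one₀ (by positivity) (inv_le_one_of_one_le₀ hr2.le)))
        (by positivity : 0 < (r₂ : ℝ)⁻¹) (inv_lt_one_of_one_lt₀ hr2)
      have hkN : k ≤ N := by
        by_contra! hlt
        have := pow_le_pow_of_le_one (by positivity : 0 ≤ (r₂ : ℝ)⁻¹)
          (inv_le_one_of_one_le₀ hr2.le) (by omega : N + 1 ≤ k)
        linarith
      have h1 := hball N hkN (by rw [hDS]; exact ENNReal.ofReal_le_ofReal hN2)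
      rw [ENNReal.inv_mul_le_iff hc0 hct]
      refine h1.trans ?_
      rw [hDS, ENNReal.ofReal_rpow_of_pos h0, hc, ← ENNReal.ofReal_mul (by positivity)]
      refine ENNReal.ofReal_le_ofReal ?_
      rw [← Real.mul_rpow (by positivity) h0.le]
      refine Real.rpow_le_rpow (by positivity) ?_ d.2
      rw [pow_succ] at hN1
      have h2 := mul_lt_mul_of_pos_left hN1 hr0
      have h3 : (r₂ : ℝ) * ((r₂ : ℝ)⁻¹ ^ N * (r₂ : ℝ)⁻¹) = (r₂ : ℝ)⁻¹ ^ N := by field_simp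
      linarith
  intro h0
  have h1 := hle (F k)
  rw [OuterMeasure.coe_mkMetric] at h1
  change _ ≤ Measure.hausdorffMeasure (d : ℝ) (F k) at h1
  rw [h0, ho, smul_apply, OuterMeasure.restrict_apply, smul_eq_mul, Set.inter_self,
    Measure.coe_toOuterMeasure, nonpos_iff_eq_zero, mul_eq_zero, ENNReal.inv_eq_zero] at h1
  exact h1.elim hct hk

end

/-! ### Lower bound for the level sets and their dimension -/

noncomputable section

variable {r₁ r₂ : ℕ} {ψ : List (Fin r₁ × Fin r₂) → ℝ} {C : ℝ} {a : Fin r₁ × Fin r₂}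
  {μ : Measure (Carpet r₁ r₂)} {K : ℝ}

namespace BlockScheme

variable {n : ℕ → ℕ} {p : ℕ → List (Fin r₁ × Fin r₂) → ℝ} {c : Fin 4 → ℝ}

theorem len_pos (h : BlockScheme ψ n p c) (j : ℕ) : 0 < n j := (h.law j).pos

theorem exists_sq_le (h : BlockScheme ψ n p c) :
    ∃ K : ℝ, 0 ≤ K ∧ ∀ j, (n j : ℝ) ^ 2 ≤ j + K := by
  obtain ⟨B, K, hK, hB⟩ := h.slow
  refine ⟨K, hK, fun j => ?_⟩
  obtain ⟨hB1, hB2, hB4, -⟩ := hB j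
  calc (n j : ℝ) ^ 2 ≤ B j ^ 2 := by gcongr
    _ ≤ B j ^ 4 := pow_le_pow_right₀ hB1 (by norm_num)
    _ ≤ _ := hB4

theorem ae_tendsto (h : BlockScheme ψ n p c) :
    ∀ᵐ ω ∂(blocksLaw n p), ∀ i, Tendsto (fun J => (∑ j ∈ Finset.range J,
      observable ψ (p j) i (List.ofFn (ω j))) / concatLen n J) atTop (𝓝 (c i)) := by
  obtain ⟨B, K, hK, hB⟩ := h.slow
  rw [ae_all_iff]
  intro i
  filter_upwards [ae_tendsto_average_blocks h.law (fun j => observable ψ (p j) i)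
    (fun j => (hB j).1) hK (fun j => (hB j).2.2.1) fun j w hw => (hB j).2.2.2 i w hw] with ω hω
  have h1 := (hω.mul (tendsto_div_concatLen h.len_pos h.tendsto_len)).add
    (tendsto_sum_div_concatLen h.len_pos (h.tendsto_mean i))
  rw [mul_zero, zero_add] at h1
  refine h1.congr' ?_
  filter_upwards [eventually_gt_atTop 0] with J hJ
  have hJ0 : (J : ℝ) ≠ 0 := by exact_mod_cast hJ.ne'
  rw [div_mul_div_cancel₀ hJ0, ← add_div, Finset.sum_sub_distrib, sub_add_cancel]

end BlockScheme

theorem tendsto_comp_baseLen_div (h₁ : 2 ≤ r₁) (h₂ : r₁ ≤ r₂) {g : ℕ → ℝ} {c : ℝ}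
    (hg : Tendsto (fun N : ℕ => g N / N) atTop (𝓝 c)) :
    Tendsto (fun N : ℕ => g (baseLen r₁ r₂ N) / N) atTop (𝓝 (c * (sExp r₁ r₂)⁻¹)) := by
  have hL : Tendsto (baseLen r₁ r₂) atTop atTop :=
    tendsto_atTop_mono (le_baseLen h₁ h₂) tendsto_id
  refine ((hg.comp hL).mul (tendsto_baseLen_div h₁ h₂)).congr' ?_
  filter_upwards [hL.eventually_gt_atTop 0] with N hN
  exact div_mul_div_cancel₀ (by exact_mod_cast hN.ne')

namespace BlockScheme

variable {n : ℕ → ℕ} {p : ℕ → List (Fin r₁ × Fin r₂) → ℝ} {c : Fin 4 → ℝ}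

/-- Typical concatenations belong to the level set. -/
theorem concatPoint_mem_levelSet (h : BlockScheme ψ n p c) (hψ : QuasiMul C ψ) (h₁ : 2 ≤ r₁)
    (h₂ : r₁ ≤ r₂) [IsFiniteMeasure μ] (hK : 1 ≤ K) (hμ1 : ∀ w, μ.real (cylinder w) ≤ K * ψ w)
    (hμ2 : ∀ w, ψ w ≤ K * μ.real (cylinder w)) {α : ℝ}
    (hc : (1 - sExp r₁ r₂) * c 0 + sExp r₁ r₂ * c 1 = -(α * Real.log r₁))
    {ω : Blocks r₁ r₂ n} (hω : ∀ j, 0 < p j (List.ofFn (ω j)))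
    (hlim : ∀ i, Tendsto (fun J => (∑ j ∈ Finset.range J,
      observable ψ (p j) i (List.ofFn (ω j))) / concatLen n J) atTop (𝓝 (c i))) :
    concatPoint a ω ∈ levelSet ψ μ α := by
  obtain ⟨K', hK', hslow⟩ := h.exists_sq_le
  have hs0 := sExp_pos h₁ h₂
  have hl2 : 0 < Real.log r₂ := Real.log_pos (by exact_mod_cast (by omega : 1 < r₂))
  have hωψ : ∀ j, 0 < ψ (List.ofFn (ω j)) := fun j => (h.law j).supp _ (hω j)
  have hωI : ∀ j, 0 < fiberSum ψ 1 ((List.ofFn (ω j)).map Prod.fst) := fun j =>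
    hψ.fiberSum_pos 1 (hωψ j)
  have hz : concatPoint a ω ∈ supp ψ := fun N => hψ.prefixWord_pos h.len_pos a hωψ N
  refine ⟨hz, ?_⟩
  have hA := hψ.tendsto_log_prefixWord h.len_pos h.tendsto_len hK' hslow a hωψ (hlim 1)
  have hU := (hψ.fiberSum_one.comp_map Prod.fst).tendsto_log_prefixWord h.len_pos h.tendsto_len
    hK' hslow a hωI (hlim 0)
  simp only [map_fst_prefixWord] at hU
  have hUL := tendsto_comp_baseLen_div h₁ h₂
    (g := fun N => Real.log (fiberSum ψ 1 (pre (concatPoint a ω).1 N))) hU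
  have hmain := (hA.add hUL).sub hU
  have herr : Tendsto (fun N : ℕ => (Real.log (μ.real (Metric.closedBall (concatPoint a ω)
      (((r₂ : ℝ)⁻¹) ^ N))) - (Real.log (ψ (prefixWord (concatPoint a ω) N)) +
        Real.log (fiberSum ψ 1 (pre (concatPoint a ω).1 (baseLen r₁ r₂ N))) -
        Real.log (fiberSum ψ 1 (pre (concatPoint a ω).1 N)))) / N) atTop (𝓝 0) := by
    refine squeeze_zero_norm (fun N => ?_)
      (tendsto_const_div_atTop_nhds_zero_nat (Real.log (K * C ^ 2)))
    rw [Real.norm_eq_abs, abs_div, Nat.abs_cast]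
    gcongr
    exact hψ.abs_log_closedBall_sub_le h₁ h₂ hK hμ1 hμ2 hz N
  have hfin := ((herr.add hmain).neg.div_const (Real.log r₂))
  have hval : -(0 + (c 1 + c 0 * (sExp r₁ r₂)⁻¹ - c 0)) / Real.log r₂ = α := by
    rw [log_eq_sExp_mul h₁ h₂] at hc
    field_simp
    linarith
  rw [hval] at hfin
  refine hfin.congr fun N => ?_
  rw [Real.logb, ← add_div, ← sub_div, ← add_div, sub_add_cancel, div_neg, neg_div]
  congr 1
  exact div_right_comm _ _ _

/-- Balls centred at typical concatenations have small mass. -/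
theorem eventually_closedBall_le (h : BlockScheme ψ n p c) (h₁ : 2 ≤ r₁) (h₂ : r₁ ≤ r₂)
    {D d : ℝ} (hc : D * Real.log r₁ ≤ sExp r₁ r₂ * c 2 + (1 - sExp r₁ r₂) * c 3) (hd : d < D)
    {ω : Blocks r₁ r₂ n} (hω : ∀ j, 0 < p j (List.ofFn (ω j)))
    (hlim : ∀ i, Tendsto (fun J => (∑ j ∈ Finset.range J,
      observable ψ (p j) i (List.ofFn (ω j))) / concatLen n J) atTop (𝓝 (c i))) :
    ∀ᶠ N : ℕ in atTop, (blocksLaw n p).map (concatPoint a)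
      (Metric.closedBall (concatPoint a ω) (((r₂ : ℝ)⁻¹) ^ N)) ≤
        ENNReal.ofReal ((((r₂ : ℝ)⁻¹) ^ N) ^ d) := by
  obtain ⟨K', hK', hslow⟩ := h.exists_sq_le
  have hs0 := sExp_pos h₁ h₂
  have hr2 : (0 : ℝ) < r₂ := by exact_mod_cast (by omega : 0 < r₂)
  have hl2 : 0 < Real.log r₂ := Real.log_pos (by exact_mod_cast (by omega : 1 < r₂))
  set S : Fin 4 → ℕ → ℝ := fun i J => ∑ j ∈ Finset.range J,
    observable ψ (p j) i (List.ofFn (ω j)) with hS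
  have hSlim : ∀ i, Tendsto (fun N : ℕ => S i (blockCount n N) / N) atTop (𝓝 (c i)) := fun i =>
    tendsto_div_of_blocks (K' := 0) h.len_pos h.tendsto_len hK' hslow (hlim i) fun N => by simp [hS]
  have hL := tendsto_comp_baseLen_div h₁ h₂ (g := fun N => S 3 (blockCount n N)) (hSlim 3)
  have hmain := (hSlim 2).add (hL.sub (hSlim 3))
  -- The decay rate of the ball masses is c 2 on the first N letters plus c 3 on the remaining N
  -- (1/s - 1). It equals (s c 2 + (1 - s) c 3) / s, and log r₁ / s = log r₂.
  have hlt : d * Real.log r₂ < c 2 + (c 3 * (sExp r₁ r₂)⁻¹ - c 3) := by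
    have h3 : D * Real.log r₂ ≤ c 2 + (c 3 * (sExp r₁ r₂)⁻¹ - c 3) := by
      rw [log_eq_sExp_mul h₁ h₂] at hc
      have h4 : c 2 + (c 3 * (sExp r₁ r₂)⁻¹ - c 3) =
          (sExp r₁ r₂ * c 2 + (1 - sExp r₁ r₂) * c 3) / sExp r₁ r₂ := by
        field_simp
      rw [h4, le_div_iff₀ hs0]
      linarith
    exact (mul_lt_mul_of_pos_right hd hl2).trans_le h3
  filter_upwards [hmain.eventually_const_lt hlt, eventually_gt_atTop 0] with N hN hN0
  have hN0' : (0 : ℝ) < N := by exact_mod_cast hN0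
  rw [Measure.map_apply (measurable_concatPoint h₁ (h₁.trans h₂) a)
    (measurableSet_closedBall_pow h₁ h₂ _ N)]
  refine (blocksLaw_preimage_closedBall_le h₁ h₂ h.law a hω
    (blockCount_mono h.len_pos (le_baseLen h₁ h₂ N)) (concatLen_blockCount_le n N)
    (concatLen_blockCount_le n _)).trans (ENNReal.ofReal_le_ofReal ?_)
  rw [← Real.rpow_natCast, ← Real.rpow_mul (by positivity), Real.rpow_def_of_pos (by positivity),
    Real.exp_le_exp, Real.log_inv]
  rw [← sub_div, ← add_div, lt_div_iff₀ hN0'] at hN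
  simp only [hS] at hN
  linarith

end BlockScheme

/-- The lower bound for the dimension of the level sets. -/
theorem QuasiMul.le_dimH_levelSet (hψ : QuasiMul C ψ) (h₁ : 2 ≤ r₁) (h₂ : r₁ ≤ r₂)
    (ha : 0 < ψ [a]) [IsFiniteMeasure μ] (hK : 1 ≤ K)
    (hμ1 : ∀ w, μ.real (cylinder w) ≤ K * ψ w) (hμ2 : ∀ w, ψ w ≤ K * μ.real (cylinder w))
    {α D : ℝ} (hD : ∀ q, D ≤ α * q - beta ψ q) {d : NNReal} (hd0 : 0 < d) (hd : d < D) :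
    (d : ℝ≥0∞) ≤ dimH (levelSet ψ μ α) := by
  obtain ⟨n, p, c, h, hc1, hc2⟩ := hψ.exists_blockScheme h₁ h₂ ha hD
  have := isProbabilityMeasure_blocksLaw h.law
  set m := (blocksLaw n p).map (concatPoint a) with hm
  set E : Set (Carpet r₁ r₂) := {z ∈ levelSet ψ μ α | ∀ᶠ N : ℕ in atTop,
    m (Metric.closedBall z (((r₂ : ℝ)⁻¹) ^ N)) ≤
      ENNReal.ofReal ((((r₂ : ℝ)⁻¹) ^ N) ^ (d : ℝ))} with hE
  have hae : ∀ᵐ ω ∂(blocksLaw n p), concatPoint a ω ∈ E := by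
    filter_upwards [ae_blocksLaw_pos h.law, h.ae_tendsto] with ω hω hlim
    exact ⟨h.concatPoint_mem_levelSet hψ h₁ h₂ hK hμ1 hμ2 hc1 hω hlim,
      h.eventually_closedBall_le h₁ h₂ hc2 hd hω hlim⟩
  have hmE : m E ≠ 0 := by
    -- E is not known to be measurable; this inequality for the image measure holds for arbitrary
    -- sets.
    have h1 := Measure.le_map_apply
      (measurable_concatPoint h₁ (h₁.trans h₂) a).aemeasurable (μ := blocksLaw n p) E
    have h2 : blocksLaw n p (concatPoint a ⁻¹' E) = 1 :=
      (measure_congr (eventuallyEq_univ.2 hae)).trans measure_univ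
    rw [h2] at h1
    exact (zero_lt_one.trans_le h1).ne'
  exact (le_dimH_of_measure_closedBall_le h₁ h₂ m hmE hd0 fun z hz => hz.2).trans
    (dimH_mono fun z hz => hz.1)

/-- The dimension of the level sets. -/
theorem QuasiMul.dimH_levelSet_eq (hψ : QuasiMul C ψ) (h₁ : 2 ≤ r₁) (h₂ : r₁ ≤ r₂)
    (ha : 0 < ψ [a]) [IsFiniteMeasure μ] (hK : 1 ≤ K)
    (hμ1 : ∀ w, μ.real (cylinder w) ≤ K * ψ w) (hμ2 : ∀ w, ψ w ≤ K * μ.real (cylinder w))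
    {α : ℝ} (hα : 0 < legendre (beta ψ) α) :
    ((dimH (levelSet ψ μ α) : ℝ≥0∞) : EReal) = legendre (beta ψ) α := by
  have hle : ∀ q, legendre (beta ψ) α ≤ ((α * q - beta ψ q : ℝ) : EReal) := fun q => iInf_le _ q
  have htop : legendre (beta ψ) α ≠ ⊤ := ne_top_of_le_ne_top (EReal.coe_ne_top _) (hle 0)
  have hbot : legendre (beta ψ) α ≠ ⊥ := (bot_lt_of_lt hα).ne'
  obtain ⟨D, hD⟩ : ∃ D : ℝ, (D : EReal) = legendre (beta ψ) α :=
    ⟨_, EReal.coe_toReal htop hbot⟩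
  rw [← hD] at hα hle ⊢
  have hD0 : 0 < D := by exact_mod_cast hα
  have hDq : ∀ q, D ≤ α * q - beta ψ q := fun q => by exact_mod_cast hle q
  have hdim : dimH (levelSet ψ μ α) = ENNReal.ofReal D := by
    refine le_antisymm ?_ ?_
    · refine le_of_forall_gt fun e he => ?_
      rcases eq_or_ne e ∞ with rfl | het
      · have h1 : α * 0 - beta ψ 0 < (Real.toNNReal (α * 0 - beta ψ 0 + 1) : ℝ) := by
          rw [Real.coe_toNNReal _ (by linarith [hDq 0])]; linarith
        exact (hψ.dimH_levelSet_le h₁ h₂ ha hK hμ1 hμ2 h1).trans_lt ENNReal.coe_lt_top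
      · lift e to NNReal using het
        have hDe : D < e := (ENNReal.ofReal_lt_coe_iff hD0.le).1 he
        obtain ⟨d, hd1, hd2⟩ := exists_between hDe
        have h1 : legendre (beta ψ) α < (d : EReal) := by rw [← hD]; exact_mod_cast hd1
        obtain ⟨q, hq⟩ := iInf_lt_iff.1 h1
        have h2 : α * q - beta ψ q < ((⟨d, by linarith⟩ : NNReal) : ℝ) := by exact_mod_cast hq
        refine (hψ.dimH_levelSet_le h₁ h₂ ha hK hμ1 hμ2 h2).trans_lt ?_
        exact ENNReal.coe_lt_coe.2 (NNReal.coe_lt_coe.1 hd2)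
    · refine le_of_forall_lt fun e he => ?_
      obtain ⟨d, hd1, hd2⟩ := ENNReal.lt_iff_exists_nnreal_btwn.1 he
      have hdD : (d : ℝ) < D := by
        rwa [← ENNReal.ofReal_coe_nnreal, ENNReal.ofReal_lt_ofReal_iff hD0] at hd2
      have hd0 : 0 < d := ENNReal.coe_pos.1 (bot_le.trans_lt hd1)
      exact hd1.trans_le (hψ.le_dimH_levelSet h₁ h₂ ha hK hμ1 hμ2 hDq hd0 hdD)
  rw [hdim, EReal.coe_ennreal_ofReal, max_eq_left hD0.le]

end

end SelfAffine

theorem theorem3p2 (r₁ r₂ : ℕ) (h₁ : 2 ≤ r₁) (h₂ : r₁ ≤ r₂)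
    (ψ : List (Fin r₁ × Fin r₂) → ℝ) (hψ : SelfAffine.AlmostMultiplicative ψ)
    (hP : SelfAffine.pressure ψ = 0)
    (μ : Measure (SelfAffine.Carpet r₁ r₂)) (hμ : SelfAffine.IsGibbsMeasure ψ μ) :
    (∀ q : ℝ, ∃ P : ℝ,
      Tendsto (SelfAffine.pressureSeq (SelfAffine.weight ψ q)) atTop (𝓝 P)) ∧
    ConcaveOn ℝ Set.univ (SelfAffine.beta ψ) ∧
    Differentiable ℝ (SelfAffine.beta ψ) ∧
    Monotone (SelfAffine.beta ψ) ∧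
    ∀ α : ℝ, 0 ≤ α →
      (0 < SelfAffine.legendre (SelfAffine.beta ψ) α →
        ((dimH (SelfAffine.levelSet ψ μ α) : ℝ≥0∞) : EReal) =
          SelfAffine.legendre (SelfAffine.beta ψ) α) ∧
      (SelfAffine.legendre (SelfAffine.beta ψ) α < 0 →
        SelfAffine.levelSet ψ μ α = ∅) := by
  obtain ⟨C, hq⟩ := hψ.quasiMul
  have hprob := hμ.isProbabilityMeasure
  obtain ⟨z, hz⟩ := hμ.ae_mem_supp.exists
  -- A letter in the support keeps every partition function positive, so that pressures are genuine
  -- limits of logarithms of positive sums.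
  obtain ⟨a, ha⟩ : ∃ a, 0 < ψ [a] := ⟨_, by simpa [SelfAffine.prefixWord] using hz 1⟩
  obtain ⟨K₀, hK₀, hb⟩ := hμ.bounds
  have hK : 1 ≤ max K₀ 1 := le_max_right _ _
  simp only [hP, mul_zero, Real.exp_zero, one_mul] at hb
  have hμ1 : ∀ w, μ.real (SelfAffine.cylinder w) ≤ max K₀ 1 * ψ w := fun w =>
    (hb w).2.trans (mul_le_mul_of_nonneg_right (le_max_left _ _) (hψ.nonneg w))
  have hμ2 : ∀ w, ψ w ≤ max K₀ 1 * μ.real (SelfAffine.cylinder w) := fun w => by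
    have h := (inv_mul_le_iff₀ hK₀).1 (hb w).1
    exact h.trans (mul_le_mul_of_nonneg_right (le_max_left _ _) measureReal_nonneg)
  have hl1 : 0 < Real.log r₁ := Real.log_pos (by exact_mod_cast (by omega : 1 < r₁))
  -- Zero pressure turns the uniform error bound into a bound on the partition functions themselves,
  -- which is the source of monotonicity.
  have hD : ∀ n, SelfAffine.wsum n ψ ≤ C := fun n => by
    have h := hq.abs_log_wsum_sub_le ha n
    rw [hP, mul_zero, sub_zero] at h
    exact (Real.log_le_log_iff (hq.wsum_pos ha n) hq.pos).1 (le_of_abs_le h)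
  have hanti := hq.pressure_weight_antitone h₁ h₂ ha hq.one_le hD
  refine ⟨fun q => ⟨_, hq.tendsto_pressure_weight h₁ h₂ ha q⟩, ?_, fun q => ?_, fun q q' h => ?_,
    fun α _ => ⟨fun hα => hq.dimH_levelSet_eq h₁ h₂ ha hK hμ1 hμ2 hα, fun hα => ?_⟩⟩
  · have h := (hq.convexOn_pressure h₁ h₂ ha).neg.smul (inv_nonneg.2 hl1.le)
    have he : SelfAffine.beta ψ = fun q => (Real.log r₁)⁻¹ •
        (-fun q => SelfAffine.pressure (SelfAffine.weight ψ q)) q := by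
      funext q
      rw [SelfAffine.beta, div_eq_inv_mul]
      rfl
    rw [he]
    exact h
  · obtain ⟨lam, h⟩ := hq.hasDerivAt_pressure h₁ h₂ ha q
    exact (h.neg.div_const (Real.log r₁)).differentiableAt
  · exact div_le_div_of_nonneg_right (neg_le_neg (hanti h)) hl1.le
  · obtain ⟨q, hq'⟩ := iInf_lt_iff.1 hα
    exact hq.levelSet_eq_empty h₁ h₂ ha hK hμ1 hμ2 (by exact_mod_cast hq')
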